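/- Write $\mathbf e_i=(\cos\frac{i\pi}{4},\sin\frac{i\pi}{4})$ with indices modulo $8$. For $x\in\mathbb R^2$ and $s>0$ let $O(x,s)$ be the solid regular octagon with centre $x$, edge length $s$ and vertices $v_i=x+\frac{s}{\sqrt2}(\mathbf e_i+\mathbf e_{i+1})$ $(0\le i\le 7)$, and cut it into the eight pieces $O_i(x,s)=O(x,s)\cap\{x+\lambda\mathbf e_i+\mu\mathbf e_{i+1}:\lambda,\mu\ge 0\}\ni v_i$. Put $s_n=(\sqrt2-1)^{n+1}$, let $C_0=\mathbb Z^2$, let $C_{n+1}$ be the set of all vertices of the octagons $O(x,s_n)$, $x\in C_n$, and let $P_n=\bigcup_{x\in C_n}O(x,s_n)$. The pieces are coloured red or white, and each vertex $v_i$ of an octagon has the colour of the piece $O_i$ containing it. For $n=0$ the octagon $O(0,s_0)$ is red and all others are white. For $y\in C_{n+1}$ consider all octagons $O(x,s_n)$, $x\in C_n$, of which $y$ is a vertex. If $y$ has the same colour as a vertex of all of them, then $O(y,s_{n+1})$ is entirely of that colour. If $y$ is a red vertex of one of them and a white vertex of another, then the pieces of $O(y,s_{n+1})$ are alternately red and white,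 and the piece facing the centre of the large octagon of which $y$ is a red vertex is red. Let $R_n$ be the union of the red pieces of the octagons $O(x,s_n)$, $x\in C_n$, and put $$F_0=O(0,s_0),\qquad F_{n+1}=\overline{(F_n\setminus P_{n+1})\cup R_{n+1}}.$$ **Proposition (Elser).** Let $F_\square$ be the closure of the set of all points which belong to $F_n$ for all sufficiently large $n$. Then $F_\square$ is compact, $F_n\to F_\square$ in the Hausdorff metric, $F_\square$ is a fundamental cell of the square lattice $\mathbb Z^2$, and its symmetry group is $S(F_\square)=D_8$. Here $S(X)$ is the group of all isometries of $\mathbb R^2$ mapping $X$ onto itself, and $D_8$ is the dihedral group of order $16$ generated by the rotation about the origin through $\pi/4$ and the reflection in the first coordinate axis. A set $F$ is a fundamental cell of a lattice $\Gamma$ if $F=\overline D$ for a set $D$ which contains exactly one point of each coset of $\Gamma$ and is contained in the closure of its interior, and if the translates $F+g$, $g\in\Gamma$, cover $\mathbb R^2$ and have pairwise disjoint interiors. -/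

import Mathlib

open Filter Topology

noncomputable section

namespace Elser

/-- The Euclidean plane. -/
abbrev Plane : Type := EuclideanSpace ℝ (Fin 2)

/-! ### Lattices, tilings, fundamental cells -/

/-- The square lattice `ℤ²`. -/
def squareLattice : AddSubgroup Plane where
  carrier := {v | ∀ i, ∃ m : ℤ, v i = m}
  zero_mem' := fun _ => ⟨0, by simp⟩
  add_mem' := by
    intro a b ha hb i
    obtain ⟨m, hm⟩ := ha i
    obtain ⟨k, hk⟩ := hb i
    exact ⟨m + k, by simp [hm, hk]⟩
  neg_mem' := by
    intro a ha i
    obtain ⟨m, hm⟩ := ha i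
    exact ⟨-m, by simp [hm]⟩

/-- The translate `F + g`. -/
def translate (F : Set Plane) (g : Plane) : Set Plane := (fun x => x + g) '' F

/-- `F` tiles the plane under `Γ`: the translates `F + g`, `g ∈ Γ`, cover the plane, and
distinct ones have disjoint interiors. -/
def TilesUnder (Γ : AddSubgroup Plane) (F : Set Plane) : Prop :=
  (⋃ g : Γ, translate F g) = Set.univ ∧
    ∀ g h : Γ, g ≠ h →
      Disjoint (interior (translate F g)) (interior (translate F h))

/-- `F` is a fundamental cell of `Γ`: it is the closure of a set `D` containing exactly one point
of every coset of `Γ` (a copy in the plane of the quotient by `Γ`), where every point of `D` is a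
limit of interior points of `D`; and the translates of `F` by `Γ` tile the plane. -/
def IsFundamentalCell (Γ : AddSubgroup Plane) (F : Set Plane) : Prop :=
  (∃ D : Set Plane, (∀ x : Plane, ∃! g : Γ, x + (g : Plane) ∈ D) ∧
      D ⊆ closure (interior D) ∧ F = closure D) ∧
    TilesUnder Γ F

/-! ### Symmetry groups -/

/-- The group of all isometries of the plane which map `X` onto itself. -/
def symmetryGroup (X : Set Plane) : Subgroup (Plane ≃ᵢ Plane) where
  carrier := {φ | φ '' X = X}
  one_mem' := by
    change (fun x : Plane => x) '' X = X
    simp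
  mul_mem' := by
    intro φ ψ hφ hψ
    change (fun x => φ (ψ x)) '' X = X
    rw [← Set.image_image (fun x => φ x) (fun x => ψ x), Set.mem_ofPred_eq.mp hψ,
      Set.mem_ofPred_eq.mp hφ]
  inv_mem' := by
    intro φ hφ
    change φ.symm '' X = X
    conv_lhs => rw [← Set.mem_ofPred_eq.mp hφ]
    rw [Set.image_image]
    simp

/-- The rotation about the origin through the angle `θ`, in coordinates. -/
def rotMap (θ : ℝ) (v : Plane) : Plane :=
  !₂[Real.cos θ * v 0 - Real.sin θ * v 1, Real.sin θ * v 0 + Real.cos θ * v 1]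

/-- The reflection in the first coordinate axis, in coordinates. -/
def reflMap (v : Plane) : Plane := !₂[v 0, - v 1]

theorem rotMap_neg_right (θ : ℝ) (v : Plane) : rotMap θ (rotMap (-θ) v) = v := by
  have h := Real.sin_sq_add_cos_sq θ
  ext i
  fin_cases i
  · simp [rotMap]
    linear_combination (v 0) * h
  · simp [rotMap]
    linear_combination (v 1) * h

theorem isometry_rotMap (θ : ℝ) : Isometry (rotMap θ) := by
  refine Isometry.of_dist_eq fun v w => ?_
  have h := Real.sin_sq_add_cos_sq θ
  rw [EuclideanSpace.dist_eq, EuclideanSpace.dist_eq]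
  congr 1
  simp only [Fin.sum_univ_two, Real.dist_eq, sq_abs]
  simp [rotMap]
  linear_combination ((v 0 - w 0) ^ 2 + (v 1 - w 1) ^ 2) * h

theorem isometry_reflMap : Isometry reflMap := by
  refine Isometry.of_dist_eq fun v w => ?_
  rw [EuclideanSpace.dist_eq, EuclideanSpace.dist_eq]
  congr 1
  simp only [Fin.sum_univ_two, Real.dist_eq, sq_abs]
  simp [reflMap]
  ring

/-- The rotation about the origin through the angle `θ`, as an isometry. -/
def rotation (θ : ℝ) : Plane ≃ᵢ Plane :=
  IsometryEquiv.mk' (rotMap θ) (rotMap (-θ)) (rotMap_neg_right θ) (isometry_rotMap θ)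

/-- The reflection in the first coordinate axis, as an isometry. -/
def reflection : Plane ≃ᵢ Plane :=
  IsometryEquiv.mk' reflMap reflMap
    (fun v => by ext i; fin_cases i <;> simp [reflMap]) isometry_reflMap

/-- The dihedral group `D_n` of order `2 n` (for `n ≥ 1`), as a group of isometries fixing the
origin: it is generated by the rotation through `2 π / n` and the reflection in the first axis. -/
def dihedral (n : ℕ) : Subgroup (Plane ≃ᵢ Plane) :=
  Subgroup.closure {rotation (2 * Real.pi / n), reflection}

/-! ### Octagons and their pieces -/

/-- The eight unit vectors `e_i = (cos (i π / 4), sin (i π / 4))`; indices are modulo `8`. -/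
def e (i : Fin 8) : Plane :=
  !₂[Real.cos ((i : ℕ) * (Real.pi / 4)), Real.sin ((i : ℕ) * (Real.pi / 4))]

/-- The `i`-th vertex of the regular octagon with centre `x` and edge length `s`, two of whose
edges are horizontal. -/
def octVertex (s : ℝ) (x : Plane) (i : Fin 8) : Plane := x + (s / √2) • (e i + e (i + 1))

/-- The (solid) regular octagon with centre `x` and edge length `s`. -/
def octagon (s : ℝ) (x : Plane) : Set Plane := convexHull ℝ (Set.range (octVertex s x))

/-- The cone with apex `x` spanned by `v` and `w`. -/
def cone (x v w : Plane) : Set Plane :=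
  {p | ∃ a b : ℝ, 0 ≤ a ∧ 0 ≤ b ∧ p = x + (a • v + b • w)}

/-- The `i`-th of the eight pieces of an octagon; it is the piece containing the `i`-th vertex. -/
def piece (s : ℝ) (x : Plane) (i : Fin 8) : Set Plane :=
  octagon s x ∩ cone x (e i) (e (i + 1))

/-! ### The octagon packings and their colouring -/

/-- The edge length `(√2 - 1) ^ (n + 1)` of the octagons of the `n`-th packing. -/
def edge (n : ℕ) : ℝ := (√2 - 1) ^ (n + 1)

/-- The centres of the octagons of the `n`-th packing: the lattice points for `n = 0`, and the
vertices of the octagons of the previous packing otherwise. -/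
def centres : ℕ → Set Plane
  | 0 => squareLattice
  | n + 1 => {y | ∃ x ∈ centres n, ∃ i, y = octVertex (edge n) x i}

/-- The part of the plane covered by the octagons of the `n`-th packing. -/
def packing (n : ℕ) : Set Plane := ⋃ x ∈ centres n, octagon (edge n) x

/-- Colouring rule. Given an octagon packing with set of centres `C` and edge length `s`, where
`red x i` says that the `i`-th piece (hence the `i`-th vertex) of the octagon with centre `x` is
red, this determines the red pieces of the next smaller octagon with centre `y`.
The point `y` is a vertex of a large octagon exactly when `octVertex s y k ∈ C` for some `k`: this
is the centre of that octagon, which has `y` as its vertex number `k + 4`.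
If `y` is a red vertex of all these large octagons, all pieces are red. If `y` is a red vertex of
one of them and a white vertex of another, the red and white pieces alternate, and the piece facing
the large octagon which has `y` as a red vertex is red. Otherwise all pieces are white. -/
def nextRed (s : ℝ) (C : Set Plane) (red : Plane → Fin 8 → Prop) (y : Plane) (j : Fin 8) : Prop :=
  ∃ k, octVertex s y k ∈ C ∧ red (octVertex s y k) (k + 4) ∧
    ((∀ l, octVertex s y l ∈ C → red (octVertex s y l) (l + 4)) ∨
      (j : ℕ) % 2 = (k : ℕ) % 2)

/-- `isRed n x i`: the `i`-th piece of the octagon with centre `x` of the `n`-th packing is red.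
In the packing number `0` exactly the octagon centred at the origin is red. -/
def isRed : ℕ → Plane → Fin 8 → Prop
  | 0 => fun x _ => x = 0
  | n + 1 => nextRed (edge n) (centres n) (isRed n)

/-- The union of the red pieces of the octagons of the `n`-th packing. -/
def redPart (n : ℕ) : Set Plane :=
  ⋃ x ∈ centres n, ⋃ i ∈ {i : Fin 8 | isRed n x i}, piece (edge n) x i

/-- The `n`-th approximation `F_n` of the cell. -/
def stage : ℕ → Set Plane
  | 0 => octagon (edge 0) 0
  | n + 1 => closure ((stage n \ packing (n + 1)) ∪ redPart (n + 1))

/-- The cell: the closure of the set of all points which lie in `F_n` for all large `n`. -/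
def cell : Set Plane := closure {p | ∀ᶠ n in atTop, p ∈ stage n}

end Elser

end

noncomputable section

namespace Elser

/-! Rescaled differences of octagon centres lie in `½ℤ[ζ₈]`, and the short ones form a finite list
that reproduces itself from level to level (`trichotomy`). Hence incidences of vertices and octagons
are integer identities, settled by `decide`. In particular a point is a vertex of at most two
octagons, with vertex numbers of opposite parity.

Tiling. Let the colour of a piece be the `g ∈ ℤ²` whose translate by `-g` makes the piece red. Two
colours meeting at a vertex share the new pieces according to parity, so by induction each piece has
exactly one colour (`exists_colour`, `colour_unique`). The open set `redLimit` consists of interior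
points of red pieces which, with a neighbourhood, meet no later octagon. Its translates are disjoint
(`colours_disjoint`) and have dense union (`dense_coloured`), because the octagons are dense and
every piece survives near its centre. As `cell = closure redLimit` (`cell_eq`) is compact, its
translates tile.

Convergence. `stage n` is the closure of `redOpen n` (`stage_eq`). When a red point is covered for
the first time, the covering octagon carries red or is next to one that does (`covers_red`). So red
never disappears without leaving red points at a distance of order `rho ^ n`.

Symmetry. The lattice has only fourfold rotations, and the colouring rule also consults octagons
that do not descend from the origin. These affect the red pieces only at the eight tips, where the
colouring alternates in any case (`isRed_succ_descendants`), and red points are first covered by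
descendants. The descendants have the symmetry `D₈`, so the cell has it too. Conversely, the points
of the cell farthest from the origin are the eight points `apex i`; an isometry of the cell permutes
them and fixes the origin, hence lies in `D₈`. -/

theorem sqrt_two_sq : √2 * √2 = (2 : ℝ) := Real.mul_self_sqrt (by norm_num)

theorem one_lt_sqrt_two' : (1 : ℝ) < √2 := by
  rw [Real.lt_sqrt (by norm_num)]; norm_num

theorem sqrt_two_gt : (1.414 : ℝ) < √2 := Real.lt_sqrt_of_sq_lt (by norm_num)

theorem sqrt_two_lt : √2 < (1.415 : ℝ) := by
  rw [Real.sqrt_lt' (by norm_num)]; norm_num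

/-! ### The eight unit vectors and their inner products. -/

/-- The inner product with `e l`. -/
def ip (l : Fin 8) : Plane →L[ℝ] ℝ := innerSL ℝ (e l)

theorem e_zero : e 0 = !₂[1, 0] := by simp [e]
theorem e_one : e 1 = !₂[√2 / 2, √2 / 2] := by simp [e]
theorem e_two : e 2 = !₂[0, 1] := by
  have : (2 : ℝ) * (Real.pi / 4) = Real.pi / 2 := by ring
  simp [e, this]
theorem e_three : e 3 = !₂[-(√2 / 2), √2 / 2] := by
  have : (3 : ℝ) * (Real.pi / 4) = Real.pi - Real.pi / 4 := by ring
  simp [e, this]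
theorem e_four : e 4 = !₂[-1, 0] := by
  have : (4 : ℝ) * (Real.pi / 4) = Real.pi := by ring
  simp [e, this]
theorem e_five : e 5 = !₂[-(√2 / 2), -(√2 / 2)] := by
  have : (5 : ℝ) * (Real.pi / 4) = Real.pi / 4 + Real.pi := by ring
  simp [e, this, Real.cos_add_pi, Real.sin_add_pi]
theorem e_six : e 6 = !₂[0, -1] := by
  have : (6 : ℝ) * (Real.pi / 4) = Real.pi / 2 + Real.pi := by ring
  simp [e, this, Real.cos_add_pi, Real.sin_add_pi]
theorem e_seven : e 7 = !₂[√2 / 2, -(√2 / 2)] := by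
  have : (7 : ℝ) * (Real.pi / 4) = (Real.pi - Real.pi / 4) + Real.pi := by ring
  simp [e, this, Real.cos_add_pi, Real.sin_add_pi]

theorem forall_fin_eight {P : Fin 8 → Prop} (h0 : P 0) (h1 : P 1) (h2 : P 2) (h3 : P 3) (h4 : P 4)
    (h5 : P 5) (h6 : P 6) (h7 : P 7) (i : Fin 8) : P i := by
  fin_cases i <;> assumption

theorem e_add_four (l : Fin 8) : e (l + 4) = -e l := by
  revert l
  apply forall_fin_eight <;> ext k <;> fin_cases k <;>
    simp [e_zero, e_one, e_two, e_three, e_four, e_five, e_six, e_seven]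

theorem e_add_two (l : Fin 8) : e l + e (l + 2) = √2 • e (l + 1) := by
  have h := sqrt_two_sq
  revert l
  apply forall_fin_eight <;> ext k <;> fin_cases k <;>
    simp [e_zero, e_one, e_two, e_three, e_four, e_five, e_six, e_seven] <;> linarith

theorem ip_apply (l : Fin 8) (p : Plane) : ip l p = p 0 * e l 0 + p 1 * e l 1 := by
  simp [ip, PiLp.inner_apply, Fin.sum_univ_two]

theorem ip_zero (p : Plane) : ip 0 p = p 0 := by simp [ip_apply, e_zero]
theorem ip_two (p : Plane) : ip 2 p = p 1 := by simp [ip_apply, e_two]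

theorem ip_add_four (l : Fin 8) (p : Plane) : ip (l + 4) p = -ip l p := by
  simp [ip, e_add_four]

theorem ip_add_two (l : Fin 8) (p : Plane) : ip l p + ip (l + 2) p = √2 * ip (l + 1) p := by
  have := congrArg (fun w => inner ℝ w p) (e_add_two l)
  simpa [ip, inner_add_left, inner_smul_left] using this

/-- All inner products in terms of the two that describe the cone number `i`. -/
theorem ip_table (i : Fin 8) (p : Plane) :
    ip i p = √2 * ip (i - 1) p + ip (i + 2) p ∧ ip (i + 1) p = ip (i - 1) p + √2 * ip (i + 2) p ∧
      ip (i + 3) p = -ip (i - 1) p ∧ ip (i + 4) p = -(√2 * ip (i - 1) p + ip (i + 2) p) ∧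
      ip (i + 5) p = -(ip (i - 1) p + √2 * ip (i + 2) p) ∧ ip (i + 6) p = -ip (i + 2) p := by
  have a1 := ip_add_two (i - 1) p
  have a2 := ip_add_two i p
  have a3 := ip_add_four (i - 1) p
  have a4 := ip_add_four i p
  have a5 := ip_add_four (i + 1) p
  have a6 := ip_add_four (i + 2) p
  rw [show i - 1 + 2 = i + 1 by grind, show i - 1 + 1 = i by grind] at a1
  rw [show i - 1 + 4 = i + 3 by grind] at a3
  rw [show i + 1 + 4 = i + 5 by grind] at a5
  rw [show i + 2 + 4 = i + 6 by grind] at a6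
  have h := sqrt_two_sq
  have b1 : ip i p = √2 * ip (i - 1) p + ip (i + 2) p := by
    linear_combination -ip i p * h + (-√2) * a1 - a2
  have b2 : ip (i + 1) p = ip (i - 1) p + √2 * ip (i + 2) p := by
    linear_combination -ip (i + 1) p * h - a1 - √2 * a2
  exact ⟨b1, b2, a3, by rw [a4, b1], by rw [a5, b2], a6⟩

/-! ### Vertices -/

/-- The direction of the `i`-th vertex: the vertices of an octagon of edge length `s` with centre
`x` are `x + s • v i`. -/
def v (i : Fin 8) : Plane := (√2 / 2) • (e i + e (i + 1))

theorem octVertex_eq (s : ℝ) (x : Plane) (i : Fin 8) : octVertex s x i = x + s • v i := by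
  have h : s / √2 = s * (√2 / 2) := by
    have : √2 ≠ 0 := by positivity
    field_simp; rw [sq, sqrt_two_sq]
  rw [octVertex, v, smul_smul, h]

theorem v_add_four (i : Fin 8) : v (i + 4) = -v i := by
  have : i + 4 + 1 = i + 1 + 4 := by grind
  rw [v, v, this, e_add_four, e_add_four]; simp [add_comm]

/-! ### Exact arithmetic in the ring generated by the unit vectors -/

/-- `toVec z` is half the combination of `e 0, …, e 3` with integer coefficients `z`. -/
def toVec (z : ℤ × ℤ × ℤ × ℤ) : Plane :=
  (1 / 2 : ℝ) • ((z.1 : ℝ) • e 0 + (z.2.1 : ℝ) • e 1 + (z.2.2.1 : ℝ) • e 2 + (z.2.2.2 : ℝ) • e 3)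

/-- The coefficients of `√2 • z`. -/
def mulR (z : ℤ × ℤ × ℤ × ℤ) : ℤ × ℤ × ℤ × ℤ :=
  (z.2.1 - z.2.2.2, z.1 + z.2.2.1, z.2.1 + z.2.2.2, z.2.2.1 - z.1)

/-- The coefficients of `e l`. -/
def eZ (l : Fin 8) : ℤ × ℤ × ℤ × ℤ :=
  match l with
  | 0 => (2, 0, 0, 0) | 1 => (0, 2, 0, 0) | 2 => (0, 0, 2, 0) | 3 => (0, 0, 0, 2)
  | 4 => (-2, 0, 0, 0) | 5 => (0, -2, 0, 0) | 6 => (0, 0, -2, 0) | 7 => (0, 0, 0, -2)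

/-- The coefficients of `v i`. -/
def vZ (i : Fin 8) : ℤ × ℤ × ℤ × ℤ :=
  match i with
  | 0 => (1, 1, 1, -1) | 1 => (1, 1, 1, 1) | 2 => (-1, 1, 1, 1) | 3 => (-1, -1, 1, 1)
  | 4 => (-1, -1, -1, 1) | 5 => (-1, -1, -1, -1) | 6 => (1, -1, -1, -1) | 7 => (1, 1, -1, -1)

/-- Coefficients `(P, Q)` of `2 * ip l (toVec z) = P + Q * (√2 / 2)`. -/
def ipZ (l : Fin 8) (z : ℤ × ℤ × ℤ × ℤ) : ℤ × ℤ :=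
  match l with
  | 0 => (z.1, z.2.1 - z.2.2.2) | 1 => (z.2.1, z.1 + z.2.2.1)
  | 2 => (z.2.2.1, z.2.1 + z.2.2.2) | 3 => (z.2.2.2, z.2.2.1 - z.1)
  | 4 => (-z.1, z.2.2.2 - z.2.1) | 5 => (-z.2.1, -z.1 - z.2.2.1)
  | 6 => (-z.2.2.1, -z.2.1 - z.2.2.2) | 7 => (-z.2.2.2, z.1 - z.2.2.1)

/-- A decidable sufficient condition for `0 ≤ P + Q * √2`. -/
def surdNonneg (P Q : ℤ) : Prop :=
  (0 ≤ P ∧ 0 ≤ Q) ∨ (0 ≤ P ∧ 2 * Q * Q ≤ P * P) ∨ (0 ≤ Q ∧ P * P ≤ 2 * Q * Q)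

instance (P Q : ℤ) : Decidable (surdNonneg P Q) := by unfold surdNonneg; infer_instance

theorem surdNonneg.nonneg {P Q : ℤ} (h : surdNonneg P Q) : (0 : ℝ) ≤ P + Q * √2 := by
  have h2 := sqrt_two_sq
  have h1 : (0 : ℝ) < √2 := by positivity
  rcases h with ⟨a, b⟩ | ⟨a, b⟩ | ⟨a, b⟩
  · have a' : (0 : ℝ) ≤ P := by exact_mod_cast a
    have b' : (0 : ℝ) ≤ Q := by exact_mod_cast b
    positivity
  · have a' : (0 : ℝ) ≤ P := by exact_mod_cast a
    have b' : (2 * Q * Q : ℝ) ≤ P * P := by exact_mod_cast b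
    have : |(-Q * √2 : ℝ)| ≤ |(P : ℝ)| := by
      apply sq_le_sq.1; nlinarith
    rw [abs_of_nonneg a'] at this
    linarith [le_abs_self (-Q * √2 : ℝ)]
  · have a' : (0 : ℝ) ≤ Q := by exact_mod_cast a
    have b' : (P * P : ℝ) ≤ 2 * Q * Q := by exact_mod_cast b
    have : |(-P : ℝ)| ≤ |(Q * √2 : ℝ)| := by
      apply sq_le_sq.1; nlinarith
    rw [abs_of_nonneg (by positivity : (0 : ℝ) ≤ Q * √2)] at this
    linarith [le_abs_self (-P : ℝ)]

theorem toVec_add (z w : ℤ × ℤ × ℤ × ℤ) : toVec (z + w) = toVec z + toVec w := by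
  simp only [toVec, Prod.fst_add, Prod.snd_add, Int.cast_add]; module

theorem toVec_sub (z w : ℤ × ℤ × ℤ × ℤ) : toVec (z - w) = toVec z - toVec w := by
  simp only [toVec, Prod.fst_sub, Prod.snd_sub, Int.cast_sub]; module

theorem toVec_mulR (z : ℤ × ℤ × ℤ × ℤ) : toVec (mulR z) = √2 • toVec z := by
  have h0 : √2 • e 0 = e 1 - e 3 := by
    have := e_add_two 7
    rw [show (7 : Fin 8) + 2 = 1 from rfl, show (7 : Fin 8) + 1 = 0 from rfl,
      show (7 : Fin 8) = 3 + 4 from rfl, e_add_four] at this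
    rw [← this]; abel
  have h1 : √2 • e 1 = e 0 + e 2 := (e_add_two 0).symm
  have h2 : √2 • e 2 = e 1 + e 3 := (e_add_two 1).symm
  have h3 : √2 • e 3 = e 2 - e 0 := by
    have := e_add_two 2
    rw [show (2 : Fin 8) + 2 = 0 + 4 from rfl, e_add_four, show (2 : Fin 8) + 1 = 3 from rfl] at this
    rw [← this]; abel
  have : √2 • toVec z = (1 / 2 : ℝ) • ((z.1 : ℝ) • √2 • e 0 + (z.2.1 : ℝ) • √2 • e 1
      + (z.2.2.1 : ℝ) • √2 • e 2 + (z.2.2.2 : ℝ) • √2 • e 3) := by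
    rw [toVec]; module
  rw [this, h0, h1, h2, h3]
  simp only [toVec, mulR, Int.cast_add, Int.cast_sub]
  module

theorem toVec_eZ (l : Fin 8) : toVec (eZ l) = e l := by
  have h (l : Fin 8) (z : ℤ × ℤ × ℤ × ℤ) (h : toVec (eZ l) = e l) (hz : z = 0 - eZ l) :
      toVec z = e (l + 4) := by
    rw [e_add_four, ← h, hz, toVec_sub]; simp [toVec]
  have h0 : toVec (eZ 0) = e 0 := by simp [toVec, eZ]
  have h1 : toVec (eZ 1) = e 1 := by simp [toVec, eZ]
  have h2 : toVec (eZ 2) = e 2 := by simp [toVec, eZ]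
  have h3 : toVec (eZ 3) = e 3 := by simp [toVec, eZ]
  revert l
  exact forall_fin_eight h0 h1 h2 h3 (h 0 _ h0 (by decide))
    (h 1 _ h1 (by decide)) (h 2 _ h2 (by decide)) (h 3 _ h3 (by decide))

theorem toVec_double (z w : ℤ × ℤ × ℤ × ℤ) (h : z + z = w) : toVec z = (1 / 2 : ℝ) • toVec w := by
  rw [← h, toVec_add]; module

/-- Since `2 • v i = √2 • (e i + e (i + 1))`, doubling avoids division among integer coefficients.
-/
theorem toVec_vZ (i : Fin 8) : toVec (vZ i) = v i := by
  rw [toVec_double (vZ i) (mulR (eZ i + eZ (i + 1))) (by revert i; decide), toVec_mulR, toVec_add,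
    toVec_eZ, toVec_eZ, v]
  module

theorem ip_toVec (l : Fin 8) (z : ℤ × ℤ × ℤ × ℤ) :
    2 * ip l (toVec z) = (ipZ l z).1 + (ipZ l z).2 * (√2 / 2) := by
  have h := sqrt_two_sq
  revert l
  apply forall_fin_eight <;>
    simp [ip_apply, toVec, e_zero, e_one, e_two, e_three, e_four, e_five, e_six, e_seven, ipZ] <;>
    ring_nf <;> (try rw [sq, h]) <;> ring

/-- By irrationality of `√2`, the inner products with `e 0` and `e 2` determine two combinations of
the coefficients each. -/
theorem toVec_injective : Function.Injective toVec := by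
  intro z w h
  have hirr (P Q : ℤ) (h : (P : ℝ) + Q * (√2 / 2) = 0) : P = 0 ∧ Q = 0 := by
    have hQ : Q = 0 := by
      by_contra hQ
      have h2 : ((Q : ℤ) : ℝ) ≠ 0 := by exact_mod_cast hQ
      apply irrational_sqrt_two.ne_rat (-(2 * P) / Q)
      push_cast
      field_simp
      linarith
    subst hQ
    simpa using h
  have h0 : toVec (z - w) = 0 := by rw [toVec_sub, h, sub_self]
  have a := ip_toVec 0 (z - w)
  have b := ip_toVec 2 (z - w)
  rw [h0, map_zero, mul_zero] at a b
  have a' := hirr _ _ a.symm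
  have b' := hirr _ _ b.symm
  simp only [ipZ, Prod.fst_sub, Prod.snd_sub] at a' b'
  ext <;> lia

/-! ### Scales, vertices and neighbouring centres. -/

/-- The ratio of consecutive edge lengths. -/
def rho : ℝ := √2 - 1

theorem rho_pos : 0 < rho := sub_pos.2 one_lt_sqrt_two'

theorem rho_mul : (1 + √2) * rho = 1 := by
  rw [rho]; linear_combination sqrt_two_sq

theorem rho_lt : rho < 0.415 := by rw [rho]; linarith [sqrt_two_lt]
theorem rho_pow_pos (n : ℕ) : 0 < rho ^ n := pow_pos rho_pos n

theorem rho_pow_succ (n : ℕ) : rho ^ n = (1 + √2) * rho ^ (n + 1) := by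
  rw [pow_succ]; linear_combination -rho ^ n * rho_mul

theorem edge_eq (n : ℕ) : edge n = rho ^ (n + 1) := rfl

/-- The neighbour of `x` in direction `e l`. -/
def nb (n : ℕ) (x : Plane) (l : Fin 8) : Plane := x + rho ^ n • e l

/-- The diagonal neighbour of `x` in direction `e l`. -/
def dg (n : ℕ) (x : Plane) (l : Fin 8) : Plane := x + rho ^ n • (√2 • e l)

/-- The vertices of the octagons of the `n`-th packing. -/
def vx (n : ℕ) (x : Plane) (i : Fin 8) : Plane := octVertex (edge n) x i

theorem vx_eq (n : ℕ) (x : Plane) (i : Fin 8) : vx n x i = x + rho ^ (n + 1) • v i :=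
  octVertex_eq _ _ _

theorem mem_centres_succ {n : ℕ} {y : Plane} :
    y ∈ centres (n + 1) ↔ ∃ x ∈ centres n, ∃ i, y = vx n x i := Iff.rfl

theorem vx_mem {n : ℕ} {x : Plane} (hx : x ∈ centres n) (i : Fin 8) : vx n x i ∈ centres (n + 1) :=
  ⟨x, hx, i, rfl⟩

/-- The coefficients of `(1 + √2) • z`. -/
def invZ (z : ℤ × ℤ × ℤ × ℤ) : ℤ × ℤ × ℤ × ℤ := z + mulR z

theorem toVec_invZ (z : ℤ × ℤ × ℤ × ℤ) : toVec (invZ z) = (1 + √2) • toVec z := by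
  rw [invZ, toVec_add, toVec_mulR]; module

theorem toVec_zero : toVec 0 = 0 := by simp [toVec]

theorem nb_eq (n : ℕ) (x : Plane) (l : Fin 8) : nb n x l = x + rho ^ n • toVec (eZ l) := by
  rw [nb, toVec_eZ]

theorem dg_eq (n : ℕ) (x : Plane) (l : Fin 8) : dg n x l = x + rho ^ n • toVec (mulR (eZ l)) := by
  rw [dg, toVec_mulR, toVec_eZ]

theorem vx_add_toVec (n : ℕ) (x : Plane) (d : ℤ × ℤ × ℤ × ℤ) (j : Fin 8) :
    vx n (x + rho ^ n • toVec d) j = x + rho ^ (n + 1) • toVec (invZ d + vZ j) := by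
  rw [vx_eq, toVec_add, toVec_invZ, toVec_vZ, rho_pow_succ n]; module

/-- Because `rho ^ n = (1 + √2) * rho ^ (n + 1)`, an incidence between consecutive levels depends
neither on the level nor on the centre: it is an equation in `ℤ⁴`. -/
theorem vx_add_eq {n : ℕ} {x : Plane} {d ε : ℤ × ℤ × ℤ × ℤ} {i j : Fin 8}
    (h : invZ d + vZ j = vZ i + ε) :
    vx n (x + rho ^ n • toVec d) j = vx n x i + rho ^ (n + 1) • toVec ε := by
  rw [vx_add_toVec, h, vx_eq, toVec_add, toVec_vZ]; module

theorem eq_of_vx_add_eq {n : ℕ} {x : Plane} {d ε : ℤ × ℤ × ℤ × ℤ} {i j : Fin 8}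
    (h : vx n (x + rho ^ n • toVec d) j = vx n x i + rho ^ (n + 1) • toVec ε) :
    invZ d + vZ j = vZ i + ε := by
  rw [vx_add_toVec, vx_eq, add_assoc, ← smul_add, add_right_inj, ← toVec_vZ i, ← toVec_add] at h
  exact toVec_injective (smul_right_injective _ (rho_pow_pos _).ne' h)

theorem vx_succ (n : ℕ) (x : Plane) (i : Fin 8) : vx n x (i + 1) = nb (n + 1) (vx n x i) (i + 3) := by
  rw [nb_eq, ← vx_add_eq (d := 0) (j := i + 1), toVec_zero, smul_zero, add_zero]
  revert i; decide

theorem vx_pred (n : ℕ) (x : Plane) (i : Fin 8) : vx n x (i - 1) = nb (n + 1) (vx n x i) (i + 6) := by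
  rw [nb_eq, ← vx_add_eq (d := 0) (j := i - 1), toVec_zero, smul_zero, add_zero]
  revert i; decide

/-- The octagons around `x` and `nb n x l` share the edge orthogonal to `e l`, whose ends are the
vertices `l` and `l - 1` of the first. -/
theorem vx_nb (n : ℕ) (x : Plane) (l : Fin 8) : vx n (nb n x l) (l + 3) = vx n x l := by
  rw [nb_eq, vx_add_eq (i := l) (ε := 0), toVec_zero, smul_zero, add_zero]
  revert l; decide

theorem vx_nb' (n : ℕ) (x : Plane) (l : Fin 8) : vx n (nb n x (l + 1)) (l + 5) = vx n x l := by
  rw [nb_eq, vx_add_eq (i := l) (ε := 0), toVec_zero, smul_zero, add_zero]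
  revert l; decide

theorem vx_dg (n : ℕ) (x : Plane) (l : Fin 8) :
    vx n (dg n x l) (l + 3) = nb (n + 1) (vx n x l) l := by
  rw [dg_eq, nb_eq, vx_add_eq]
  revert l; decide

theorem vx_dg' (n : ℕ) (x : Plane) (l : Fin 8) :
    vx n (dg n x (l + 1)) (l + 5) = nb (n + 1) (vx n x l) (l + 1) := by
  rw [dg_eq, nb_eq, vx_add_eq]
  revert l; decide

/-- Reflection in the shared edge exchanges the two vertices; a neighbour of `x` thus produces a
diagonal neighbour one level down. -/
theorem vx_nb_mirror (n : ℕ) (x : Plane) (l : Fin 8) :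
    vx n (nb n x l) (l + 2) = dg (n + 1) (vx n x (l + 1)) l := by
  rw [dg_eq, nb_eq, vx_add_eq]
  revert l; decide

theorem vx_nb_mirror' (n : ℕ) (x : Plane) (l : Fin 8) :
    vx n (nb n x l) (l + 5) = dg (n + 1) (vx n x (l - 2)) l := by
  rw [dg_eq, nb_eq, vx_add_eq]
  revert l; decide

theorem nb_nb (n : ℕ) (x : Plane) (l : Fin 8) : nb n (nb n x l) (l + 4) = x := by
  rw [nb, nb, e_add_four]; module

/-! ### Inner products of the special vectors -/

theorem ip_e_self (l : Fin 8) : ip l (e l) = 1 := by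
  have h := ip_toVec l (eZ l)
  rw [toVec_eZ, show ipZ l (eZ l) = (2, 0) by clear * -; revert l; decide] at h
  push_cast at h; linarith

theorem ip_e_succ (l : Fin 8) : ip l (e (l + 1)) = √2 / 2 := by
  have h := ip_toVec l (eZ (l + 1))
  rw [toVec_eZ, show ipZ l (eZ (l + 1)) = (0, 2) by clear * -; revert l; decide] at h
  push_cast at h; linarith

theorem ip_succ_e (l : Fin 8) : ip (l + 1) (e l) = √2 / 2 := by
  have h := ip_toVec (l + 1) (eZ l)
  rw [toVec_eZ, show ipZ (l + 1) (eZ l) = (0, 2) by clear * -; revert l; decide] at h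
  push_cast at h; linarith

theorem ip_e_le (l m : Fin 8) : ip l (e m) ≤ 1 := by
  have h := ip_toVec l (eZ m)
  have h2 : surdNonneg (4 - 2 * (ipZ l (eZ m)).1) (-(ipZ l (eZ m)).2) := by clear * -; revert l m; decide
  have h3 := h2.nonneg
  rw [toVec_eZ] at h
  push_cast at h3; linarith

theorem ip_v_self (l : Fin 8) : ip l (v l) = (1 + √2) / 2 := by
  have h := ip_toVec l (vZ l)
  rw [toVec_vZ, show ipZ l (vZ l) = (1, 2) by clear * -; revert l; decide] at h
  push_cast at h; linarith

theorem ip_succ_v (l : Fin 8) : ip (l + 1) (v l) = (1 + √2) / 2 := by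
  have h := ip_toVec (l + 1) (vZ l)
  rw [toVec_vZ, show ipZ (l + 1) (vZ l) = (1, 2) by clear * -; revert l; decide] at h
  push_cast at h; linarith

theorem ip_pred_v (l : Fin 8) : ip (l - 1) (v l) = 1 / 2 := by
  have h := ip_toVec (l - 1) (vZ l)
  rw [toVec_vZ, show ipZ (l - 1) (vZ l) = (1, 0) by clear * -; revert l; decide] at h
  push_cast at h; linarith

theorem ip_add_two_v (l : Fin 8) : ip (l + 2) (v l) = 1 / 2 := by
  have h := ip_toVec (l + 2) (vZ l)
  rw [toVec_vZ, show ipZ (l + 2) (vZ l) = (1, 0) by clear * -; revert l; decide] at h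
  push_cast at h; linarith

theorem ip_v_le (l m : Fin 8) : ip l (v m) ≤ (1 + √2) / 2 := by
  have h := ip_toVec l (vZ m)
  have h2 : surdNonneg (2 - 2 * (ipZ l (vZ m)).1) (2 - (ipZ l (vZ m)).2) := by clear * -; revert l m; decide
  have h3 := h2.nonneg
  rw [toVec_vZ] at h
  push_cast at h3; linarith

theorem ip_vx (n : ℕ) (x : Plane) (l i : Fin 8) :
    ip l (vx n x i) = ip l x + rho ^ (n + 1) * ip l (v i) := by
  rw [vx_eq, map_add, map_smul, smul_eq_mul]

theorem ip_nb (n : ℕ) (x : Plane) (l i : Fin 8) :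
    ip l (nb n x i) = ip l x + rho ^ n * ip l (e i) := by
  rw [nb, map_add, map_smul, smul_eq_mul]

theorem ip_dg (n : ℕ) (x : Plane) (l i : Fin 8) :
    ip l (dg n x i) = ip l x + rho ^ n * (√2 * ip l (e i)) := by
  rw [dg, map_add, map_smul, map_smul, smul_eq_mul, smul_eq_mul]

/-- The largest inner product of a vertex with a unit vector is half the larger edge length. -/
theorem half_rho (n : ℕ) : rho ^ (n + 1) * ((1 + √2) / 2) = rho ^ n / 2 := by
  rw [rho_pow_succ n]; ring

/-! ### Differences of centres -/

/-- A centre difference is one of the short ones or long. -/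
def shortOrLong (z : ℤ × ℤ × ℤ × ℤ) : Prop :=
  z = 0 ∨ (∃ m, z = eZ m) ∨ (∃ m, z = mulR (eZ m)) ∨
    ∃ l, surdNonneg (2 * (ipZ l z).1 - 4) ((ipZ l z).2 - 2)

instance (z : ℤ × ℤ × ℤ × ℤ) : Decidable (shortOrLong z) := by
  unfold shortOrLong; infer_instance

theorem shortOrLong_zero : ∀ i j, shortOrLong (invZ 0 + vZ j - vZ i) := by decide +kernel
theorem shortOrLong_e : ∀ m i j, shortOrLong (invZ (eZ m) + vZ j - vZ i) := by decide +kernel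
theorem shortOrLong_mulR :
    ∀ m i j, shortOrLong (invZ (mulR (eZ m)) + vZ j - vZ i) := by decide +kernel

/-- The short differences. -/
def Short (z : ℤ × ℤ × ℤ × ℤ) : Prop := z = 0 ∨ (∃ m, z = eZ m) ∨ ∃ m, z = mulR (eZ m)

theorem Short.step {d : ℤ × ℤ × ℤ × ℤ} (hd : Short d) (i j : Fin 8)
    (h : ∀ l, ip l (toVec (invZ d + vZ j - vZ i)) < 1 + √2 / 2) :
    Short (invZ d + vZ j - vZ i) := by
  have key : shortOrLong (invZ d + vZ j - vZ i) := by
    rcases hd with rfl | ⟨m, rfl⟩ | ⟨m, rfl⟩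
    · exact shortOrLong_zero i j
    · exact shortOrLong_e m i j
    · exact shortOrLong_mulR m i j
  rcases key with h0 | h1 | h2 | ⟨l, hl⟩
  · exact Or.inl h0
  · exact Or.inr (Or.inl h1)
  · exact Or.inr (Or.inr h2)
  · have a := h l
    have b := ip_toVec l (invZ d + vZ j - vZ i)
    have c := hl.nonneg
    push_cast at c
    linarith

/-- The constant `c = 1 + √2 / 2` solves `c + (1 + √2) = c * (1 + √2)`. In each direction `e l` a
vertex is at most `(1 + √2) / 2` from its centre, in units of `rho ^ (n + 1)`, so close children
have close parents. Short differences of parents yield finitely many differences of children, and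
those which are not short reach `c` in some direction. -/
theorem exists_short {n : ℕ} : ∀ {x x' : Plane}, x ∈ centres n → x' ∈ centres n →
    (∀ l, ip l (x' - x) < (1 + √2 / 2) * rho ^ n) →
    ∃ d, Short d ∧ x' = x + rho ^ n • toVec d := by
  induction n with
  | zero =>
    intro x x' hx hx' h
    obtain ⟨a, ha⟩ := hx 0
    obtain ⟨b, hb⟩ := hx 1
    obtain ⟨a', ha'⟩ := hx' 0
    obtain ⟨b', hb'⟩ := hx' 1
    have h0 := h 0
    have h2 := h 2
    have h4 := h (0 + 4)
    have h6 := h (2 + 4)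
    rw [ip_add_four] at h4 h6
    have hs := sqrt_two_lt
    simp only [ip_zero, ip_two, PiLp.sub_apply, ha, hb, ha', hb', pow_zero, mul_one] at h0 h2 h4 h6
    have c1 : a' - a < 2 := by exact_mod_cast (by linarith : ((a' : ℝ) - a) < 2)
    have c2 : b' - b < 2 := by exact_mod_cast (by linarith : ((b' : ℝ) - b) < 2)
    have c3 : -2 < a' - a := by exact_mod_cast (by linarith : (-2 : ℝ) < ((a' : ℝ) - a))
    have c4 : -2 < b' - b := by exact_mod_cast (by linarith : (-2 : ℝ) < ((b' : ℝ) - b))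
    refine ⟨(2 * (a' - a), 0, 2 * (b' - b), 0), ?_, ?_⟩
    · generalize a' - a = p at *
      generalize b' - b = q at *
      unfold Short
      clear * - c1 c2 c3 c4
      interval_cases p <;> interval_cases q <;> decide
    · ext k
      fin_cases k <;> simp [toVec, e_zero, e_two, ha, hb, ha', hb']
  | succ n ih =>
    rintro w w' ⟨u, hu, i, rfl⟩ ⟨u', hu', j, rfl⟩ h
    have hr := rho_pow_succ n
    have hp := rho_pow_pos (n + 1)
    obtain ⟨d, hd, rfl⟩ := ih hu hu' (fun l => by
      have a := h l
      have b := ip_v_le l i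
      have c := ip_v_le (l + 4) j
      rw [ip_add_four] at c
      change ip l (vx n u' j - vx n u i) < _ at a
      rw [map_sub, ip_vx, ip_vx] at a
      rw [map_sub, hr]
      nlinarith [sqrt_two_sq])
    have key : vx n (u + rho ^ n • toVec d) j = vx n u i +
        rho ^ (n + 1) • toVec (invZ d + vZ j - vZ i) := vx_add_eq (by abel)
    refine ⟨_, hd.step i j fun l => ?_, key⟩
    have a := h l
    change ip l (vx n (u + rho ^ n • toVec d) j - vx n u i) < _ at a
    rw [key, add_sub_cancel_left, map_smul, smul_eq_mul, mul_comm] at a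
    exact lt_of_mul_lt_mul_right a hp.le

theorem trichotomy {n : ℕ} {x x' : Plane} (hx : x ∈ centres n) (hx' : x' ∈ centres n)
    (h : ∀ l, ip l (x' - x) < (1 + √2 / 2) * rho ^ n) :
    x' = x ∨ (∃ l, x' = nb n x l) ∨ ∃ l, x' = dg n x l := by
  obtain ⟨d, rfl | ⟨m, rfl⟩ | ⟨m, rfl⟩, rfl⟩ := exists_short hx hx' h
  · left; simp [toVec_zero]
  · right; left; exact ⟨m, (nb_eq _ _ _).symm⟩
  · right; right; exact ⟨m, (dg_eq _ _ _).symm⟩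

theorem eq_of_close {n : ℕ} {x x' : Plane} (hx : x ∈ centres n) (hx' : x' ∈ centres n)
    (h : ∀ l, ip l (x' - x) < rho ^ n) : x' = x := by
  have hp := rho_pow_pos n
  have hs := sqrt_two_gt
  rcases trichotomy hx hx' (fun l => (h l).trans (by nlinarith)) with h0 | ⟨l, rfl⟩ | ⟨l, rfl⟩
  · exact h0
  · have := h l
    rw [map_sub, ip_nb, ip_e_self] at this
    linarith
  · have := h l
    rw [map_sub, ip_dg, ip_e_self] at this
    nlinarith

/-- A point is a vertex of at most two octagons, which then are neighbours. -/
theorem vx_eq_vx {n : ℕ} {x x' : Plane} {i j : Fin 8} (hx : x ∈ centres n) (hx' : x' ∈ centres n)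
    (h : vx n x' j = vx n x i) :
    (x' = x ∧ j = i) ∨ (x' = nb n x i ∧ j = i + 3) ∨ (x' = nb n x (i + 1) ∧ j = i + 5) := by
  have hp := rho_pow_pos (n + 1)
  obtain ⟨d, hd, rfl⟩ := exists_short hx hx' (fun l => by
    have a := congrArg (ip l) h
    have b := ip_v_le l i
    have c := ip_v_le (l + 4) j
    rw [ip_add_four] at c
    rw [ip_vx, ip_vx] at a
    rw [map_sub, rho_pow_succ n]
    nlinarith [sqrt_two_sq, sqrt_two_gt])
  have key := eq_of_vx_add_eq (ε := 0) (by rw [h, toVec_zero, smul_zero, add_zero])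
  rw [add_zero] at key
  rcases hd with rfl | ⟨m, rfl⟩ | ⟨m, rfl⟩
  · left
    exact ⟨by simp [toVec_zero], by clear * - key; revert i j; decide⟩
  · right
    rw [← nb_eq]
    have : (m = i ∧ j = i + 3) ∨ (m = i + 1 ∧ j = i + 5) := by
      clear * - key; revert m i j; decide +kernel
    rcases this with ⟨rfl, rfl⟩ | ⟨rfl, rfl⟩
    · exact Or.inl ⟨rfl, rfl⟩
    · exact Or.inr ⟨rfl, rfl⟩
  · exfalso
    clear * - key; revert m i j; decide +kernel

/-- Two such points, `π / 4` apart as seen from `x`, would be closer than distinct centres can be.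
Consequently a vertex has at most two parents. -/
theorem not_nb_nb_succ {n : ℕ} {x : Plane} {l : Fin 8} (h : nb n x l ∈ centres n)
    (h' : nb n x (l + 1) ∈ centres n) : False := by
  have hp := rho_pow_pos n
  have hs := sqrt_two_gt
  have hd : ∀ k, ip k (e (l + 1) - e l) < 1 := by
    intro k
    have a := ip_toVec k (eZ (l + 1) - eZ l)
    have h2 : surdNonneg (2 * (2 - (ipZ k (eZ (l + 1) - eZ l)).1) - 1)
      (-(ipZ k (eZ (l + 1) - eZ l)).2) := by clear * -; revert k l; decide +kernel
    have h3 := h2.nonneg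
    rw [toVec_sub, toVec_eZ, toVec_eZ] at a
    push_cast at h3
    linarith
  have key := eq_of_close h h' (fun k => by
    rw [nb, nb, add_sub_add_left_eq_sub, ← smul_sub, map_smul, smul_eq_mul]
    nlinarith [hd k])
  have := congrArg (ip l) key
  rw [ip_nb, ip_nb, ip_e_self, ip_e_succ] at this
  nlinarith [sqrt_two_lt]

/-! ### Cones, octagons and pieces as systems of linear inequalities. -/

theorem exists_cone (p : Plane) : ∃ i : Fin 8, 0 ≤ ip (i - 1) p ∧ 0 ≤ ip (i + 2) p := by
  by_contra! hc
  -- If no cone contains `p`, nonnegativity propagates backwards through the directions; four steps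
  -- contradict `ip (k + 4) p = -ip k p`.
  have step (k : Fin 8) (h : 0 ≤ ip k p) : 0 < ip (k - 1) p := by
    have := hc (k + 1) (by rwa [show k + 1 - 1 = k by grind])
    rw [show k + 1 + 2 = (k - 1) + 4 by grind, ip_add_four] at this
    linarith
  have four (k : Fin 8) (h : 0 ≤ ip k p) : 0 < ip (k + 4) p := by
    have := step _ (step _ (step _ (step _ h).le).le).le
    rwa [show k - 1 - 1 - 1 - 1 = k + 4 by grind] at this
  rcases le_total 0 (ip 0 p) with h | h
  · have := four _ h
    rw [ip_add_four] at this
    linarith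
  · have := four (0 + 4) (by rw [ip_add_four]; linarith)
    rw [ip_add_four, ip_add_four] at this
    linarith

theorem eq_cone_coords (i : Fin 8) (p : Plane) :
    p = (√2 * ip (i - 1) p) • e i + (√2 * ip (i + 2) p) • e (i + 1) := by
  have h7 : (-1 : Fin 8) = 7 := rfl
  revert i
  apply forall_fin_eight <;> ext k <;> fin_cases k <;>
    simp [h7, ip_apply, e_zero, e_one, e_two, e_three, e_four, e_five, e_six, e_seven] <;>
    ring_nf <;> (try simp only [Real.sq_sqrt (show (0 : ℝ) ≤ 2 by norm_num)]) <;> ring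

theorem ip_pred_e (i : Fin 8) : ip (i - 1) (e i) = √2 / 2 := by
  have := ip_e_succ (i - 1)
  rwa [show i - 1 + 1 = i by grind] at this

theorem ip_e_add_two (i : Fin 8) : ip i (e (i + 2)) = 0 := by
  have h := ip_toVec i (eZ (i + 2))
  rw [toVec_eZ, show ipZ i (eZ (i + 2)) = (0, 0) by clear * -; revert i; decide] at h
  push_cast at h; linarith

theorem ip_add_two_e (i : Fin 8) : ip (i + 2) (e i) = 0 := by
  have h := ip_toVec (i + 2) (eZ i)
  rw [toVec_eZ, show ipZ (i + 2) (eZ i) = (0, 0) by clear * -; revert i; decide] at h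
  push_cast at h; linarith

theorem mem_cone_iff (x q : Plane) (i : Fin 8) :
    q ∈ cone x (e i) (e (i + 1)) ↔ 0 ≤ ip (i - 1) (q - x) ∧ 0 ≤ ip (i + 2) (q - x) := by
  constructor
  · rintro ⟨a, b, ha, hb, rfl⟩
    have h1 := ip_e_add_two (i - 1)
    rw [show i - 1 + 2 = i + 1 by grind] at h1
    have h2 := ip_succ_e (i + 1)
    rw [show i + 1 + 1 = i + 2 by grind] at h2
    rw [add_sub_cancel_left, map_add, map_add, map_smul, map_smul, map_smul, map_smul, ip_pred_e, h1,
      h2, ip_add_two_e]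
    simp only [smul_eq_mul]
    constructor <;> positivity
  · rintro ⟨h1, h2⟩
    refine ⟨√2 * ip (i - 1) (q - x), √2 * ip (i + 2) (q - x), by positivity, by positivity, ?_⟩
    rw [← eq_cone_coords]; abel

theorem convex_ip_le (x : Plane) (c : ℝ) : Convex ℝ {q : Plane | ∀ l, ip l (q - x) ≤ c} := by
  intro p hp q hq a b ha hb hab l
  have h1 := hp l
  have h2 := hq l
  rw [map_sub] at h1 h2 ⊢
  rw [map_add, map_smul, map_smul, smul_eq_mul, smul_eq_mul]
  have hx : ip l x = a * ip l x + b * ip l x := by rw [← add_mul, hab, one_mul]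
  have hc : c = a * c + b * c := by rw [← add_mul, hab, one_mul]
  nlinarith

theorem v_eq_sub (i : Fin 8) : v (i - 1) = ((1 + √2) : ℝ) • e i - v i := by
  rw [← toVec_vZ, ← toVec_vZ, ← toVec_eZ, ← toVec_invZ, ← toVec_sub]
  congr 1
  revert i; decide

theorem mem_octagon_iff {s : ℝ} (hs : 0 < s) (x q : Plane) :
    q ∈ octagon s x ↔ ∀ l, ip l (q - x) ≤ s * ((1 + √2) / 2) := by
  have h2 := sqrt_two_sq
  have h20 : 0 < √2 := by positivity
  constructor
  · intro h
    refine convexHull_min (t := {q : Plane | ∀ l, ip l (q - x) ≤ s * ((1 + √2) / 2)}) ?_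
      (convex_ip_le _ _) h
    rintro _ ⟨i, rfl⟩ l
    rw [octVertex_eq, add_sub_cancel_left, map_smul, smul_eq_mul]
    exact mul_le_mul_of_nonneg_left (ip_v_le l i) hs.le
  · intro h
    have hc : Convex ℝ (octagon s x) := convex_convexHull _ _
    have hv (i : Fin 8) : x + s • v i ∈ octagon s x :=
      subset_convexHull _ _ ⟨i, octVertex_eq s x i⟩
    have hx : x ∈ octagon s x := by
      have := hc (hv 0) (hv 4) (a := 1 / 2) (b := 1 / 2) (by norm_num) (by norm_num) (by norm_num)
      rw [show (4 : Fin 8) = 0 + 4 from rfl, v_add_four] at this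
      convert this using 1
      module
    have hm (i : Fin 8) : x + (s * ((1 + √2) / 2)) • e i ∈ octagon s x := by
      have := hc (hv i) (hv (i - 1)) (a := 1 / 2) (b := 1 / 2) (by norm_num) (by norm_num)
        (by norm_num)
      rw [v_eq_sub] at this
      convert this using 1
      module
    have comb (p r : Plane) (hp : x + p ∈ octagon s x) (hr : x + r ∈ octagon s x) (a b : ℝ)
        (ha : 0 ≤ a) (hb : 0 ≤ b) (hab : a + b ≤ 1) : x + (a • p + b • r) ∈ octagon s x := by
      have := hc.sum_mem (t := Finset.univ) (w := ![a, b, 1 - a - b])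
        (z := ![x + p, x + r, x]) (by
          intro k _; fin_cases k
          · exact ha
          · exact hb
          · change 0 ≤ 1 - a - b; linarith)
        (by simp [Fin.sum_univ_three]) (by intro k _; fin_cases k; exacts [hp, hr, hx])
      simp only [Fin.sum_univ_three, Matrix.cons_val_zero, Matrix.cons_val_one, Matrix.cons_val] at this
      convert this using 1
      module
    obtain ⟨i, hd, hf⟩ := exists_cone (q - x)
    obtain ⟨t1, t2, -⟩ := ip_table i (q - x)
    have b1 := h i
    have b2 := h (i + 1)
    have hq := eq_cone_coords i (q - x)
    generalize ip (i - 1) (q - x) = d at *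
    generalize ip (i + 2) (q - x) = f at *
    have hr : 0 < s * ((1 + √2) / 2) := by positivity
    -- The line from the centre to vertex `i` halves the sector: `q` lies in the triangle formed by
    -- the centre, this vertex and the midpoint of the edge with normal `e i` or `e (i + 1)`.
    rcases le_total f d with hfd | hfd
    · have key := comb (s • v i) ((s * ((1 + √2) / 2)) • e i) (hv i) (hm i) (2 * f / s)
        ((√2 * (d - f)) / (s * ((1 + √2) / 2))) (by positivity)
        (div_nonneg (mul_nonneg h20.le (by linarith)) hr.le) (by
          have : 2 * f / s = (f * (1 + √2)) / (s * ((1 + √2) / 2)) := by field_simp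
          rw [this, ← add_div, div_le_one hr]
          linarith)
      convert key using 1
      rw [smul_smul, smul_smul, div_mul_cancel₀ _ hs.ne', div_mul_cancel₀ _ hr.ne', v, ← sub_eq_iff_eq_add', hq]
      module
    · have key := comb (s • v i) ((s * ((1 + √2) / 2)) • e (i + 1)) (hv i) (hm (i + 1)) (2 * d / s)
        ((√2 * (f - d)) / (s * ((1 + √2) / 2))) (by positivity)
        (div_nonneg (mul_nonneg h20.le (by linarith)) hr.le) (by
          have : 2 * d / s = (d * (1 + √2)) / (s * ((1 + √2) / 2)) := by field_simp
          rw [this, ← add_div, div_le_one hr]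
          linarith)
      convert key using 1
      rw [smul_smul, smul_smul, div_mul_cancel₀ _ hs.ne', div_mul_cancel₀ _ hr.ne', v, ← sub_eq_iff_eq_add', hq]
      module

/-- The octagon of the `n`-th packing with centre `x`. -/
def oct (n : ℕ) (x : Plane) : Set Plane := octagon (edge n) x

theorem mem_oct_iff (n : ℕ) (x q : Plane) : q ∈ oct n x ↔ ∀ l, ip l (q - x) ≤ rho ^ n / 2 := by
  rw [oct, edge_eq, mem_octagon_iff (rho_pow_pos _), half_rho]

theorem mem_piece_iff (n : ℕ) (x q : Plane) (i : Fin 8) : q ∈ piece (edge n) x i ↔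
    (∀ l, ip l (q - x) ≤ rho ^ n / 2) ∧ 0 ≤ ip (i - 1) (q - x) ∧ 0 ≤ ip (i + 2) (q - x) := by
  rw [piece, Set.mem_inter_iff, mem_cone_iff, ← mem_oct_iff]; rfl

/-- The interior of the `i`-th piece of an octagon of the `n`-th packing. -/
def pieceInt (n : ℕ) (x : Plane) (i : Fin 8) : Set Plane :=
  {q | (∀ l, ip l (q - x) < rho ^ n / 2) ∧ 0 < ip (i - 1) (q - x) ∧ 0 < ip (i + 2) (q - x)}

theorem isOpen_pieceInt (n : ℕ) (x : Plane) (i : Fin 8) : IsOpen (pieceInt n x i) := by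
  have h (l : Fin 8) : Continuous fun q : Plane => ip l (q - x) := by fun_prop
  refine IsOpen.and ?_ ((isOpen_lt continuous_const (h _)).and (isOpen_lt continuous_const (h _)))
  simp only [Set.ofPred_forall]
  exact isOpen_iInter_of_finite fun l => isOpen_lt (h l) continuous_const

theorem pieceInt_subset (n : ℕ) (x : Plane) (i : Fin 8) : pieceInt n x i ⊆ piece (edge n) x i :=
  fun q hq => (mem_piece_iff n x q i).2 ⟨fun l => (hq.1 l).le, hq.2.1.le, hq.2.2.le⟩

theorem add_smul_v_mem_pieceInt {n : ℕ} {x : Plane} {i : Fin 8} {t : ℝ} (h0 : 0 < t) (h1 : t < 1) :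
    x + (t * rho ^ (n + 1)) • v i ∈ pieceInt n x i := by
  have hp := rho_pow_pos (n + 1)
  refine ⟨fun l => ?_, ?_, ?_⟩
  · rw [add_sub_cancel_left, map_smul, smul_eq_mul, ← half_rho]
    have h2 : 0 < √2 := by positivity
    calc t * rho ^ (n + 1) * ip l (v i) ≤ t * rho ^ (n + 1) * ((1 + √2) / 2) :=
          mul_le_mul_of_nonneg_left (ip_v_le l i) (by positivity)
      _ < 1 * rho ^ (n + 1) * ((1 + √2) / 2) := by gcongr
      _ = _ := by ring
  · rw [add_sub_cancel_left, map_smul, smul_eq_mul, ip_pred_v]; positivity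
  · rw [add_sub_cancel_left, map_smul, smul_eq_mul, ip_add_two_v]; positivity

theorem piece_subset_closure (n : ℕ) (x : Plane) (i : Fin 8) :
    piece (edge n) x i ⊆ closure (pieceInt n x i) := by
  intro q hq
  rw [mem_piece_iff] at hq
  obtain ⟨c1, c2, c3⟩ := add_smul_v_mem_pieceInt (n := n) (x := x) (i := i) (t := 1 / 2)
    (by norm_num) (by norm_num)
  generalize x + (1 / 2 * rho ^ (n + 1)) • v i = c at c1 c2 c3
  have hlim : Tendsto (fun t : ℝ => q + t • (c - q)) (𝓝[>] 0) (𝓝 (q + (0 : ℝ) • (c - q))) :=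
    (Continuous.tendsto (by fun_prop) _).mono_left nhdsWithin_le_nhds
  rw [zero_smul, add_zero] at hlim
  refine mem_closure_of_tendsto hlim ?_
  filter_upwards [Ioo_mem_nhdsGT (show (0 : ℝ) < 1 by norm_num)] with t ht
  obtain ⟨ht0, ht1⟩ := ht
  have e1 (l : Fin 8) : ip l (q + t • (c - q) - x) = (1 - t) * ip l (q - x) + t * ip l (c - x) := by
    rw [show q + t • (c - q) - x = (1 - t) • (q - x) + t • (c - x) by module, map_add, map_smul,
      map_smul, smul_eq_mul, smul_eq_mul]
  refine ⟨fun l => ?_, ?_, ?_⟩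
  · rw [e1]; nlinarith [hq.1 l, c1 l]
  · rw [e1]; nlinarith [hq.2.1, mul_pos ht0 c2]
  · rw [e1]; nlinarith [hq.2.2, mul_pos ht0 c3]

theorem oct_eq_iUnion (n : ℕ) (x : Plane) : oct n x = ⋃ i, piece (edge n) x i := by
  ext q
  simp only [Set.mem_iUnion, mem_piece_iff, mem_oct_iff]
  constructor
  · intro h
    obtain ⟨i, hi⟩ := exists_cone (q - x)
    exact ⟨i, h, hi⟩
  · rintro ⟨i, h, -⟩; exact h

/-- The sign pattern of the inner products on the open cone determines the cone. -/
theorem cone_unique {p : Plane} {i j : Fin 8} (h1 : 0 < ip (i - 1) p) (h2 : 0 < ip (i + 2) p)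
    (h3 : 0 ≤ ip (j - 1) p) (h4 : 0 ≤ ip (j + 2) p) : j = i := by
  obtain ⟨t1, t2, t3, t4, t5, t6⟩ := ip_table i p
  have h20 : 0 < √2 := by positivity
  have n3 : ip (i + 3) p < 0 := by linarith
  have n4 : ip (i + 4) p < 0 := by rw [t4]; nlinarith
  have n5 : ip (i + 5) p < 0 := by rw [t5]; nlinarith
  have n6 : ip (i + 6) p < 0 := by linarith
  have key : ∀ k : Fin 8, 0 ≤ ip k p → k ≠ i + 3 ∧ k ≠ i + 4 ∧ k ≠ i + 5 ∧ k ≠ i + 6 := by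
    intro k hk
    refine ⟨?_, ?_, ?_, ?_⟩ <;> rintro rfl <;> linarith
  have a := key _ h3
  have b := key _ h4
  clear * - a b
  revert i j; decide

/-! ### Centres -/

theorem mem_centres_add {n : ℕ} {x g : Plane} (hg : g ∈ squareLattice) (hx : x ∈ centres n) :
    x + g ∈ centres n := by
  induction n generalizing x with
  | zero => exact squareLattice.add_mem hx hg
  | succ n ih =>
    obtain ⟨u, hu, i, rfl⟩ := hx
    exact ⟨u + g, ih hu, i, by simp only [octVertex]; abel⟩

open Pointwise in
theorem isClosed_centres (n : ℕ) : IsClosed (centres n) := by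
  induction n with
  | zero =>
    have : centres 0 = ⋂ i : Fin 2, (fun v : Plane => v i) ⁻¹' Set.range (Int.cast : ℤ → ℝ) := by
      ext w
      simp only [Set.mem_iInter, Set.mem_preimage, Set.mem_range]
      exact forall_congr' fun i => exists_congr fun m => eq_comm
    rw [this]
    exact isClosed_iInter fun i => Int.isClosedEmbedding_coe_real.isClosed_range.preimage (by fun_prop)
  | succ n ih =>
    have : centres (n + 1) = centres n + Set.range (fun i => rho ^ (n + 1) • v i) := by
      ext w
      rw [mem_centres_succ, Set.mem_add]
      constructor
      · rintro ⟨x, hx, i, rfl⟩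
        exact ⟨x, hx, _, ⟨i, rfl⟩, (vx_eq _ _ _).symm⟩
      · rintro ⟨x, hx, _, ⟨i, rfl⟩, rfl⟩
        exact ⟨x, hx, i, (vx_eq _ _ _).symm⟩
    rw [this]
    exact ih.add_right_of_isCompact (Set.finite_range _).isCompact

theorem isCompact_octagon (s : ℝ) (x : Plane) : IsCompact (octagon s x) :=
  (Set.finite_range _).isCompact_convexHull ℝ

theorem mem_packing {n : ℕ} {q : Plane} : q ∈ packing n ↔ ∃ x ∈ centres n, q ∈ oct n x := by
  simp [packing, oct]

open Pointwise in
theorem isClosed_packing (n : ℕ) : IsClosed (packing n) := by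
  have : packing n = centres n + oct n 0 := by
    ext q
    rw [mem_packing, Set.mem_add]
    constructor
    · rintro ⟨x, hx, hq⟩
      refine ⟨x, hx, q - x, ?_, by abel⟩
      rw [mem_oct_iff] at hq ⊢
      simpa using hq
    · rintro ⟨x, hx, p, hp, rfl⟩
      refine ⟨x, hx, ?_⟩
      rw [mem_oct_iff] at hp ⊢
      simpa using hp
  rw [this]
  exact (isClosed_centres n).add_right_of_isCompact (isCompact_octagon _ _)

/-- The centres that descend from the octagon at the origin. -/
def descendants : ℕ → Set Plane
  | 0 => {0}
  | n + 1 => {y | ∃ x ∈ descendants n, ∃ i, y = vx n x i}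

theorem descendants_subset (n : ℕ) : descendants n ⊆ centres n := by
  induction n with
  | zero => rintro _ rfl; exact squareLattice.zero_mem
  | succ n ih => rintro _ ⟨x, hx, i, rfl⟩; exact ⟨x, ih hx, i, rfl⟩

/-! ### Colours -/

theorem vx_vx (n : ℕ) (x : Plane) (i : Fin 8) : vx n (vx n x i) (i + 4) = x := by
  rw [vx_eq, vx_eq, v_add_four]; module

/-- The rule as seen from the parents: the direction from `y` to a parent is opposite to the vertex
number of `y`, and adding `4` preserves parity. -/
theorem isRed_succ {n : ℕ} {y : Plane} {j : Fin 8} : isRed (n + 1) y j ↔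
    ∃ x ∈ centres n, ∃ i, y = vx n x i ∧ isRed n x i ∧
      ((∀ x' ∈ centres n, ∀ i', y = vx n x' i' → isRed n x' i') ∨ (j : ℕ) % 2 = (i : ℕ) % 2) := by
  have hpar : ∀ k : Fin 8, ((k + 4 : Fin 8) : ℕ) % 2 = (k : ℕ) % 2 := by decide
  have hk (k : Fin 8) : k + 4 + 4 = k := by grind
  have hall : (∀ l, octVertex (edge n) y l ∈ centres n → isRed n (octVertex (edge n) y l) (l + 4)) ↔
      ∀ x' ∈ centres n, ∀ i', y = vx n x' i' → isRed n x' i' := by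
    constructor
    · rintro h x hx i rfl
      have := h (i + 4)
      change vx n (vx n x i) (i + 4) ∈ _ → isRed n (vx n (vx n x i) (i + 4)) _ at this
      rw [vx_vx, hk] at this
      exact this hx
    · intro h l hl
      refine h _ hl _ ?_
      exact (vx_vx n y l).symm
  change nextRed _ _ _ _ _ ↔ _
  rw [nextRed, hall]
  constructor
  · rintro ⟨k, hk1, hk2, hk3⟩
    exact ⟨_, hk1, k + 4, (vx_vx n y k).symm, hk2, by rwa [hpar]⟩
  · rintro ⟨x, hx, i, rfl, h2, h3⟩
    refine ⟨i + 4, ?_, ?_, by rwa [hpar]⟩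
    · change vx n (vx n x i) (i + 4) ∈ _
      rwa [vx_vx]
    · change isRed n (vx n (vx n x i) (i + 4)) _
      rwa [vx_vx, hk]

theorem isRed.mem_descendants {n : ℕ} {x : Plane} {i : Fin 8} (h : isRed n x i) :
    x ∈ descendants n := by
  induction n generalizing x i with
  | zero => exact h
  | succ n ih =>
    obtain ⟨u, -, k, rfl, hr, -⟩ := isRed_succ.1 h
    exact ⟨u, ih hr, k, rfl⟩

theorem isRed.mem_centres {n : ℕ} {x : Plane} {i : Fin 8} (h : isRed n x i) : x ∈ centres n :=
  descendants_subset n h.mem_descendants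

theorem isRed.vx {n : ℕ} {x : Plane} {i j : Fin 8} (h : isRed n x i)
    (hj : (j : ℕ) % 2 = (i : ℕ) % 2) : isRed (n + 1) (vx n x i) j :=
  isRed_succ.2 ⟨x, h.mem_centres, i, rfl, h, Or.inr hj⟩

/-- The rule treats all colours `g` alike. If two parents of `x` differ in colour, their vertex
numbers have opposite parities, so one of the two colours claims the piece `i`. -/
theorem exists_colour {n : ℕ} {x : Plane} (hx : x ∈ centres n) (i : Fin 8) :
    ∃ g ∈ squareLattice, isRed n (x - g) i := by
  induction n generalizing x i with
  | zero => exact ⟨x, hx, sub_self x⟩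
  | succ n ih =>
    obtain ⟨u, hu, k, rfl⟩ := mem_centres_succ.1 hx
    have hvx (n : ℕ) (x g : Plane) (i : Fin 8) : vx n x i - g = vx n (x - g) i := by
      rw [vx_eq, vx_eq]; abel
    obtain ⟨g, hg, hr⟩ := ih hu k
    by_cases hall : ∀ x' ∈ centres n, ∀ i', vx n u k - g = vx n x' i' → isRed n x' i'
    · exact ⟨g, hg, isRed_succ.2 ⟨_, hr.mem_centres, k, hvx _ _ _ _, hr, Or.inl hall⟩⟩
    · push Not at hall
      obtain ⟨x', hx', i', h1, h2⟩ := hall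
      obtain ⟨g', hg', hr'⟩ := ih (x := x' + g) (mem_centres_add hg hx') i'
      have e1 : vx n u k = vx n (x' + g) i' := by
        have := hvx n (x' + g) g i'
        rw [add_sub_cancel_right, ← h1] at this
        exact (sub_left_inj.1 this).symm
      have hpar : (i : ℕ) % 2 = (k : ℕ) % 2 ∨ (i : ℕ) % 2 = (i' : ℕ) % 2 := by
        rcases vx_eq_vx (mem_centres_add hg hx') hu e1 with ⟨rfl, rfl⟩ | ⟨-, rfl⟩ | ⟨-, rfl⟩
        · rw [add_sub_cancel_right] at hr; exact absurd hr h2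
        · clear * -; revert i i'; decide
        · clear * -; revert i i'; decide
      rcases hpar with hp | hp
      · exact ⟨g, hg, isRed_succ.2 ⟨_, hr.mem_centres, k, hvx _ _ _ _, hr, Or.inr hp⟩⟩
      · refine ⟨g', hg', isRed_succ.2 ⟨_, hr'.mem_centres, i', ?_, hr', Or.inr hp⟩⟩
        rw [e1, hvx]

/-- If both colours claim the piece by parity, they come from the same parent. Otherwise one of them
is the colour of all parents, hence also of the parent that gave the other. -/
theorem colour_unique {n : ℕ} {x : Plane} {i : Fin 8} {g h : Plane} (hg : g ∈ squareLattice)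
    (hh : h ∈ squareLattice) (h1 : isRed n (x - g) i) (h2 : isRed n (x - h) i) : g = h := by
  induction n generalizing x i with
  | zero =>
    change x - g = 0 at h1
    change x - h = 0 at h2
    rw [sub_eq_zero] at h1 h2
    rw [← h1, ← h2]
  | succ n ih =>
    obtain ⟨a, ha, j, e1, r1, c1⟩ := isRed_succ.1 h1
    obtain ⟨b, hb, k, e2, r2, c2⟩ := isRed_succ.1 h2
    have hvx (x g : Plane) (i : Fin 8) : vx n (x + g) i = vx n x i + g := by
      rw [vx_eq, vx_eq]; abel
    have f1 : x = vx n (a + g) j := by rw [hvx, ← e1]; abel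
    have f2 : x = vx n (b + h) k := by rw [hvx, ← e2]; abel
    have ha' := mem_centres_add hg ha
    have hb' := mem_centres_add hh hb
    by_cases hp : (i : ℕ) % 2 = (j : ℕ) % 2 ∧ (i : ℕ) % 2 = (k : ℕ) % 2
    · rcases vx_eq_vx ha' hb' (f2.symm.trans f1) with ⟨h3, rfl⟩ | ⟨-, rfl⟩ | ⟨-, rfl⟩
      · refine ih (x := a + g) (i := k) (by rwa [add_sub_cancel_right]) ?_
        rw [← h3, add_sub_cancel_right]; exact r2
      · exfalso; clear * - hp; revert i j; decide
      · exfalso; clear * - hp; revert i j; decide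
    · rcases not_and_or.1 hp with hp | hp
      · have c1 := c1.resolve_right hp
        refine ih (x := b + h) (i := k) ?_ (by rwa [add_sub_cancel_right])
        refine c1 _ ?_ _ ?_
        · have := mem_centres_add (squareLattice.neg_mem hg) hb'
          rwa [← sub_eq_add_neg] at this
        · rw [f2, ← sub_eq_zero]
          rw [vx_eq, vx_eq]; abel
      · have c2 := c2.resolve_right hp
        refine ih (x := a + g) (i := j) (by rwa [add_sub_cancel_right]) ?_
        refine c2 _ ?_ _ ?_
        · have := mem_centres_add (squareLattice.neg_mem hh) ha'
          rwa [← sub_eq_add_neg] at this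
        · rw [f1, ← sub_eq_zero]
          rw [vx_eq, vx_eq]; abel

/-! ### How far descendants reach -/

/-- The reach of an octagon and its descendants, relative to its larger edge length. -/
def kappa : ℝ := (2 + √2) / 4

theorem kappa_mul_rho : kappa * rho + 1 / 2 = kappa := by
  rw [kappa, rho]; linear_combination (1 / 4) * sqrt_two_sq

theorem kappa_lt : kappa < 0.854 := by rw [kappa]; linarith [sqrt_two_lt]
theorem lt_kappa : 0.853 < kappa := by rw [kappa]; linarith [sqrt_two_gt]

/-- `q` may lie in an octagon which descends from the one with centre `u`. -/
def Reach (n : ℕ) (u q : Plane) : Prop := ∀ l, ip l (q - u) ≤ kappa * rho ^ n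

theorem ip_sub_vx (n : ℕ) (q u : Plane) (l i : Fin 8) :
    ip l (q - vx n u i) = ip l (q - u) - rho ^ (n + 1) * ip l (v i) := by
  rw [map_sub, ip_vx, map_sub]; ring

theorem ip_sub_nb (n : ℕ) (q u : Plane) (l i : Fin 8) :
    ip l (q - nb n u i) = ip l (q - u) - rho ^ n * ip l (e i) := by
  rw [map_sub, ip_nb, map_sub]; ring

/-- By `kappa = 1 / 2 + kappa * rho`: the step from a centre to its vertex costs at most `rho ^ n /
2` in each direction. -/
theorem Reach.parent {n : ℕ} {u q : Plane} {i : Fin 8} (h : Reach (n + 1) (vx n u i) q) :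
    Reach n u q := by
  intro l
  have a := h l
  have b := ip_v_le l i
  have hp := rho_pow_pos (n + 1)
  have c : kappa * rho ^ n = kappa * rho ^ (n + 1) + rho ^ (n + 1) * ((1 + √2) / 2) := by
    rw [half_rho, pow_succ]; linear_combination -rho ^ n * kappa_mul_rho
  rw [ip_sub_vx] at a
  rw [c]
  nlinarith

theorem reach_of_mem_oct {n : ℕ} {u q : Plane} (h : q ∈ oct n u) : Reach n u q := by
  intro l
  have := (mem_oct_iff _ _ _).1 h l
  nlinarith [rho_pow_pos n, lt_kappa]

theorem Reach.exists_ancestor {n m : ℕ} (hnm : n ≤ m) {y q : Plane} (hy : y ∈ centres m)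
    (h : Reach m y q) : ∃ x ∈ centres n, Reach n x q := by
  induction m, hnm using Nat.le_induction generalizing y with
  | base => exact ⟨y, hy, h⟩
  | succ m _ ih =>
    obtain ⟨u, hu, i, rfl⟩ := mem_centres_succ.1 hy
    exact ih hu h.parent

/-- Points near a centre are not covered later. -/
theorem notMem_packing_of_near {n m : ℕ} (hnm : n < m) {x q : Plane} (hx : x ∈ centres n)
    (hq : ∀ l, ip l (q - x) < (1 - kappa) * rho ^ n) : q ∉ packing m := by
  intro h
  obtain ⟨y, hy, hqy⟩ := mem_packing.1 h
  obtain ⟨w, hw, hr⟩ := (reach_of_mem_oct hqy).exists_ancestor hnm hy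
  obtain ⟨u, hu, i, rfl⟩ := mem_centres_succ.1 hw
  -- Descendants of vertex `i` of `x` keep `(1 / 2 - kappa * rho) * rho ^ n = (1 - kappa) * rho ^ n`
  -- away from `x` in direction `e i`; a centre `u ≠ x` reaching `q` would be too close to `x`.
  by_cases hxu : u = x
  · subst hxu
    have a := hr (i + 4)
    rw [ip_add_four, ip_sub_vx, ip_v_self, half_rho, pow_succ] at a
    have b := hq i
    have : kappa * (rho ^ n * rho) = (kappa - 1 / 2) * rho ^ n := by
      linear_combination rho ^ n * kappa_mul_rho
    linarith
  · apply hxu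
    refine eq_of_close hx hu fun l => ?_
    have a := hr.parent (l + 4)
    have b := hq l
    rw [ip_add_four] at a
    rw [map_sub] at *
    linarith

/-! ### Nearest centres -/

/-- `q` is not nearer to any neighbour or diagonal neighbour of `u` than to `u`. -/
def Near (n : ℕ) (u q : Plane) : Prop :=
  ∀ l, (nb n u l ∈ centres n → ip l (q - u) ≤ rho ^ n / 2) ∧
    (dg n u l ∈ centres n → ip l (q - u) ≤ √2 / 2 * rho ^ n)

theorem near_of_mem_oct {n : ℕ} {u q : Plane} (h : q ∈ oct n u) : Near n u q := by
  intro l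
  have := (mem_oct_iff _ _ _).1 h l
  exact ⟨fun _ => this, fun _ => by nlinarith [rho_pow_pos n, sqrt_two_gt]⟩

/-- `q` is not nearer to the other centre that has the same vertex number `i`. -/
def Preferred (n : ℕ) (u : Plane) (i : Fin 8) (q : Plane) : Prop :=
  (nb n u i ∈ centres n → ip i (q - u) ≤ rho ^ n / 2) ∧
    (nb n u (i + 1) ∈ centres n → ip (i + 1) (q - u) ≤ rho ^ n / 2)

/-- `p` lies in the cone number `i`. -/
def InCone (i : Fin 8) (p : Plane) : Prop := 0 ≤ ip (i - 1) p ∧ 0 ≤ ip (i + 2) p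

theorem InCone.nonpos {i : Fin 8} {p : Plane} (h : InCone i p) :
    0 ≤ ip i p ∧ 0 ≤ ip (i + 1) p ∧ ip (i + 3) p ≤ 0 ∧ ip (i + 4) p ≤ 0 ∧ ip (i + 5) p ≤ 0 ∧
      ip (i + 6) p ≤ 0 := by
  obtain ⟨t1, t2, t3, t4, t5, t6⟩ := ip_table i p
  obtain ⟨hd, hf⟩ := h
  have h1 : 0 ≤ √2 * ip (i - 1) p := by positivity
  have h2 : 0 ≤ √2 * ip (i + 2) p := by positivity
  refine ⟨?_, ?_, ?_, ?_, ?_, ?_⟩ <;> linarith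

theorem fin_eight_shift {P : Fin 8 → Prop} (i : Fin 8) (h0 : P i) (h1 : P (i + 1)) (h2 : P (i + 2))
    (h3 : P (i + 3)) (h4 : P (i + 4)) (h5 : P (i + 5)) (h6 : P (i + 6)) (h7 : P (i - 1))
    (j : Fin 8) : P j := by
  have : ∀ i j : Fin 8, j = i ∨ j = i + 1 ∨ j = i + 2 ∨ j = i + 3 ∨ j = i + 4 ∨ j = i + 5 ∨
      j = i + 6 ∨ j = i - 1 := by decide
  rcases this i j with rfl | rfl | rfl | rfl | rfl | rfl | rfl | rfl <;> assumption

/-- The competitors of the vertex control those of `u`. The adjacent vertices of `u` put `q` into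
the cone `i`. Vertices mirrored in shared edges treat the neighbours in directions `i - 1` and `i +
2`, and vertices of diagonal neighbours treat the diagonals `i` and `i + 1`. The remaining bounds
come from `Preferred`, `Reach` or the sign. -/
theorem Near.parent {n : ℕ} {u q : Plane} {i : Fin 8} (hu : u ∈ centres n)
    (hn : Near (n + 1) (vx n u i) q) (hr : Reach (n + 1) (vx n u i) q)
    (hp : Preferred n u i q) : InCone i (q - u) ∧ Near n u q := by
  have hpos := rho_pow_pos (n + 1)
  have hpow := rho_pow_succ n
  have hs := sqrt_two_sq
  have h20 : 0 < √2 := by positivity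
  have k1 := kappa_lt
  have hc : InCone i (q - u) := by
    have a := (hn (i + 3)).1 (by rw [← vx_succ]; exact vx_mem hu _)
    have b := (hn (i + 6)).1 (by rw [← vx_pred]; exact vx_mem hu _)
    rw [show i + 3 = i - 1 + 4 by grind, ip_add_four, ip_sub_vx, ip_pred_v] at a
    rw [show i + 6 = i + 2 + 4 by grind, ip_add_four, ip_sub_vx, ip_add_two_v] at b
    constructor <;> linarith
  refine ⟨hc, ?_⟩
  obtain ⟨-, -, c3, c4, c5, c6⟩ := hc.nonpos
  have far (l : Fin 8) (h : ip l (q - u) ≤ 0) : (nb n u l ∈ centres n → ip l (q - u) ≤ rho ^ n / 2) ∧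
      (dg n u l ∈ centres n → ip l (q - u) ≤ √2 / 2 * rho ^ n) := by
    have := rho_pow_pos n
    exact ⟨fun _ => by linarith, fun _ => h.trans (by positivity)⟩
  have side (l : Fin 8) (h : ip l (v i) = 1 / 2) : ip l (q - u) ≤ √2 / 2 * rho ^ n := by
    have a := hr l
    rw [ip_sub_vx, h] at a
    rw [hpow]
    nlinarith [sqrt_two_gt]
  have mirror (l : Fin 8) (h : ip l (v i) = 1 / 2)
      (h2 : dg (n + 1) (vx n u i) l ∈ centres (n + 1)) : ip l (q - u) ≤ rho ^ n / 2 := by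
    have a := (hn l).2 h2
    rw [ip_sub_vx, h] at a
    rw [hpow]
    linarith
  have front (l : Fin 8) (h : ip l (v i) = (1 + √2) / 2)
      (h2 : nb (n + 1) (vx n u i) l ∈ centres (n + 1)) : ip l (q - u) ≤ √2 / 2 * rho ^ n := by
    have a := (hn l).1 h2
    rw [ip_sub_vx, h] at a
    rw [hpow]
    nlinarith
  refine fin_eight_shift i ⟨hp.1, fun h => ?_⟩ ⟨hp.2, fun h => ?_⟩ ⟨fun h => ?_, fun h => ?_⟩
    (far _ c3) (far _ c4) (far _ c5) (far _ c6) ⟨fun h => ?_, fun h => ?_⟩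
  · exact front _ (ip_v_self i) (by rw [← vx_dg]; exact vx_mem h _)
  · exact front _ (ip_succ_v i) (by rw [← vx_dg']; exact vx_mem h _)
  · refine mirror _ (ip_add_two_v i) ?_
    have := vx_mem h (i + 2 + 5)
    rwa [vx_nb_mirror', show i + 2 - 2 = i by grind] at this
  · exact side _ (ip_add_two_v i)
  · refine mirror _ (ip_pred_v i) ?_
    have := vx_mem h (i - 1 + 2)
    rwa [vx_nb_mirror, show i - 1 + 1 = i by grind] at this
  · exact side _ (ip_pred_v i)

/-- On or beyond the bisector the second parent is preferred; its only competitor is `u`, as a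
vertex has at most two parents. -/
theorem Preferred.other {n : ℕ} {u q : Plane} {i : Fin 8}
    (hu : u ∈ centres n) (hq : rho ^ n / 2 ≤ ip i (q - u)) :
    Preferred n (nb n u i) (i + 3) q := by
  have h4 : i + 3 + 1 = i + 4 := by grind
  constructor
  · intro h'
    refine (not_nb_nb_succ h' ?_).elim
    rwa [h4, nb_nb]
  · intro _
    rw [h4, ip_add_four, ip_sub_nb, ip_e_self]
    linarith

theorem Preferred.other' {n : ℕ} {u q : Plane} {i : Fin 8}
    (hu : u ∈ centres n) (hq : rho ^ n / 2 ≤ ip (i + 1) (q - u)) :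
    Preferred n (nb n u (i + 1)) (i + 5) q := by
  have h4 : i + 5 = i + 1 + 4 := by grind
  constructor
  · intro _
    rw [h4, ip_add_four, ip_sub_nb, ip_e_self]
    linarith
  · intro h'
    refine (not_nb_nb_succ (l := i + 5) ?_ h').elim
    rwa [h4, nb_nb]

theorem exists_preferred {n : ℕ} {w : Plane} (hw : w ∈ centres (n + 1)) (q : Plane) :
    ∃ u ∈ centres n, ∃ i, w = vx n u i ∧ Preferred n u i q := by
  obtain ⟨u, hu, i, rfl⟩ := mem_centres_succ.1 hw
  by_cases h1 : nb n u i ∈ centres n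
  · rcases le_total (ip i (q - u)) (rho ^ n / 2) with h | h
    · exact ⟨u, hu, i, rfl, fun _ => h, fun h2 => (not_nb_nb_succ h1 h2).elim⟩
    · exact ⟨_, h1, i + 3, (vx_nb _ _ _).symm, Preferred.other hu h⟩
  · by_cases h2 : nb n u (i + 1) ∈ centres n
    · rcases le_total (ip (i + 1) (q - u)) (rho ^ n / 2) with h | h
      · exact ⟨u, hu, i, rfl, fun h3 => absurd h3 h1, fun _ => h⟩
      · exact ⟨_, h2, i + 5, (vx_nb' _ _ _).symm, Preferred.other' hu h⟩
    · exact ⟨u, hu, i, rfl, fun h3 => absurd h3 h1, fun h3 => absurd h3 h2⟩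

/-- `Reach` brings the two centres within the range of `trichotomy`, and `Near` excludes neighbours
and diagonal neighbours. -/
theorem eq_of_near {n : ℕ} {u x q : Plane} (hu : u ∈ centres n) (hx : x ∈ centres n)
    (hn : Near n u q) (hr : Reach n u q) (hq : ∀ l, ip l (q - x) < rho ^ n / 2) : x = u := by
  have hpos := rho_pow_pos n
  have k1 := kappa_lt
  have hs := sqrt_two_gt
  have hd (l : Fin 8) : ip l (x - u) = ip l (q - u) - ip l (q - x) := by
    rw [← map_sub]; congr 1; abel
  rcases trichotomy hu hx (fun l => by
    have a := hr l
    have b := hq (l + 4)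
    rw [ip_add_four] at b
    rw [hd]
    nlinarith) with h | ⟨l, rfl⟩ | ⟨l, rfl⟩
  · exact h
  · have a := (hn l).1 hx
    have b := hq (l + 4)
    rw [ip_add_four, ip_sub_nb, ip_e_self] at b
    linarith
  · have a := (hn l).2 hx
    have b := hq (l + 4)
    rw [ip_add_four, map_sub, ip_dg, ip_e_self] at b
    rw [map_sub] at a
    nlinarith

/-! ### Red points are near red octagons -/

/-- The vertex number `i` of the octagon with centre `u`, or the vertex following it on a free edge,
is a red vertex of some octagon. -/
def RedNear (n : ℕ) (u : Plane) (i : Fin 8) : Prop :=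
  isRed n u i ∨
    (nb n u (i + 1) ∈ centres n ∧ (isRed n (nb n u (i + 1)) (i + 5) ∨ isRed n u (i - 1))) ∨
    (nb n u i ∈ centres n ∧ (isRed n (nb n u i) (i + 3) ∨ isRed n u (i + 1)))

/-- By parity the piece `i + 4` of the new octagon is red. For the two other indices it is the
adjoining piece, and the next vertex of `u` on that side is the required neighbour. -/
theorem RedNear.of_isRed {n : ℕ} {u : Plane} {i j : Fin 8} (h : isRed n u i)
    (hj : j = i + 3 ∨ j = i + 4 ∨ j = i + 5) : RedNear (n + 1) (vx n u i) j := by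
  rcases hj with rfl | rfl | rfl
  · refine Or.inr (Or.inr ⟨?_, Or.inr (h.vx ?_)⟩)
    · rw [← vx_succ]; exact vx_mem h.mem_centres _
    · clear * -; revert i; decide
  · exact Or.inl (h.vx (by clear * -; revert i; decide))
  · refine Or.inr (Or.inl ⟨?_, Or.inr (h.vx ?_)⟩)
    · rw [show i + 5 + 1 = i + 6 by grind, ← vx_pred]; exact vx_mem h.mem_centres _
    · clear * -; revert i; decide

/-- The edge of `u` from vertex `i` to vertex `i + 1` is shared, the one to vertex `i - 1` is free;
the piece `i + 6` lies just outside the free edge. Parity decides which alternative of `RedNear` is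
inherited. -/
theorem RedNear.step {n : ℕ} {u : Plane} {i : Fin 8} (hu : u ∈ centres n)
    (h2 : nb n u (i + 1) ∈ centres n) (h : RedNear n u i) :
    RedNear (n + 1) (vx n u i) (i + 6) := by
  have hm : nb (n + 1) (vx n u i) (i + 6) ∈ centres (n + 1) := by
    rw [← vx_pred]; exact vx_mem hu _
  rcases h with h | ⟨-, h | h⟩ | ⟨h, -⟩
  · exact Or.inl (h.vx (by clear * -; revert i; decide))
  · refine Or.inr (Or.inr ⟨hm, Or.inr ?_⟩)
    rw [← vx_nb']
    exact h.vx (by clear * -; revert i; decide)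
  · refine Or.inr (Or.inr ⟨hm, Or.inl ?_⟩)
    rw [← vx_pred]
    exact h.vx (by clear * -; revert i; decide)
  · exact (not_nb_nb_succ h h2).elim

theorem RedNear.step' {n : ℕ} {u : Plane} {i : Fin 8} (hu : u ∈ centres n)
    (h2 : nb n u i ∈ centres n) (h : RedNear n u i) :
    RedNear (n + 1) (vx n u i) (i + 2) := by
  have hm : nb (n + 1) (vx n u i) (i + 2 + 1) ∈ centres (n + 1) := by
    rw [show i + 2 + 1 = i + 3 by grind, ← vx_succ]; exact vx_mem hu _
  rcases h with h | ⟨h, -⟩ | ⟨-, h | h⟩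
  · exact Or.inl (h.vx (by clear * -; revert i; decide))
  · exact (not_nb_nb_succ h2 h).elim
  · refine Or.inr (Or.inl ⟨hm, Or.inr ?_⟩)
    rw [← vx_nb]
    exact h.vx (by clear * -; revert i; decide)
  · refine Or.inr (Or.inl ⟨hm, Or.inl ?_⟩)
    rw [show i + 2 + 1 = i + 3 by grind, ← vx_succ]
    exact h.vx (by clear * -; revert i; decide)

theorem RedNear.step_single {n : ℕ} {u : Plane} {i : Fin 8} (hu : u ∈ centres n)
    (h1 : nb n u i ∉ centres n) (h2 : nb n u (i + 1) ∉ centres n) (h : RedNear n u i) (j : Fin 8) :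
    RedNear (n + 1) (vx n u i) j := by
  rcases h with h | ⟨h, -⟩ | ⟨h, -⟩
  · refine Or.inl (isRed_succ.2 ⟨u, hu, i, rfl, h, Or.inl ?_⟩)
    intro x hx k hk
    rcases vx_eq_vx hu hx hk.symm with ⟨rfl, rfl⟩ | ⟨rfl, -⟩ | ⟨rfl, -⟩
    · exact h
    · exact absurd hx h1
    · exact absurd hx h2
  · exact absurd h h2
  · exact absurd h h1

theorem InCone.index_of_neg {i j : Fin 8} {p : Plane} (h : InCone j p) (h1 : ip i p < 0)
    (h2 : ip (i + 1) p < 0) : j = i + 3 ∨ j = i + 4 ∨ j = i + 5 := by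
  obtain ⟨c0, c1, -⟩ := h.nonpos
  have key : ∀ k, ip k p < 0 → k ≠ j - 1 ∧ k ≠ j ∧ k ≠ j + 1 ∧ k ≠ j + 2 := by
    intro k hk
    refine ⟨?_, ?_, ?_, ?_⟩ <;> rintro rfl <;> linarith [h.1, h.2]
  have a := key _ h1
  have b := key _ h2
  clear * - a b
  revert i j; decide

theorem InCone.index_of_pos {i j : Fin 8} {p : Plane} (h : InCone j p) (h1 : 0 < ip i p)
    (h2 : ip (i + 1) p ≤ 0) : j = i + 6 ∨ (j = i - 1 ∧ ip (i + 1) p = 0) := by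
  obtain ⟨c0, c1, c3, c4, c5, c6⟩ := h.nonpos
  obtain ⟨t1, t2, -⟩ := ip_table j p
  obtain ⟨hd, hf⟩ := h
  have h20 : 0 < √2 := by positivity
  have m1 := mul_nonneg h20.le hd
  have m2 := mul_nonneg h20.le hf
  have hj : ∃ k, i = j + k := ⟨i - j, by grind⟩
  obtain ⟨k, rfl⟩ := hj
  revert h1 h2
  refine forall_fin_eight (P := fun k => 0 < ip (j + k) p → ip (j + k + 1) p ≤ 0 →
    j = j + k + 6 ∨ j = j + k - 1 ∧ ip (j + k + 1) p = 0) ?_ ?_ ?_ ?_ ?_ ?_ ?_ ?_ k <;> intro h1 h2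
  · rw [add_zero] at h1 h2; nlinarith [sqrt_two_lt, sqrt_two_gt, mul_nonneg hd (sub_nonneg.2 sqrt_two_lt.le),
      mul_nonneg hf (sub_nonneg.2 sqrt_two_lt.le), mul_nonneg hd (sub_nonneg.2 sqrt_two_gt.le),
      mul_nonneg hf (sub_nonneg.2 sqrt_two_gt.le)]
  · right
    refine ⟨by grind, le_antisymm h2 ?_⟩
    rwa [show j + 1 + 1 = j + 2 by grind]
  · left; grind
  · linarith
  · linarith
  · linarith
  · linarith
  · rw [show j + 7 + 1 = j by grind] at h2
    rw [show j + 7 = j - 1 by grind] at h1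
    nlinarith

theorem InCone.index_of_pos' {i j : Fin 8} {p : Plane} (h : InCone j p) (h1 : 0 < ip (i + 1) p)
    (h2 : ip i p ≤ 0) : j = i + 2 ∨ (j = i + 1 ∧ ip i p = 0) := by
  obtain ⟨c0, c1, c3, c4, c5, c6⟩ := h.nonpos
  obtain ⟨t1, t2, -⟩ := ip_table j p
  obtain ⟨hd, hf⟩ := h
  have h20 : 0 < √2 := by positivity
  have m1 := mul_nonneg h20.le hd
  have m2 := mul_nonneg h20.le hf
  have hj : ∃ k, i = j + k := ⟨i - j, by grind⟩
  obtain ⟨k, rfl⟩ := hj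
  revert h1 h2
  refine forall_fin_eight (P := fun k => 0 < ip (j + k + 1) p → ip (j + k) p ≤ 0 →
    j = j + k + 2 ∨ j = j + k + 1 ∧ ip (j + k) p = 0) ?_ ?_ ?_ ?_ ?_ ?_ ?_ ?_ k <;> intro h1 h2
  · rw [add_zero] at h1 h2; nlinarith [sqrt_two_lt, sqrt_two_gt, mul_nonneg hd (sub_nonneg.2 sqrt_two_lt.le),
      mul_nonneg hf (sub_nonneg.2 sqrt_two_lt.le), mul_nonneg hd (sub_nonneg.2 sqrt_two_gt.le),
      mul_nonneg hf (sub_nonneg.2 sqrt_two_gt.le)]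
  · rw [show j + 1 + 1 = j + 2 by grind] at h1; nlinarith
  · rw [show j + 2 + 1 = j + 3 by grind] at h1; linarith
  · rw [show j + 3 + 1 = j + 4 by grind] at h1; linarith
  · rw [show j + 4 + 1 = j + 5 by grind] at h1; linarith
  · rw [show j + 5 + 1 = j + 6 by grind] at h1; linarith
  · left; grind
  · right
    refine ⟨by grind, le_antisymm h2 ?_⟩
    rwa [show j + 7 = j - 1 by grind]

theorem InCone.mem_oct {n : ℕ} {u q : Plane} {i : Fin 8} (h : InCone i (q - u))
    (h1 : ip i (q - u) ≤ rho ^ n / 2) (h2 : ip (i + 1) (q - u) ≤ rho ^ n / 2) : q ∈ oct n u := by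
  obtain ⟨c0, c1, c3, c4, c5, c6⟩ := h.nonpos
  obtain ⟨t1, t2, -⟩ := ip_table i (q - u)
  obtain ⟨hd, hf⟩ := h
  have h20 := sqrt_two_gt
  have hpos := rho_pow_pos n
  rw [mem_oct_iff]
  refine fin_eight_shift i h1 h2 ?_ ?_ ?_ ?_ ?_ ?_
  · nlinarith
  · linarith
  · linarith
  · linarith
  · linarith
  · nlinarith

/-- The point is in the cone `i` of `u` but outside its octagon. If `w` has a second parent, `q` is
not past the shared edge, so it is past the free one, which fixes its cone at `w`. -/
theorem exists_parent_beyond {n : ℕ} {w q : Plane} {j : Fin 8} (hw : w ∈ centres (n + 1))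
    (hn : Near (n + 1) w q) (hr : Reach (n + 1) w q) (hc : InCone j (q - w))
    (hq : q ∉ packing n) : ∃ u ∈ centres n, ∃ i, w = vx n u i ∧ Preferred n u i q ∧
      ((nb n u i ∉ centres n ∧ nb n u (i + 1) ∉ centres n) ∨
        (nb n u (i + 1) ∈ centres n ∧ j = i + 6) ∨ (nb n u i ∈ centres n ∧ j = i + 2)) := by
  obtain ⟨u, hu, i, rfl, hp⟩ := exists_preferred hw q
  have hcu := (hn.parent hu hr hp).1
  have hout : q ∉ oct n u := fun h => hq (mem_packing.2 ⟨u, hu, h⟩)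
  have e1 : ip i (q - vx n u i) = ip i (q - u) - rho ^ n / 2 := by
    rw [ip_sub_vx, ip_v_self, half_rho]
  have e2 : ip (i + 1) (q - vx n u i) = ip (i + 1) (q - u) - rho ^ n / 2 := by
    rw [ip_sub_vx, ip_succ_v, half_rho]
  by_cases h1 : nb n u i ∈ centres n
  · have a := hp.1 h1
    have b : rho ^ n / 2 < ip (i + 1) (q - u) := by
      by_contra! hb
      exact hout (hcu.mem_oct a hb)
    rcases hc.index_of_pos' (i := i) (by linarith) (by linarith) with h | ⟨h, h0⟩
    · exact ⟨u, hu, i, rfl, hp, Or.inr (Or.inr ⟨h1, h⟩)⟩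
    -- On the bisector both parents are admissible, and the other one gives the index the required
    -- form.
    · refine ⟨_, h1, i + 3, (vx_nb _ _ _).symm, Preferred.other hu (by linarith),
        Or.inr (Or.inl ⟨?_, ?_⟩)⟩
      · rwa [show i + 3 + 1 = i + 4 by grind, nb_nb]
      · grind
  · by_cases h2 : nb n u (i + 1) ∈ centres n
    · have a := hp.2 h2
      have b : rho ^ n / 2 < ip i (q - u) := by
        by_contra! hb
        exact hout (hcu.mem_oct hb a)
      rcases hc.index_of_pos (i := i) (by linarith) (by linarith) with h | ⟨h, h0⟩
      · exact ⟨u, hu, i, rfl, hp, Or.inr (Or.inl ⟨h2, h⟩)⟩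
      · refine ⟨_, h2, i + 5, (vx_nb' _ _ _).symm, Preferred.other' hu (by linarith),
          Or.inr (Or.inr ⟨?_, ?_⟩)⟩
        · rwa [show i + 5 = i + 1 + 4 by grind, nb_nb]
        · grind
    · exact ⟨u, hu, i, rfl, hp, Or.inl ⟨h1, h2⟩⟩

theorem pieceInt_index {n : ℕ} {x q : Plane} {i j : Fin 8} (hq : q ∈ pieceInt n x i)
    (h : InCone j (q - x)) : j = i :=
  cone_unique hq.2.1 hq.2.2 h.1 h.2

/-- Around a point which is still red, the packing has red vertices. -/
theorem redNear_of_near {j n : ℕ} (hjn : j ≤ n) {x q : Plane} {i : Fin 8} (hx : isRed j x i)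
    (hq : q ∈ pieceInt j x i) (hav : ∀ l, j < l → l ≤ n → q ∉ packing l) {u : Plane}
    (hu : u ∈ centres n) (hn : Near n u q) (hr : Reach n u q) {k : Fin 8} (hk : InCone k (q - u)) :
    RedNear n u k := by
  induction n, hjn using Nat.le_induction generalizing u k with
  | base =>
    obtain rfl := eq_of_near hu hx.mem_centres hn hr hq.1
    obtain rfl := pieceInt_index hq hk
    exact Or.inl hx
  | succ n hjn ih =>
    have ih' := @ih fun l h1 h2 => hav l h1 (by lia)
    -- At level `j` itself `q` lies inside an octagon; only above it is `q` uncovered, as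
    -- `exists_parent_beyond` requires.
    rcases hjn.eq_or_lt with rfl | hlt
    · obtain ⟨w, hw, l, rfl, hp⟩ := exists_preferred hu q
      obtain ⟨hc, hnw⟩ := hn.parent hw hr hp
      obtain rfl := eq_of_near hw hx.mem_centres hnw hr.parent hq.1
      obtain rfl := pieceInt_index hq hc
      refine RedNear.of_isRed hx (hk.index_of_neg ?_ ?_)
      · rw [ip_sub_vx, ip_v_self, half_rho]; linarith [hq.1 l]
      · rw [ip_sub_vx, ip_succ_v, half_rho]; linarith [hq.1 (l + 1)]
    · obtain ⟨w, hw, l, rfl, hp, h⟩ := exists_parent_beyond hu hn hr hk (hav n hlt (by lia))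
      obtain ⟨hc, hnw⟩ := hn.parent hw hr hp
      have hred := ih' hw hnw hr.parent hc
      rcases h with ⟨h1, h2⟩ | ⟨h2, rfl⟩ | ⟨h1, rfl⟩
      · exact hred.step_single hw h1 h2 k
      · exact hred.step hw h2
      · exact hred.step' hw h1

/-- An octagon which covers red points is a descendant, and is a red octagon or has one nearby. -/
theorem covers_red {j n : ℕ} (hjn : j ≤ n) {x q : Plane} {i : Fin 8} (hx : isRed j x i)
    (hq : q ∈ pieceInt j x i) (hav : ∀ l, j < l → l ≤ n → q ∉ packing l) {y : Plane}
    (hy : y ∈ centres (n + 1)) (hqy : q ∈ oct (n + 1) y) :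
    y ∈ descendants (n + 1) ∧
      ∃ y' k, isRed (n + 1) y' k ∧ ∀ l, ip l (y' - y) ≤ rho ^ (n + 1) := by
  have hpos := rho_pow_pos (n + 1)
  have hself (l : Fin 8) : ip l (y - y) ≤ rho ^ (n + 1) := by
    rw [sub_self, map_zero]; exact hpos.le
  have hnb (m l : Fin 8) : ip l (nb (n + 1) y m - y) ≤ rho ^ (n + 1) := by
    rw [map_sub, ip_nb]
    nlinarith [ip_e_le l m]
  obtain ⟨u, hu, l, rfl, hp⟩ := exists_preferred hy q
  have hn := near_of_mem_oct hqy
  have hr := reach_of_mem_oct hqy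
  obtain ⟨hc, hnu⟩ := hn.parent hu hr hp
  rcases redNear_of_near hjn hx hq hav hu hnu hr.parent hc with h | ⟨-, h | h⟩ | ⟨-, h | h⟩
  · exact ⟨⟨u, h.mem_descendants, l, rfl⟩, _, _, h.vx rfl, hself⟩
  · refine ⟨⟨_, h.mem_descendants, l + 5, (vx_nb' _ _ _).symm⟩, _, _, h.vx rfl, ?_⟩
    rw [vx_nb']; exact hself
  · refine ⟨⟨u, h.mem_descendants, l, rfl⟩, _, _, h.vx rfl, ?_⟩
    rw [vx_pred]; exact hnb _
  · refine ⟨⟨_, h.mem_descendants, l + 3, (vx_nb _ _ _).symm⟩, _, _, h.vx rfl, ?_⟩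
    rw [vx_nb]; exact hself
  · refine ⟨⟨u, h.mem_descendants, l, rfl⟩, _, _, h.vx rfl, ?_⟩
    rw [vx_succ]; exact hnb _

/-! ### The stages as closures of open sets -/

/-- The interiors of the red pieces of level at most `n` outside the later octagons. -/
def redOpen (n : ℕ) : Set Plane :=
  {q | ∃ j ≤ n, ∃ x i, isRed j x i ∧ q ∈ pieceInt j x i ∧ ∀ l, j < l → l ≤ n → q ∉ packing l}

/-- The points that are red at all stages after some stage, together with a neighbourhood. -/
def redLimit : Set Plane :=
  {q | ∃ j x i, isRed j x i ∧ q ∈ pieceInt j x i ∧ q ∉ closure (⋃ l > j, packing l)}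

theorem mem_redOpen_self {n : ℕ} {x q : Plane} {i : Fin 8} (h : isRed n x i)
    (hq : q ∈ pieceInt n x i) : q ∈ redOpen n :=
  ⟨n, le_rfl, x, i, h, hq, fun l h1 h2 => absurd h1 (by lia)⟩

theorem eventually_notMem_packing {j n : ℕ} {q : Plane}
    (h : ∀ l, j < l → l ≤ n → q ∉ packing l) :
    ∀ᶠ p in 𝓝 q, ∀ l, j < l → l ≤ n → p ∉ packing l := by
  have : ∀ᶠ p in 𝓝 q, ∀ l ∈ Finset.Ioc j n, p ∉ packing l := by
    rw [Filter.eventually_all_finset]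
    intro l hl
    rw [Finset.mem_Ioc] at hl
    exact (isClosed_packing l).isOpen_compl.mem_nhds (h l hl.1 hl.2)
  filter_upwards [this] with p hp l h1 h2
  exact hp l (Finset.mem_Ioc.2 ⟨h1, h2⟩)

theorem isOpen_redLimit : IsOpen redLimit := by
  rw [isOpen_iff_mem_nhds]
  rintro q ⟨j, x, i, h, hq, hn⟩
  filter_upwards [(isOpen_pieceInt j x i).mem_nhds hq, isClosed_closure.isOpen_compl.mem_nhds hn]
    with p h1 h2
  exact ⟨j, x, i, h, h1, h2⟩

theorem redLimit_mem_redOpen {q : Plane} (h : q ∈ redLimit) : ∀ᶠ n in atTop, q ∈ redOpen n := by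
  obtain ⟨j, x, i, h, hq, hn⟩ := h
  filter_upwards [eventually_ge_atTop j] with n hjn
  refine ⟨j, hjn, x, i, h, hq, fun l h1 _ hl => hn (subset_closure ?_)⟩
  exact Set.mem_biUnion h1 hl

/-- Pieces are the closures of their interiors and the packings are closed, so passing to interiors
loses nothing after closure and unrolls the recursion. -/
theorem stage_eq (n : ℕ) : stage n = closure (redOpen n) := by
  have hred (n : ℕ) {x : Plane} {i : Fin 8} (h : isRed n x i) :
      piece (edge n) x i ⊆ closure (redOpen n) :=
    (piece_subset_closure n x i).trans (closure_mono fun q hq => mem_redOpen_self h hq)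
  induction n with
  | zero =>
    apply Set.Subset.antisymm
    · change oct 0 0 ⊆ _
      rw [oct_eq_iUnion]
      exact Set.iUnion_subset fun i => hred 0 (rfl : isRed 0 0 i)
    · refine closure_minimal ?_ (isCompact_octagon _ _).isClosed
      rintro q ⟨j, hj, x, i, h, hq, -⟩
      obtain rfl : j = 0 := by lia
      obtain rfl : x = 0 := h
      exact (pieceInt_subset _ _ _ hq).1
  | succ n ih =>
    change closure ((stage n \ packing (n + 1)) ∪ redPart (n + 1)) = _
    apply Set.Subset.antisymm
    · refine closure_minimal (Set.union_subset ?_ ?_) isClosed_closure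
      · rw [ih]
        rintro q ⟨h1, h2⟩
        have := (isClosed_packing (n + 1)).isOpen_compl.inter_closure ⟨h2, h1⟩
        refine closure_mono ?_ this
        rintro p ⟨hp, j, hj, x, i, h, hq, hl⟩
        refine ⟨j, by lia, x, i, h, hq, fun l h1 h2 => ?_⟩
        rcases Nat.le_succ_iff.1 h2 with h3 | rfl
        · exact hl l h1 h3
        · exact hp
      · refine Set.iUnion₂_subset fun x _ => Set.iUnion₂_subset fun i hi => hred _ hi
    · refine closure_mono ?_
      rintro q ⟨j, hj, x, i, h, hq, hl⟩
      rcases Nat.le_succ_iff.1 hj with h3 | rfl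
      · left
        refine ⟨?_, hl _ (by lia) le_rfl⟩
        rw [ih]
        exact subset_closure ⟨j, h3, x, i, h, hq, fun l h1 h2 => hl l h1 (by lia)⟩
      · right
        simp only [redPart, Set.mem_iUnion]
        exact ⟨x, h.mem_centres, i, h, pieceInt_subset _ _ _ hq⟩

/-! ### Distances -/

theorem norm_le_of_ip_le {p : Plane} {c : ℝ} (h : ∀ l, ip l p ≤ c) : ‖p‖ ≤ 2 * c := by
  have h0 := h 0
  have h2 := h 2
  have h4 := h (0 + 4)
  have h6 := h (2 + 4)
  rw [ip_add_four] at h4 h6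
  rw [ip_zero] at h0 h4
  rw [ip_two] at h2 h6
  have hc : 0 ≤ c := by linarith
  rw [EuclideanSpace.norm_eq]
  refine Real.sqrt_le_iff.2 ⟨by positivity, ?_⟩
  simp only [Fin.sum_univ_two, Real.norm_eq_abs, sq_abs]
  nlinarith [abs_le.2 ⟨by linarith, h0⟩, abs_le.2 ⟨by linarith, h2⟩, sq_le_sq' (by linarith) h0,
    sq_le_sq' (by linarith) h2]

theorem dist_le_of_ip_le {p q : Plane} {c : ℝ} (h : ∀ l, ip l (p - q) ≤ c) : dist p q ≤ 2 * c := by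
  rw [dist_eq_norm]; exact norm_le_of_ip_le h

theorem notMem_closure_of_near {n : ℕ} {x q : Plane} (hx : x ∈ centres n)
    (hq : ∀ l, ip l (q - x) < (1 - kappa) * rho ^ n) : q ∉ closure (⋃ l > n, packing l) := by
  have ho : IsOpen {q : Plane | ∀ l, ip l (q - x) < (1 - kappa) * rho ^ n} := by
    simp only [Set.ofPred_forall]
    exact isOpen_iInter_of_finite fun l => isOpen_lt (by fun_prop) continuous_const
  intro h
  obtain ⟨p, hp1, hp2⟩ := mem_closure_iff.1 h _ ho hq
  obtain ⟨m, hm, hpm⟩ := Set.mem_iUnion₂.1 hp2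
  exact notMem_packing_of_near hm hx hp1 hpm

/-- Close to the centre of an octagon its pieces survive. -/
theorem eventually_survives {n : ℕ} {x : Plane} (hx : x ∈ centres n) (i : Fin 8) :
    ∀ᶠ t in 𝓝[>] (0 : ℝ), x + (t * rho ^ (n + 1)) • v i ∈ pieceInt n x i ∧
      x + (t * rho ^ (n + 1)) • v i ∉ closure (⋃ l > n, packing l) := by
  -- Any bound below `2 * (1 - kappa) ≈ 0.29` would do: the point is at most `t * rho ^ n / 2` from
  -- `x` in each direction.
  filter_upwards [Ioo_mem_nhdsGT (show (0 : ℝ) < 1 / 4 by norm_num)] with t ht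
  refine ⟨add_smul_v_mem_pieceInt ht.1 (by linarith [ht.2]), notMem_closure_of_near hx fun l => ?_⟩
  rw [add_sub_cancel_left, map_smul, smul_eq_mul, mul_assoc]
  have h1 := mul_le_mul_of_nonneg_left (ip_v_le l i) (rho_pow_pos (n + 1)).le
  rw [half_rho] at h1
  have h2 := rho_pow_pos n
  have h3 := kappa_lt
  have h4 := mul_le_mul_of_nonneg_left h1 ht.1.le
  nlinarith [ht.2]

theorem tendsto_add_smul_v (n : ℕ) (x : Plane) (i : Fin 8) :
    Tendsto (fun t : ℝ => x + (t * rho ^ (n + 1)) • v i) (𝓝[>] 0) (𝓝 x) := by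
  have : Tendsto (fun t : ℝ => x + (t * rho ^ (n + 1)) • v i) (𝓝[>] 0)
      (𝓝 (x + ((0 : ℝ) * rho ^ (n + 1)) • v i)) :=
    (Continuous.tendsto (by fun_prop) _).mono_left nhdsWithin_le_nhds
  simpa using this

theorem isRed.mem_closure_redLimit {n : ℕ} {x : Plane} {i : Fin 8} (h : isRed n x i) :
    x ∈ closure redLimit := by
  refine mem_closure_of_tendsto (tendsto_add_smul_v n x i) ?_
  filter_upwards [eventually_survives h.mem_centres i] with t ht
  exact ⟨n, x, i, h, ht.1, ht.2⟩

theorem isRed.mem_closure_redOpen {n : ℕ} {x : Plane} {i : Fin 8} (h : isRed n x i) :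
    x ∈ closure (redOpen n) := by
  refine mem_closure_of_tendsto (tendsto_add_smul_v n x i) ?_
  filter_upwards [eventually_survives h.mem_centres i] with t ht
  exact mem_redOpen_self h ht.1

theorem isRed.exists_ancestor {n m : ℕ} (hnm : n ≤ m) {y q : Plane} {i : Fin 8} (hy : isRed m y i)
    (h : Reach m y q) : ∃ x k, isRed n x k ∧ Reach n x q := by
  induction m, hnm using Nat.le_induction generalizing y i with
  | base => exact ⟨y, i, hy, h⟩
  | succ m _ ih =>
    obtain ⟨u, -, k, rfl, hr, -⟩ := isRed_succ.1 hy
    exact ih hr h.parent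

/-- An octagon with a red piece descends only through octagons with red pieces; the ancestor at
level `n` is within reach. -/
theorem exists_redOpen_near {n : ℕ} {p : Plane} (hp : p ∈ redLimit) :
    ∃ q ∈ redOpen n, dist p q ≤ 5 * rho ^ n := by
  have hpos := rho_pow_pos n
  obtain ⟨j, x, i, h, hq, hn⟩ := hp
  rcases le_or_gt j n with hj | hj
  · refine ⟨p, ⟨j, hj, x, i, h, hq, fun l h1 _ hl => hn (subset_closure ?_)⟩, ?_⟩
    · exact Set.mem_biUnion h1 hl
    · rw [dist_self]; positivity
  · obtain ⟨u, k, hu, hr⟩ := h.exists_ancestor hj.le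
      (reach_of_mem_oct (pieceInt_subset _ _ _ hq).1)
    obtain ⟨q, hq1, hq2⟩ := Metric.mem_closure_iff.1 hu.mem_closure_redOpen _ hpos
    refine ⟨q, hq1, ?_⟩
    have := dist_le_of_ip_le hr
    nlinarith [dist_triangle p u q, kappa_lt]

theorem rho_pow_le {m n : ℕ} (h : n ≤ m) : rho ^ m ≤ rho ^ n :=
  pow_le_pow_of_le_one rho_pos.le (by linarith [rho_lt]) h

/-- If `q` does not survive, some point near it is covered after level `n`. The first octagon to
cover that point has a red piece or a neighbour with one, whose centre is a limit of surviving red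
points. -/
theorem exists_redLimit_near {n : ℕ} {q : Plane} (hq : q ∈ redOpen n) :
    ∃ p ∈ redLimit, dist q p ≤ 5 * rho ^ n := by
  have hpos := rho_pow_pos n
  obtain ⟨j, hj, x, i, h, hq, hl⟩ := hq
  by_cases hn : q ∈ closure (⋃ l > j, packing l)
  · have hev : ∀ᶠ p in 𝓝 q, p ∈ pieceInt j x i ∧ (∀ l, j < l → l ≤ n → p ∉ packing l) ∧
        p ∈ Metric.ball q (rho ^ n) := by
      filter_upwards [(isOpen_pieceInt j x i).mem_nhds hq, eventually_notMem_packing hl,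
        Metric.ball_mem_nhds q hpos] with p h1 h2 h3
      exact ⟨h1, h2, h3⟩
    obtain ⟨q', ⟨a1, a2, a3⟩, a4⟩ := mem_closure_iff_nhds.1 hn _ hev
    obtain ⟨m, hm, hqm⟩ := Set.mem_iUnion₂.1 a4
    classical
    have hex : ∃ m, j < m ∧ q' ∈ packing m := ⟨m, hm, hqm⟩
    obtain ⟨b1, b2⟩ := Nat.find_spec hex
    have b3 : ∀ l, j < l → l < Nat.find hex → q' ∉ packing l :=
      fun l h1 h2 h3 => Nat.find_min hex h2 ⟨h1, h3⟩
    have hnm : n < Nat.find hex := by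
      by_contra! hc
      exact a2 _ b1 hc b2
    obtain ⟨m, hm⟩ : ∃ m, Nat.find hex = m + 1 := 
      ⟨_, (Nat.succ_pred_eq_of_pos (Nat.zero_lt_of_lt hnm)).symm⟩
    rw [hm] at b1 b2 b3 hnm
    obtain ⟨y, hy, hqy⟩ := mem_packing.1 b2
    obtain ⟨-, y', k, hred, hd⟩ := covers_red (n := m) (by lia) h a1
      (fun l h1 h2 => b3 l h1 (by lia)) hy hqy
    obtain ⟨p, hp1, hp2⟩ := Metric.mem_closure_iff.1 hred.mem_closure_redLimit _ hpos
    refine ⟨p, hp1, ?_⟩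
    -- The legs `q q'`, `q' y`, `y y'`, `y' p` are at most `1`, `1`, `2`, `1` times `rho ^ n`,
    -- whence the `5`.
    have d1 := dist_le_of_ip_le hd
    have d2 := dist_le_of_ip_le ((mem_oct_iff _ _ _).1 hqy)
    have d3 := rho_pow_le (n := n) (m := m + 1) (by lia)
    rw [Metric.mem_ball] at a3
    have t1 := dist_triangle4 q q' y p
    have t2 := dist_triangle y y' p
    rw [dist_comm q q'] at t1
    rw [dist_comm y y'] at t2
    linarith
  · exact ⟨q, ⟨j, x, i, h, hq, hn⟩, by rw [dist_self]; positivity⟩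

/-! ### Convergence of the stages and compactness of the cell. -/

theorem tendsto_rho_pow (c : ℝ) : Tendsto (fun n : ℕ => c * rho ^ n) atTop (𝓝 0) := by
  simpa using (tendsto_pow_atTop_nhds_zero_of_lt_one rho_pos.le
    (by linarith [rho_lt])).const_mul c

/-- Every point of `stage n` is within `6 * rho ^ n` of `redLimit`, so membership in arbitrarily
late stages puts a point into the closure. -/
theorem cell_eq : cell = closure redLimit := by
  apply Set.Subset.antisymm
  · refine closure_minimal ?_ isClosed_closure
    intro p hp
    rw [Metric.mem_closure_iff]
    intro ε hε
    have h1 : ∀ᶠ n : ℕ in atTop, 6 * rho ^ n < ε := (tendsto_rho_pow 6).eventually_lt_const hε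
    obtain ⟨n, hn1, hn2⟩ := ((show ∀ᶠ n in atTop, p ∈ stage n from hp).and h1).exists
    rw [stage_eq] at hn1
    obtain ⟨q, hq1, hq2⟩ := Metric.mem_closure_iff.1 hn1 _ (rho_pow_pos n)
    obtain ⟨r, hr1, hr2⟩ := exists_redLimit_near hq1
    exact ⟨r, hr1, by linarith [dist_triangle p q r]⟩
  · refine closure_mono fun q hq => ?_
    filter_upwards [redLimit_mem_redOpen hq] with n hn
    rw [stage_eq]
    exact subset_closure hn

theorem tendsto_hausdorffEDist :
    Tendsto (fun n => Metric.hausdorffEDist (stage n) cell) atTop (𝓝 0) := by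
  have h0 : Tendsto (fun n : ℕ => ENNReal.ofReal (5 * rho ^ n)) atTop (𝓝 0) := by
    have := (ENNReal.continuous_ofReal.tendsto 0).comp (tendsto_rho_pow 5)
    rwa [ENNReal.ofReal_zero] at this
  refine tendsto_of_tendsto_of_tendsto_of_le_of_le tendsto_const_nhds h0 (fun _ => bot_le) fun n => ?_
  change Metric.hausdorffEDist (stage n) cell ≤ ENNReal.ofReal (5 * rho ^ n)
  rw [stage_eq, cell_eq, Metric.hausdorffEDist_closure]
  have hpos := rho_pow_pos n
  refine Metric.hausdorffEDist_le_of_mem_edist (fun q hq => ?_) fun p hp => ?_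
  · obtain ⟨p, hp, hd⟩ := exists_redLimit_near hq
    exact ⟨p, hp, by rw [edist_dist]; exact ENNReal.ofReal_le_ofReal hd⟩
  · obtain ⟨q, hq, hd⟩ := exists_redOpen_near (n := n) hp
    exact ⟨q, hq, by rw [edist_dist]; exact ENNReal.ofReal_le_ofReal hd⟩

theorem ip_le_of_mem_cell {p : Plane} (hp : p ∈ cell) (l : Fin 8) : ip l p ≤ kappa := by
  rw [cell_eq] at hp
  have hc : IsClosed {p : Plane | ip l p ≤ kappa} := isClosed_le (by fun_prop) continuous_const
  refine closure_minimal ?_ hc hp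
  rintro q ⟨j, x, i, h, hq, -⟩
  obtain ⟨u, k, hu, hr⟩ := h.exists_ancestor (Nat.zero_le j)
    (reach_of_mem_oct (pieceInt_subset _ _ _ hq).1)
  obtain rfl : u = 0 := hu
  simpa using hr l

theorem isCompact_cell : IsCompact cell := by
  refine Metric.isCompact_of_isClosed_isBounded isClosed_closure ?_
  refine (Metric.isBounded_closedBall (x := (0 : Plane)) (r := 2 * kappa)).subset fun p hp => ?_
  rw [mem_closedBall_zero_iff]
  exact norm_le_of_ip_le (ip_le_of_mem_cell hp)

/-! ### Translates of the cell have disjoint interiors -/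

theorem mem_packing_add {n : ℕ} {q g : Plane} (hg : g ∈ squareLattice) (hq : q ∈ packing n) :
    q + g ∈ packing n := by
  obtain ⟨x, hx, h⟩ := mem_packing.1 hq
  refine mem_packing.2 ⟨x + g, mem_centres_add hg hx, ?_⟩
  rw [mem_oct_iff] at h ⊢
  simpa using h

/-- Packings are periodic and both points avoid all packings after their own level, so the levels
agree. Interiors of distinct pieces are disjoint, so the pieces agree too, and `colour_unique`
applies. -/
theorem colours_disjoint {q g h : Plane} (hg : g ∈ squareLattice) (hh : h ∈ squareLattice)
    (h1 : q - g ∈ redLimit) (h2 : q - h ∈ redLimit) : g = h := by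
  obtain ⟨j, x, i, r1, a1, b1⟩ := h1
  obtain ⟨k, y, l, r2, a2, b2⟩ := h2
  have cover {n : ℕ} {x q g : Plane} {i : Fin 8} (hr : isRed n x i) (hg : g ∈ squareLattice)
      (hq : q - g ∈ pieceInt n x i) : q ∈ packing n := by
    have := mem_packing_add hg
      (mem_packing.2 ⟨x, hr.mem_centres, (pieceInt_subset _ _ _ hq).1⟩)
    rwa [sub_add_cancel] at this
  have avoid {n m : ℕ} {q g : Plane} (hnm : n < m) (hg : g ∈ squareLattice)
      (hq : q - g ∉ closure (⋃ l > n, packing l)) : q ∉ packing m := by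
    intro h
    have := mem_packing_add (squareLattice.neg_mem hg) h
    rw [← sub_eq_add_neg] at this
    exact hq (subset_closure (Set.mem_biUnion hnm this))
  obtain rfl : j = k := by
    rcases lt_trichotomy j k with hjk | hjk | hjk
    · exact absurd (cover r2 hh a2) (avoid hjk hg b1)
    · exact hjk
    · exact absurd (cover r1 hg a1) (avoid hjk hh b2)
  have shift {x q g : Plane} {i : Fin 8} (hq : q - g ∈ pieceInt j x i) :
      q ∈ pieceInt j (x + g) i := by
    have e : q - g - x = q - (x + g) := by abel
    simpa only [pieceInt, Set.mem_ofPred_eq, e] using hq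
  have s1 := shift a1
  have s2 := shift a2
  have exy : x + g = y + h := by
    refine eq_of_close (mem_centres_add hh r2.mem_centres) (mem_centres_add hg r1.mem_centres) ?_
    intro l
    have c1 := s1.1 (l + 4)
    have c2 := s2.1 l
    rw [ip_add_four] at c1
    rw [show x + g - (y + h) = (q - (y + h)) - (q - (x + g)) by abel, map_sub]
    linarith
  rw [← exy] at s2
  obtain rfl := pieceInt_index s1 (j := l) ⟨s2.2.1.le, s2.2.2.le⟩
  refine colour_unique (x := x + g) hg hh (by rwa [add_sub_cancel_right]) ?_
  rw [exy, add_sub_cancel_right]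
  exact r2

/-! ### The octagons are dense -/

/-- The points around the centre `c` of a square of the lattice which are octagon centres. -/
def corner (m : ℕ) (c : Plane) (k : Fin 8) : Plane := c + (rho ^ m * (√2 / 2)) • e k

/-- At each level four centres surround `c`; one level on they are turned through `π / 4` and `rho`
times as far away. -/
theorem corner_succ (m : ℕ) (c : Plane) (k : Fin 8) :
    corner (m + 1) c k = vx m (corner m c (k - 1)) (k + 2) := by
  have h : (√2 / 2) • e k = (1 + √2) • (√2 / 2) • e (k - 1) + v (k + 2) := by
    rw [← toVec_eZ, ← toVec_eZ, ← toVec_vZ, smul_comm, ← toVec_invZ, div_eq_inv_mul, mul_smul,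
      mul_smul, ← toVec_mulR, ← toVec_mulR]
    have : mulR (eZ k) = mulR (invZ (eZ (k - 1))) + (vZ (k + 2) + vZ (k + 2)) := by
      revert k; decide
    rw [this, toVec_add, toVec_add]
    module
  rw [vx_eq, corner, corner, mul_smul, h, rho_pow_succ m]
  module

theorem corner_mem {c : Plane} (hc : ∀ i, ∃ z : ℤ, c i = z + 1 / 2) (m : ℕ) (k : Fin 8)
    (hk : (k : ℕ) % 2 = (m + 1) % 2) : corner m c k ∈ centres m := by
  induction m generalizing k with
  | zero =>
    obtain ⟨z, hz⟩ := hc 0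
    obtain ⟨w, hw⟩ := hc 1
    have h2 := sqrt_two_sq
    have key (a b : ℤ) (h : (√2 / 2) • e k = !₂[(a : ℝ) - 1 / 2, (b : ℝ) - 1 / 2]) :
        corner 0 c k ∈ centres 0 := by
      rw [corner, pow_zero, one_mul, h]
      intro i
      fin_cases i
      · exact ⟨z + a, by simp [hz]⟩
      · exact ⟨w + b, by simp [hw]⟩
    have s : √2 / 2 * (√2 / 2) = 1 / 2 := by linarith
    have hk' : k = 1 ∨ k = 3 ∨ k = 5 ∨ k = 7 := by clear * - hk; revert k; decide
    rcases hk' with rfl | rfl | rfl | rfl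
    · apply key 1 1; ext i; fin_cases i <;> simp [e_one, s] <;> norm_num
    · apply key 0 1; ext i; fin_cases i <;> simp [e_three, s] <;> norm_num
    · apply key 0 0; ext i; fin_cases i <;> simp [e_five, s]
    · apply key 1 0; ext i; fin_cases i <;> simp [e_seven, s] <;> norm_num
  | succ m ih =>
    rw [corner_succ]
    refine vx_mem (ih _ ?_) _
    have : (k : ℕ) % 2 ≠ ((k - 1 : Fin 8) : ℕ) % 2 := by clear * -; revert k; decide
    lia

/-- The octagon at a corner of a square about `c` covers the quarter square at that corner except
for the tip at `c`; the cut is at `rho ^ m * (√2 / 2) - rho ^ m / 2 = rho ^ (m + 1) / 2`. -/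
theorem mem_oct_corner {m : ℕ} {c q : Plane} {k : Fin 8} (h1 : 0 ≤ ip (k - 1) (q - c))
    (h2 : ip (k - 1) (q - c) ≤ rho ^ m / 2) (h3 : 0 ≤ ip (k + 1) (q - c))
    (h4 : ip (k + 1) (q - c) ≤ rho ^ m / 2) (h5 : rho ^ (m + 1) / 2 ≤ ip k (q - c)) :
    q ∈ oct m (corner m c k) := by
  have hpos := rho_pow_pos m
  have g1 := sqrt_two_gt
  have g2 := sqrt_two_lt
  have hs := sqrt_two_sq
  have a1 := ip_add_two (k - 1) (q - c)
  have a2 := ip_add_two k (q - c)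
  rw [show k - 1 + 2 = k + 1 by grind, show k - 1 + 1 = k by grind] at a1
  have e0 (l : Fin 8) : ip l (q - corner m c k) = ip l (q - c) - rho ^ m * (√2 / 2) * ip l (e k) := by
    rw [corner, ← sub_sub, map_sub ((ip l)) (q - c), map_smul, smul_eq_mul]
  have c0 : ip k (q - corner m c k) = ip k (q - c) - rho ^ m * (√2 / 2) := by
    rw [e0, ip_e_self, mul_one]
  have c1 : ip (k + 1) (q - corner m c k) = ip (k + 1) (q - c) - rho ^ m / 2 := by
    rw [e0, ip_succ_e]; linear_combination -rho ^ m / 4 * hs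
  have c2 : ip (k + 2) (q - corner m c k) = ip (k + 2) (q - c) := by
    rw [e0, ip_add_two_e, mul_zero, sub_zero]
  have c3 : ip (k - 1) (q - corner m c k) = ip (k - 1) (q - c) - rho ^ m / 2 := by
    rw [e0, ip_pred_e]; linear_combination -rho ^ m / 4 * hs
  rw [pow_succ, show rho = √2 - 1 from rfl] at h5
  change (√2 - 1) ^ m * (√2 - 1) / 2 ≤ _ at h5
  rw [show (√2 - 1) ^ m = rho ^ m from rfl] at h5
  rw [mem_oct_iff]
  generalize rho ^ m = r at *
  have a3 : ip (k + 2) (q - c) = ip k (q - c) - √2 * ip (k - 1) (q - c) := by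
    linear_combination a2 + √2 * a1 + ip k (q - c) * hs
  have e4 : k - 1 = k + 3 + 4 := by grind
  rw [e4] at c3 a3 h1 h2
  have m1 := mul_le_mul_of_nonneg_left h2 (Real.sqrt_nonneg 2)
  have m2 := mul_le_mul_of_nonneg_left h4 (Real.sqrt_nonneg 2)
  have m3 := mul_nonneg (Real.sqrt_nonneg 2) h1
  have m4 := mul_nonneg (Real.sqrt_nonneg 2) h3
  have e5 : k - 1 = k + 3 + 4 := by grind
  rw [e5] at a1
  have m5 : ip k (q - c) ≤ r * (√2 / 2) := by nlinarith
  simp only [ip_add_four] at c3 a3 h1 h2 m1 m3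
  refine fin_eight_shift k ?_ ?_ ?_ ?_ ?_ ?_ ?_ ?_ <;>
    first
    | rw [show k + 5 = k + 1 + 4 by grind, ip_add_four]
    | rw [show k + 6 = k + 2 + 4 by grind, ip_add_four]
    | rw [show k - 1 = k + 3 + 4 by grind, ip_add_four]
    | rw [ip_add_four]
    | skip
  all_goals linarith

/-- Removing the four corner octagons from a square about `c` leaves a part of the next square,
turned through `π / 4` and smaller by the factor `rho`. -/
theorem ip_le_of_notMem_packing {c q : Plane} (hc : ∀ i, ∃ z : ℤ, c i = z + 1 / 2)
    (hq : ∀ n, q ∉ packing n) (h0 : ∀ k : Fin 8, (k : ℕ) % 2 = 0 → ip k (q - c) ≤ 1 / 2) (m : ℕ) :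
    ∀ k : Fin 8, (k : ℕ) % 2 = m % 2 → ip k (q - c) ≤ rho ^ m / 2 := by
  induction m with
  | zero => simpa using h0
  | succ m ih =>
    intro k hk
    by_contra! hlt
    have par (k : Fin 8) : ((k + 1 : Fin 8) : ℕ) % 2 ≠ (k : ℕ) % 2 := by revert k; decide
    have no_corner (l : Fin 8) (hl : (l : ℕ) % 2 = (m + 1) % 2) (h1 : 0 ≤ ip (l - 1) (q - c))
        (h2 : 0 ≤ ip (l + 1) (q - c)) (h3 : rho ^ (m + 1) / 2 ≤ ip l (q - c)) : False := by
      have p1 := par l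
      have p2 := par (l - 1)
      rw [sub_add_cancel] at p2
      exact hq m (mem_packing.2 ⟨_, corner_mem hc m l hl, mem_oct_corner h1 (ih _ (by lia)) h2
        (ih _ (by lia)) h3⟩)
    have hs := sqrt_two_sq
    have hpos := rho_pow_pos (m + 1)
    have a1 := ip_add_two (k - 1) (q - c)
    have a2 := ip_add_two k (q - c)
    have a3 := ip_add_two (k - 2) (q - c)
    rw [show k - 1 + 2 = k + 1 by grind, show k - 1 + 1 = k by grind] at a1
    rw [sub_add_cancel, show k - 2 + 1 = k - 1 by grind] at a3
    have h0 : 0 ≤ √2 * ip k (q - c) := mul_nonneg (Real.sqrt_nonneg 2) (by linarith)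
    have e1 : ip (k + 2) (q - c) = ip k (q - c) - √2 * ip (k - 1) (q - c) := by
      linear_combination a2 + √2 * a1 + ip k (q - c) * hs
    have e2 : ip (k - 2) (q - c) = ip k (q - c) - √2 * ip (k + 1) (q - c) := by
      linear_combination a3 + √2 * a1 + ip k (q - c) * hs
    -- If `q` is not in the quarter facing `e k`, it is in that of `k + 2` or `k - 2`, where the
    -- inner product is even larger.
    rcases lt_or_ge (ip (k - 1) (q - c)) 0 with h1 | h1
    · have := mul_pos_of_neg_of_neg (neg_lt_zero.2 (Real.sqrt_pos.2 two_pos)) h1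
      refine no_corner (k + 2) ?_ ?_ ?_ (by linarith)
      · rw [← hk]; clear * -; revert k; decide
      · rw [show k + 2 - 1 = k + 1 by grind]; linarith
      · rw [show k + 2 + 1 = k - 1 + 4 by grind, ip_add_four]; linarith
    rcases lt_or_ge (ip (k + 1) (q - c)) 0 with h2 | h2
    · have := mul_pos_of_neg_of_neg (neg_lt_zero.2 (Real.sqrt_pos.2 two_pos)) h2
      refine no_corner (k - 2) ?_ ?_ ?_ (by linarith)
      · rw [← hk]; clear * -; revert k; decide
      · rw [show k - 2 - 1 = k + 1 + 4 by grind, ip_add_four]; linarith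
      · rw [show k - 2 + 1 = k - 1 by grind]; linarith
    · exact no_corner k hk h1 h2 hlt.le

/-- The shrinking squares leave only the centres of lattice squares uncovered; for density the first
coordinate suffices. -/
theorem fract_eq_of_notMem_packing {q : Plane} (hq : ∀ n, q ∉ packing n) : Int.fract (q 0) = 1 / 2 := by
  set c : Plane := !₂[⌊q 0⌋ + 1 / 2, ⌊q 1⌋ + 1 / 2] with hcdef
  have hc : ∀ i, ∃ z : ℤ, c i = z + 1 / 2 := by
    intro i
    fin_cases i
    · exact ⟨⌊q 0⌋, by simp [c]⟩
    · exact ⟨⌊q 1⌋, by simp [c]⟩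
  have b0 : ip 0 (q - c) = Int.fract (q 0) - 1 / 2 := by
    rw [ip_zero]; simp [c, ← Int.self_sub_floor]; ring
  have b2 : ip 2 (q - c) = Int.fract (q 1) - 1 / 2 := by
    rw [ip_two]; simp [c, ← Int.self_sub_floor]; ring
  have b4 : ip 4 (q - c) = -(Int.fract (q 0) - 1 / 2) := by
    rw [← b0]; exact ip_add_four 0 _
  have b6 : ip 6 (q - c) = -(Int.fract (q 1) - 1 / 2) := by
    rw [← b2]; exact ip_add_four 2 _
  have h0 : ∀ k : Fin 8, (k : ℕ) % 2 = 0 → ip k (q - c) ≤ 1 / 2 := by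
    intro k hk
    have i1 := Int.fract_nonneg (q 0)
    have i2 := (Int.fract_lt_one (q 0)).le
    have i3 := Int.fract_nonneg (q 1)
    have i4 := (Int.fract_lt_one (q 1)).le
    have hk' : k = 0 ∨ k = 2 ∨ k = 4 ∨ k = 6 := by clear * - hk; revert k; decide
    rcases hk' with rfl | rfl | rfl | rfl <;> linarith
  have lim : Tendsto (fun m : ℕ => 1 / 2 * rho ^ (2 * m)) atTop (𝓝 0) :=
    (tendsto_rho_pow (1 / 2)).comp (tendsto_id.const_mul_atTop' two_pos)
  have key (k : Fin 8) (hk : (k : ℕ) % 2 = 0) : ip k (q - c) ≤ 0 :=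
    ge_of_tendsto' lim fun m => by
      linarith [ip_le_of_notMem_packing hc hq h0 (2 * m) k (by lia)]
  linarith [key 0 rfl, key 4 rfl]

theorem dense_iUnion_packing : Dense (⋃ n, packing n) := by
  rw [Metric.dense_iff]
  intro q ε hε
  by_contra! h
  have hn (p : Plane) (hp : p ∈ Metric.ball q ε) : Int.fract (p 0) = 1 / 2 := by
    refine fract_eq_of_notMem_packing fun n hpn => ?_
    have : p ∈ (∅ : Set Plane) := h ▸ ⟨hp, Set.mem_iUnion.2 ⟨n, hpn⟩⟩
    exact this
  set δ := min (ε / 2) (1 / 2) with hδ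
  have d0 : 0 < δ := lt_min (by linarith) (by norm_num)
  have d1 : δ ≤ ε / 2 := min_le_left _ _
  have d2 : δ ≤ 1 / 2 := min_le_right _ _
  have h1 := hn q (Metric.mem_ball_self hε)
  have h2 := hn (q + !₂[δ, 0]) (by
    rw [Metric.mem_ball, dist_eq_norm, add_sub_cancel_left, EuclideanSpace.norm_eq]
    simp [Real.sqrt_sq d0.le]
    linarith)
  obtain ⟨z, hz⟩ := Int.fract_eq_fract.1 (h2.trans h1.symm)
  have hz' : (z : ℝ) = δ := by simpa using hz.symm
  have z1 : 0 < z := by exact_mod_cast hz'.symm ▸ d0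
  have z2 : z < 1 := by
    have : (z : ℝ) < 1 := by linarith
    exact_mod_cast this
  lia

/-! ### The translates of the cell cover the plane -/

/-- The points with a translate in `redLimit`. -/
def coloured : Set Plane := {q | ∃ g ∈ squareLattice, q - g ∈ redLimit}

theorem notMem_closure_sub {n : ℕ} {q g : Plane} (hg : g ∈ squareLattice)
    (h : q ∉ closure (⋃ l > n, packing l)) : q - g ∉ closure (⋃ l > n, packing l) := by
  intro hq
  refine h ?_
  have hm : Set.MapsTo (fun p => p + g) (⋃ l > n, packing l) (⋃ l > n, packing l) := by
    intro p hp
    obtain ⟨l, hl, hp⟩ := Set.mem_iUnion₂.1 hp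
    exact Set.mem_biUnion hl (mem_packing_add hg hp)
  simpa using hm.closure (by fun_prop) hq

theorem mem_coloured {n : ℕ} {x q : Plane} {i : Fin 8} (hx : x ∈ centres n)
    (hq : q ∈ pieceInt n x i) (hq' : q ∉ closure (⋃ l > n, packing l)) : q ∈ coloured := by
  obtain ⟨g, hg, hr⟩ := exists_colour hx i
  refine ⟨g, hg, n, x - g, i, hr, ?_, notMem_closure_sub hg hq'⟩
  simpa only [pieceInt, Set.mem_ofPred_eq, sub_sub_sub_cancel_right] using hq

theorem mem_closure_coloured {n : ℕ} {x : Plane} (hx : x ∈ centres n) :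
    x ∈ closure coloured := by
  refine mem_closure_of_tendsto (tendsto_add_smul_v n x 0) ?_
  filter_upwards [eventually_survives hx 0] with t ht
  exact mem_coloured hx ht.1 ht.2

/-- A ball far from coloured points contains no centres, hence a smaller one meets no late octagons.
A covered point in it has a last covering level, and interior points of that piece nearby are
coloured. -/
theorem dense_coloured : Dense coloured := by
  intro q
  rw [Metric.mem_closure_iff]
  intro ε hε
  by_contra! hfar
  have hcen {n : ℕ} {x : Plane} (hx : x ∈ centres n) : ε ≤ dist q x := by
    by_contra! hlt
    obtain ⟨p, hp1, hp2⟩ := Metric.mem_closure_iff.1 (mem_closure_coloured hx) (ε - dist q x)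
      (by linarith)
    linarith [hfar p hp1, dist_triangle q x p]
  have h1 : ∀ᶠ n : ℕ in atTop, 1 * rho ^ n < ε / 2 :=
    (tendsto_rho_pow 1).eventually_lt_const (by linarith)
  obtain ⟨M, hM⟩ := eventually_atTop.1 h1
  have hlate {n : ℕ} (hn : M ≤ n) {p : Plane} (hp : p ∈ Metric.ball q (ε / 2)) : p ∉ packing n := by
    intro hpn
    obtain ⟨x, hx, hpx⟩ := mem_packing.1 hpn
    have b1 := dist_le_of_ip_le ((mem_oct_iff _ _ _).1 hpx)
    have b2 := hM n hn
    have b3 := dist_triangle q p x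
    have b4 := hcen hx
    rw [Metric.mem_ball, dist_comm] at hp
    linarith
  obtain ⟨p, hpb, hp⟩ := Metric.dense_iff.1 dense_iUnion_packing q (ε / 2) (by linarith)
  obtain ⟨n0, hn0⟩ := Set.mem_iUnion.1 hp
  classical
  have hle (n : ℕ) (hn : p ∈ packing n) : n ≤ M := by
    by_contra! h
    exact hlate h.le hpb hn
  have hspec := Nat.findGreatest_spec (P := fun n => p ∈ packing n) (hle n0 hn0) hn0
  have hmax (l : ℕ) (hl : Nat.findGreatest (fun n => p ∈ packing n) M < l) : p ∉ packing l :=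
    fun h => Nat.findGreatest_is_greatest hl (hle l h) h
  generalize Nat.findGreatest (fun n => p ∈ packing n) M = n at hspec hmax
  obtain ⟨x, hx, hpx⟩ := mem_packing.1 hspec
  rw [oct_eq_iUnion] at hpx
  obtain ⟨i, hi⟩ := Set.mem_iUnion.1 hpx
  have ev : ∀ᶠ p' in 𝓝 p, p' ∈ Metric.ball q (ε / 2) ∧ ∀ l, n < l → l ≤ M → p' ∉ packing l :=
    Filter.Eventually.and (Metric.isOpen_ball.mem_nhds hpb) (eventually_notMem_packing fun l h _ => hmax l h)
  obtain ⟨U, hU, hUo, hpU⟩ := eventually_nhds_iff.1 ev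
  obtain ⟨p', hp'U, hp'⟩ := mem_closure_iff.1 (piece_subset_closure n x i hi) U hUo hpU
  have hcl : p' ∉ closure (⋃ l > n, packing l) := by
    intro h
    obtain ⟨r, hrU, hr⟩ := mem_closure_iff.1 h U hUo hp'U
    obtain ⟨l, hl, hrl⟩ := Set.mem_iUnion₂.1 hr
    rcases le_total l M with h | h
    · exact (hU r hrU).2 l hl h hrl
    · exact hlate h (hU r hrU).1 hrl
  have b1 := hfar p' (mem_coloured hx hp' hcl)
  have b2 := (hU p' hp'U).1
  rw [Metric.mem_ball, dist_comm] at b2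
  linarith

theorem redLimit_subset_cell : redLimit ⊆ cell := cell_eq ▸ subset_closure

open Pointwise in
theorem exists_sub_mem_cell (q : Plane) : ∃ g ∈ squareLattice, q - g ∈ cell := by
  have hcl : IsClosed (centres 0 + cell) := (isClosed_centres 0).add_right_of_isCompact isCompact_cell
  have hsub : coloured ⊆ centres 0 + cell := by
    rintro q ⟨g, hg, hq⟩
    exact Set.mem_add.2 ⟨g, hg, q - g, redLimit_subset_cell hq, by abel⟩
  have := closure_minimal hsub hcl (dense_coloured q)
  obtain ⟨g, hg, p, hp, rfl⟩ := Set.mem_add.1 this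
  exact ⟨g, hg, by rwa [add_sub_cancel_left]⟩

theorem tilesUnder_cell : TilesUnder squareLattice cell := by
  constructor
  · refine Set.eq_univ_of_forall fun q => ?_
    obtain ⟨g, hg, h⟩ := exists_sub_mem_cell q
    exact Set.mem_iUnion.2 ⟨⟨g, hg⟩, q - g, h, sub_add_cancel q g⟩
  · intro g h hgh
    have hcl (g : Plane) : translate cell g = closure (translate redLimit g) := by
      rw [cell_eq]
      exact ((Homeomorph.addRight g).image_closure redLimit)
    have ho (g : Plane) : IsOpen (translate redLimit g) :=
      (Homeomorph.addRight g).isOpenMap _ isOpen_redLimit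
    rw [hcl, hcl]
    have hd : Disjoint (translate redLimit g) (translate redLimit h) := by
      rw [Set.disjoint_left]
      rintro _ ⟨p, hp, rfl⟩ ⟨p', hp', hpp⟩
      change p' + (h : Plane) = p + (g : Plane) at hpp
      refine hgh (Subtype.ext (colours_disjoint (q := p + g) g.2 h.2 ?_ ?_))
      · rwa [add_sub_cancel_right]
      · rwa [← hpp, add_sub_cancel_right]
    have h1 := hd.closure_right (ho g)
    exact ((h1.mono_right interior_subset).closure_left isOpen_interior).mono_left interior_subset

/-- Any system of representatives between `redLimit` and `cell` serves as `D`: take the unique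
representative in `redLimit` where one exists, and any in `cell` otherwise. -/
theorem isFundamentalCell_cell : IsFundamentalCell squareLattice cell := by
  refine ⟨?_, tilesUnder_cell⟩
  have hrep (t : Plane ⧸ squareLattice) : ∃ p : Plane, (p : Plane ⧸ squareLattice) = t ∧ p ∈ cell ∧
      ∀ q : Plane, (q : Plane ⧸ squareLattice) = t → q ∈ redLimit → q = p := by
    obtain ⟨y, rfl⟩ := QuotientAddGroup.mk_surjective t
    by_cases h : ∃ q : Plane, (q : Plane ⧸ squareLattice) = y ∧ q ∈ redLimit
    · obtain ⟨p, hp, hpr⟩ := h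
      refine ⟨p, hp, redLimit_subset_cell hpr, fun q hq hqr => ?_⟩
      have hg : -q + p ∈ squareLattice := QuotientAddGroup.eq.1 (hq.trans hp.symm)
      have := colours_disjoint (q := p) hg squareLattice.zero_mem (by simpa using hqr)
        (by simpa using hpr)
      exact (neg_add_eq_zero.1 this)
    · push Not at h
      obtain ⟨g, hg, hc⟩ := exists_sub_mem_cell y
      refine ⟨y - g, ?_, hc, fun q hq hqr => absurd hqr (h q hq)⟩
      exact QuotientAddGroup.eq.2 (by simpa using hg)
  choose r hr1 hr2 hr3 using hrep
  have hsub : redLimit ⊆ Set.range r := fun q hq => ⟨_, (hr3 _ q rfl hq).symm⟩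
  have hsub' : Set.range r ⊆ cell := by rintro _ ⟨t, rfl⟩; exact hr2 t
  refine ⟨Set.range r, fun x => ?_, ?_, ?_⟩
  · refine ⟨⟨-x + r x, QuotientAddGroup.eq.1 (hr1 x).symm⟩, ⟨_, (add_neg_cancel_left x _).symm⟩, ?_⟩
    rintro g ⟨t, ht⟩
    have : t = (x : Plane ⧸ squareLattice) := by
      rw [← hr1 t, ht]
      exact QuotientAddGroup.eq.2 (by simp)
    subst this
    exact Subtype.ext ((neg_add_eq_iff_eq_add.2 ht).symm)
  · refine hsub'.trans ?_
    rw [cell_eq]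
    exact closure_mono (interior_maximal hsub isOpen_redLimit)
  · refine Set.Subset.antisymm ?_ (closure_minimal hsub' isClosed_closure)
    rw [cell_eq]
    exact closure_mono hsub

/-! ### Outer neighbours of the descendants of the origin -/

theorem vx_mem_descendants {n : ℕ} {x : Plane} (hx : x ∈ descendants n) (i : Fin 8) :
    vx n x i ∈ descendants (n + 1) := ⟨x, hx, i, rfl⟩

theorem nb_vx_succ_mem {n : ℕ} {x : Plane} (hx : x ∈ descendants n) (i : Fin 8) :
    nb (n + 1) (vx n x i) (i + 3) ∈ descendants (n + 1) :=
  vx_succ n x i ▸ vx_mem_descendants hx _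

theorem nb_vx_pred_mem {n : ℕ} {x : Plane} (hx : x ∈ descendants n) (i : Fin 8) :
    nb (n + 1) (vx n x i) (i + 6) ∈ descendants (n + 1) :=
  vx_pred n x i ▸ vx_mem_descendants hx _

theorem nb_vx_mem_of_nb_succ {n : ℕ} {x : Plane} {m : Fin 8} (h : nb n x (m + 1) ∈ descendants n) :
    nb (n + 1) (vx n x m) m ∈ descendants (n + 1) := by
  have := nb_vx_succ_mem h (m + 5)
  rwa [vx_nb', show m + 5 + 3 = m by grind] at this

theorem nb_vx_mem_of_nb_pred {n : ℕ} {x : Plane} {m : Fin 8} (h : nb n x (m - 1) ∈ descendants n) :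
    nb (n + 1) (vx n x (m - 1)) m ∈ descendants (n + 1) := by
  have := nb_vx_pred_mem h (m - 1 + 3)
  rwa [vx_nb, show m - 1 + 3 + 6 = m by grind] at this

/-- The last alternative describes another vertex of the same octagon. -/
theorem eZ_nb_eZ : ∀ m i j l, invZ (eZ m) + vZ j = vZ i + eZ l →
    (i = m ∧ l = m + 1) ∨ (i = m - 1 ∧ l = m - 1) ∨ ∃ k, vZ k = vZ i + eZ l := by
  decide +kernel

theorem eZ_dg_eZ : ∀ m i j l, invZ (mulR (eZ m)) + vZ j = vZ i + eZ l →
    l = m ∧ (i = m ∨ i = m - 1) := by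
  decide +kernel

theorem eZ_nb_mulR : ∀ m i j l, invZ (eZ m) + vZ j = vZ i + mulR (eZ l) →
    l = m ∧ (i = m + 1 ∨ i = m - 2) := by
  decide +kernel

theorem eZ_dg_mulR : ∀ m i j l, invZ (mulR (eZ m)) + vZ j = vZ i + mulR (eZ l) →
    (i = m ∧ l = m - 1) ∨ (i = m - 1 ∧ l = m + 1) := by
  decide +kernel

/-- A parent of `z` cannot be a descendant, and the bound on `ε` keeps it within the range of
`trichotomy` around `u`. -/
theorem exists_outer_parent {n : ℕ} {u z : Plane} {i : Fin 8} {ε : ℤ × ℤ × ℤ × ℤ}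
    (hε : ∀ k, ip k (toVec ε) ≤ √2) (hu : u ∈ descendants n)
    (hz : z = vx n u i + rho ^ (n + 1) • toVec ε)
    (hzc : z ∈ centres (n + 1)) (hzd : z ∉ descendants (n + 1)) :
    (∃ m j, nb n u m ∈ centres n ∧ nb n u m ∉ descendants n ∧ invZ (eZ m) + vZ j = vZ i + ε) ∨
    ∃ m j, dg n u m ∈ centres n ∧ dg n u m ∉ descendants n ∧
      invZ (mulR (eZ m)) + vZ j = vZ i + ε := by
  obtain ⟨w, hw, j, rfl⟩ := mem_centres_succ.1 hzc
  have hwd : w ∉ descendants n := fun h => hzd ⟨w, h, j, rfl⟩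
  have hp := rho_pow_pos (n + 1)
  have hclose (k : Fin 8) : ip k (w - u) < (1 + √2 / 2) * rho ^ n := by
    have a := congrArg (ip k) hz
    have b := ip_v_le k i
    have c := ip_v_le (k + 4) j
    rw [ip_add_four] at c
    rw [map_add, ip_vx, ip_vx, map_smul, smul_eq_mul] at a
    rw [map_sub, rho_pow_succ n]
    have m1 := mul_le_mul_of_nonneg_left b hp.le
    have m2 := mul_le_mul_of_nonneg_left c hp.le
    have m3 := mul_le_mul_of_nonneg_left (hε k) hp.le
    have m4 := mul_lt_mul_of_pos_left sqrt_two_lt hp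
    have e : (1 + √2 / 2) * ((1 + √2) * rho ^ (n + 1)) =
        2 * rho ^ (n + 1) + 3 / 2 * (rho ^ (n + 1) * √2) := by
      linear_combination rho ^ (n + 1) / 2 * sqrt_two_sq
    linarith
  rcases trichotomy (descendants_subset n hu) hw hclose with rfl | ⟨m, rfl⟩ | ⟨m, rfl⟩
  · exact absurd hu hwd
  · left
    rw [nb_eq] at hz
    exact ⟨m, j, hw, hwd, eq_of_vx_add_eq hz⟩
  · right
    rw [dg_eq] at hz
    exact ⟨m, j, hw, hwd, eq_of_vx_add_eq hz⟩

theorem outer_nb {n : ℕ} {u : Plane} {i l : Fin 8} (hu : u ∈ descendants n)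
    (hc : nb (n + 1) (vx n u i) l ∈ centres (n + 1))
    (hd : nb (n + 1) (vx n u i) l ∉ descendants (n + 1)) :
    (∃ m, nb n u m ∈ centres n ∧ nb n u m ∉ descendants n ∧
      ((i = m ∧ l = m + 1) ∨ (i = m - 1 ∧ l = m - 1))) ∨
    ∃ m, dg n u m ∈ centres n ∧ dg n u m ∉ descendants n ∧ l = m ∧ (i = m ∨ i = m - 1) := by
  have hs := sqrt_two_gt
  rcases exists_outer_parent (ε := eZ l) (fun k => by rw [toVec_eZ]; linarith [ip_e_le k l]) hu
    (nb_eq _ _ _) hc hd with ⟨m, j, h1, h2, h3⟩ | ⟨m, j, h1, h2, h3⟩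
  · refine Or.inl ⟨m, h1, h2, ?_⟩
    rcases eZ_nb_eZ m i j l h3 with h | h | ⟨k, hk⟩
    · exact Or.inl h
    · exact Or.inr h
    · refine absurd ⟨u, hu, k, ?_⟩ hd
      rw [nb_eq, vx_eq, vx_eq, ← toVec_vZ k, hk, toVec_add, toVec_vZ]
      module
  · exact Or.inr ⟨m, h1, h2, eZ_dg_eZ m i j l h3⟩

theorem outer_dg {n : ℕ} {u : Plane} {i l : Fin 8} (hu : u ∈ descendants n)
    (hc : dg (n + 1) (vx n u i) l ∈ centres (n + 1))
    (hd : dg (n + 1) (vx n u i) l ∉ descendants (n + 1)) :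
    (∃ m, nb n u m ∈ centres n ∧ nb n u m ∉ descendants n ∧ l = m ∧ (i = m + 1 ∨ i = m - 2)) ∨
    ∃ m, dg n u m ∈ centres n ∧ dg n u m ∉ descendants n ∧
      ((i = m ∧ l = m - 1) ∨ (i = m - 1 ∧ l = m + 1)) := by
  have hs := Real.sqrt_nonneg 2
  rcases exists_outer_parent (ε := mulR (eZ l)) (fun k => by
      rw [toVec_mulR, toVec_eZ, map_smul, smul_eq_mul]; nlinarith [ip_e_le k l]) hu
    (dg_eq _ _ _) hc hd with ⟨m, j, h1, h2, h3⟩ | ⟨m, j, h1, h2, h3⟩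
  · exact Or.inl ⟨m, h1, h2, eZ_nb_mulR m i j l h3⟩
  · exact Or.inr ⟨m, h1, h2, eZ_dg_mulR m i j l h3⟩

/-! ### Tips -/

/-- The centre of the octagon of the `n`-th packing at the `t`-th tip of the cell. -/
def tip : ℕ → Fin 8 → Plane
  | 0, _ => 0
  | n + 1, t => vx n (tip n t) t

theorem tip_succ (n : ℕ) (t : Fin 8) : tip (n + 1) t = vx n (tip n t) t := rfl

theorem tip_mem (n : ℕ) (t : Fin 8) : tip n t ∈ descendants n := by
  induction n with
  | zero => rfl
  | succ n ih => exact vx_mem_descendants ih t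

theorem ip_le_tip {n : ℕ} {x : Plane} (hx : x ∈ descendants n) (t : Fin 8) :
    ip t x + ip (t + 1) x ≤ ip t (tip n t) + ip (t + 1) (tip n t) := by
  induction n generalizing x with
  | zero => obtain rfl : x = 0 := hx; rfl
  | succ n ih =>
    obtain ⟨u, hu, i, rfl⟩ := hx
    have h1 := ih hu
    have hp := rho_pow_pos (n + 1)
    have h2 := mul_le_mul_of_nonneg_left (ip_v_le t i) hp.le
    have h3 := mul_le_mul_of_nonneg_left (ip_v_le (t + 1) i) hp.le
    rw [tip_succ, ip_vx, ip_vx, ip_vx, ip_vx, ip_v_self, ip_succ_v]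
    linarith

theorem nb_tip_notMem {n : ℕ} {t l : Fin 8} (hl : l = t ∨ l = t + 1) :
    nb n (tip n t) l ∉ descendants n := by
  intro h
  have h1 := ip_le_tip h t
  have hp := rho_pow_pos n
  have hs := Real.sqrt_nonneg 2
  rw [ip_nb, ip_nb] at h1
  rcases hl with rfl | rfl
  · rw [ip_e_self, ip_succ_e] at h1; nlinarith
  · rw [ip_e_self, ip_e_succ] at h1; nlinarith

/-- The neighbour found alternates between the directions `t` and `t + 1` from level to level. -/
theorem exists_nb_tip_mem (n : ℕ) (t : Fin 8) :
    ∃ l, (l = t ∨ l = t + 1) ∧ nb n (tip n t) l ∈ centres n := by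
  induction n with
  | zero =>
    have h0 (l : Fin 8) (hl : (l : ℕ) % 2 = 0) : nb 0 (tip 0 t) l ∈ centres 0 := by
      change (0 : Plane) + rho ^ 0 • e l ∈ squareLattice
      rw [zero_add, pow_zero, one_smul]
      have hl' : l = 0 ∨ l = 2 ∨ l = 4 ∨ l = 6 := by clear * - hl; revert l; decide
      rcases hl' with rfl | rfl | rfl | rfl
      · rw [e_zero]; intro i; fin_cases i; exacts [⟨1, by simp⟩, ⟨0, by simp⟩]
      · rw [e_two]; intro i; fin_cases i; exacts [⟨0, by simp⟩, ⟨1, by simp⟩]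
      · rw [e_four]; intro i; fin_cases i; exacts [⟨-1, by simp⟩, ⟨0, by simp⟩]
      · rw [e_six]; intro i; fin_cases i; exacts [⟨0, by simp⟩, ⟨-1, by simp⟩]
    have ht : (t : ℕ) % 2 = 0 ∨ ((t + 1 : Fin 8) : ℕ) % 2 = 0 := by clear * -; revert t; decide
    rcases ht with ht | ht
    · exact ⟨t, Or.inl rfl, h0 _ ht⟩
    · exact ⟨t + 1, Or.inr rfl, h0 _ ht⟩
  | succ n ih =>
    obtain ⟨l, rfl | rfl, h⟩ := ih
    · refine ⟨l + 1, Or.inr rfl, ?_⟩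
      have := vx_pred n (nb n (tip n l) l) (l + 3)
      rw [vx_nb, show l + 3 + 6 = l + 1 by grind] at this
      rw [tip_succ, ← this]
      exact vx_mem h _
    · refine ⟨t, Or.inl rfl, ?_⟩
      have := vx_succ n (nb n (tip n t) (t + 1)) (t + 5)
      rw [vx_nb', show t + 5 + 3 = t by grind] at this
      rw [tip_succ, ← this]
      exact vx_mem h _

theorem exists_outer_parent_tip (n : ℕ) (t : Fin 8) :
    ∃ x ∈ centres n, x ∉ descendants n ∧ ∃ i, tip (n + 1) t = vx n x i := by
  obtain ⟨l, hl, h⟩ := exists_nb_tip_mem n t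
  refine ⟨_, h, nb_tip_notMem hl, ?_⟩
  rcases hl with rfl | rfl
  · exact ⟨l + 3, (vx_nb n _ l).symm⟩
  · exact ⟨t + 5, (vx_nb' n _ t).symm⟩

/-- One parent of the new tip is not a descendant, hence not red there, which forces the alternating
colouring; the red parent is the preceding tip. -/
theorem isRed_tip_succ (n : ℕ) (t j : Fin 8) :
    isRed (n + 1) (tip (n + 1) t) j ↔ (j : ℕ) % 2 = (t : ℕ) % 2 := by
  induction n generalizing j with
  | zero =>
    constructor
    · intro h
      obtain ⟨x, -, i, h1, h2, h3⟩ := isRed_succ.1 h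
      obtain rfl : x = 0 := h2
      obtain ⟨w, hw, hwd, k, hk⟩ := exists_outer_parent_tip 0 t
      rcases h3 with h3 | h3
      · exact absurd (h3 w hw k hk).mem_descendants hwd
      · rw [h3]
        have hi : i = t := by
          change vx 0 0 t = vx 0 0 i at h1
          rw [vx_eq, vx_eq, add_right_inj, ← toVec_vZ, ← toVec_vZ] at h1
          have := toVec_injective (smul_right_injective _ (rho_pow_pos _).ne' h1)
          clear * - this; revert i t; decide
        rw [hi]
    · exact fun h => isRed.vx (show isRed 0 (tip 0 t) t from rfl) h
  | succ n ih =>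
    constructor
    · intro h
      obtain ⟨x, hx, i, h1, h2, h3⟩ := isRed_succ.1 h
      obtain ⟨w, hw, hwd, k, hk⟩ := exists_outer_parent_tip (n + 1) t
      rcases h3 with h3 | h3
      · exact absurd (h3 w hw k hk).mem_descendants hwd
      · rcases vx_eq_vx (descendants_subset _ (tip_mem (n + 1) t)) hx h1.symm with
          ⟨-, rfl⟩ | ⟨rfl, -⟩ | ⟨rfl, -⟩
        · exact h3
        · exact absurd h2.mem_descendants (nb_tip_notMem (Or.inl rfl))
        · exact absurd h2.mem_descendants (nb_tip_notMem (Or.inr rfl))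
    · exact fun h => isRed.vx ((ih t).2 rfl) h

/-! ### Red octagons touching the outside -/

/-- Red octagons with a neighbour outside the descendants of the origin are at the tips. -/
def OuterNb (n : ℕ) : Prop :=
  ∀ ⦃x : Plane⦄ ⦃i l : Fin 8⦄, isRed n x i → nb n x l ∈ centres n → nb n x l ∉ descendants n →
    ∃ t, x = tip n t ∧ (l = t ∨ l = t + 1)

/-- Red pieces facing a diagonal neighbour outside the descendants of the origin adjoin a neighbour
among the descendants. -/
def OuterDg (n : ℕ) : Prop :=
  ∀ ⦃x : Plane⦄ ⦃l : Fin 8⦄, dg n x l ∈ centres n → dg n x l ∉ descendants n →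
    (isRed n x l → nb n x (l + 1) ∈ descendants n) ∧
      (isRed n x (l - 1) → nb n x (l - 1) ∈ descendants n)

theorem zero_mem_descendants : (0 : Plane) ∈ descendants 0 := rfl

theorem outerNb_one : OuterNb 1 := by
  intro y i l hy hc hd
  obtain ⟨u, -, k, rfl, rfl, -⟩ := isRed_succ.1 hy
  refine ⟨k, rfl, ?_⟩
  rcases outer_nb zero_mem_descendants hc hd with ⟨m, -, -, h⟩ | ⟨m, -, -, h⟩
  · clear * - h; grind
  · clear * - h; grind

theorem parity_add_one (i : Fin 8) : ((i + 1 : Fin 8) : ℕ) % 2 ≠ (i : ℕ) % 2 := by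
  revert i; decide

theorem outerDg_one : OuterDg 1 := by
  intro y l hc hd
  have key (k : Fin 8) (hy : y = vx 0 0 k) : (isRed 1 y l → nb 1 y (l + 1) ∈ descendants 1) ∧
      (isRed 1 y (l - 1) → nb 1 y (l - 1) ∈ descendants 1) := by
    subst hy
    have h1 := nb_vx_succ_mem zero_mem_descendants k
    have h2 := nb_vx_pred_mem zero_mem_descendants k
    have h3 (j : Fin 8) : isRed 1 (vx 0 0 k) j ↔ (j : ℕ) % 2 = (k : ℕ) % 2 := isRed_tip_succ 0 k j
    rw [h3, h3]
    have h4 : (k = l + 1) ∨ (k = l - 2) := by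
      rcases outer_dg zero_mem_descendants hc hd with ⟨m, -, -, h⟩ | ⟨m, -, -, h⟩
      · clear * - h; grind
      · clear * - h; grind
    rcases h4 with rfl | rfl
    · refine ⟨fun h => absurd h.symm (parity_add_one l), fun _ => ?_⟩
      rwa [show l + 1 + 6 = l - 1 by grind] at h2
    · refine ⟨fun _ => ?_, fun h => ?_⟩
      · rwa [show l - 2 + 3 = l + 1 by grind] at h1
      · have := parity_add_one (l - 2)
        rw [show l - 2 + 1 = l - 1 by grind] at this
        exact absurd h this
  constructor <;> intro hr
  · obtain ⟨u, -, k, hy, rfl, -⟩ := isRed_succ.1 hr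
    exact (key k hy).1 hr
  · obtain ⟨u, -, k, hy, rfl, -⟩ := isRed_succ.1 hr
    exact (key k hy).2 hr

/-- If the outside neighbour stems from an outside neighbour of `u`, then `u` is a tip and parity
gives `k = t`. If it stems from an outside diagonal neighbour, `OuterDg` makes it a descendant,
which is absurd. -/
theorem OuterNb.succ {n : ℕ} (hP : OuterNb (n + 1)) (hQ : OuterDg (n + 1)) : OuterNb (n + 2) := by
  intro y i l hy hc hd
  obtain ⟨u, -, k, rfl, hr, -⟩ := isRed_succ.1 hy
  rcases outer_nb hr.mem_descendants hc hd with ⟨m, h1, h2, h3⟩ | ⟨m, h1, h2, rfl, h3⟩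
  · obtain ⟨t, rfl, ht⟩ := hP hr h1 h2
    rw [isRed_tip_succ] at hr
    have hk : k = t := by
      have : k = t ∨ k + 1 = t ∨ k = t + 1 := by clear * - h3 ht; grind
      rcases this with rfl | rfl | rfl
      · rfl
      · exact absurd hr.symm (parity_add_one k)
      · exact absurd hr (parity_add_one t)
    subst hk
    exact ⟨k, rfl, by clear * - h3 ht; grind⟩
  · exfalso
    obtain ⟨q1, q2⟩ := hQ h1 h2
    rcases h3 with rfl | rfl
    · exact hd (nb_vx_mem_of_nb_succ (q1 hr))
    · exact hd (nb_vx_mem_of_nb_pred (q2 hr))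

theorem OuterDg.succ {n : ℕ} (hP : OuterNb (n + 1)) (hQ : OuterDg (n + 1)) : OuterDg (n + 2) := by
  -- From level `2` on both neighbours are descendants; at level `1` only the form conditioned on a
  -- red piece holds.
  have key {u : Plane} {k l : Fin 8} (hr : isRed (n + 1) u k)
      (hc : dg (n + 2) (vx (n + 1) u k) l ∈ centres (n + 2))
      (hd : dg (n + 2) (vx (n + 1) u k) l ∉ descendants (n + 2)) :
      nb (n + 2) (vx (n + 1) u k) (l + 1) ∈ descendants (n + 2) ∧
        nb (n + 2) (vx (n + 1) u k) (l - 1) ∈ descendants (n + 2) := by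
    have hu := hr.mem_descendants
    have s1 := nb_vx_succ_mem hu k
    have s2 := nb_vx_pred_mem hu k
    rcases outer_dg hu hc hd with ⟨m, h1, h2, h3, h4⟩ | ⟨m, h1, h2, h3⟩
    · subst h3
      obtain ⟨t, rfl, ht⟩ := hP hr h1 h2
      rw [isRed_tip_succ] at hr
      rcases ht with rfl | rfl
      · obtain rfl : k = l - 2 := by
          rcases h4 with rfl | rfl
          · exact absurd hr (parity_add_one l)
          · rfl
        refine ⟨by rwa [show l - 2 + 3 = l + 1 by grind] at s1, ?_⟩
        have := nb_vx_mem_of_nb_pred (m := l - 1) (by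
          rw [show l - 1 - 1 = l + 6 by grind]; exact nb_vx_pred_mem (tip_mem n l) l)
        rwa [show l - 1 - 1 = l - 2 by grind] at this
      · obtain rfl : k = t + 2 := by
          rcases h4 with rfl | rfl
          · grind
          · rw [show t + 1 - 2 = t - 1 by grind] at hr
            have := parity_add_one (t - 1)
            rw [sub_add_cancel] at this
            exact absurd hr.symm this
        refine ⟨?_, by rwa [show t + 2 + 6 = t + 1 - 1 by grind] at s2⟩
        have := nb_vx_mem_of_nb_succ (m := t + 2) (by
          rw [show t + 2 + 1 = t + 3 by grind]; exact nb_vx_succ_mem (tip_mem n t) t)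
        rwa [show t + 1 + 1 = t + 2 by grind]
    · obtain ⟨q1, q2⟩ := hQ h1 h2
      rcases h3 with ⟨rfl, rfl⟩ | ⟨rfl, rfl⟩
      · refine ⟨?_, by rwa [show k + 6 = k - 1 - 1 by grind] at s2⟩
        rw [sub_add_cancel]
        exact nb_vx_mem_of_nb_succ (q1 hr)
      · refine ⟨by rwa [show m - 1 + 3 = m + 1 + 1 by grind] at s1, ?_⟩
        rw [add_sub_cancel_right]
        exact nb_vx_mem_of_nb_pred (q2 hr)
  intro y l hc hd
  constructor <;> intro hr
  · obtain ⟨u, -, k, rfl, hr, -⟩ := isRed_succ.1 hr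
    exact (key hr hc hd).1
  · obtain ⟨u, -, k, rfl, hr, -⟩ := isRed_succ.1 hr
    exact (key hr hc hd).2

/-- Level `0` is excluded: the diagonal lattice neighbours of the origin violate `OuterDg 0`. -/
theorem outerNb_outerDg (n : ℕ) : OuterNb (n + 1) ∧ OuterDg (n + 1) := by
  induction n with
  | zero => exact ⟨outerNb_one, outerDg_one⟩
  | succ n ih => exact ⟨ih.1.succ ih.2, OuterDg.succ ih.1 ih.2⟩

/-- The colouring in terms of the descendants of the origin alone. -/
theorem isRed_succ_descendants {n : ℕ} {y : Plane} {j : Fin 8} : isRed (n + 1) y j ↔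
    ∃ x ∈ descendants n, ∃ i, y = vx n x i ∧ isRed n x i ∧
      ((∀ x' ∈ descendants n, ∀ i', y = vx n x' i' → isRed n x' i') ∧ (∀ t, y ≠ tip (n + 1) t) ∨
        (j : ℕ) % 2 = (i : ℕ) % 2) := by
  rw [isRed_succ]
  constructor
  · rintro ⟨x, -, i, rfl, hr, h⟩
    refine ⟨x, hr.mem_descendants, i, rfl, hr, h.imp_left fun h => ?_⟩
    refine ⟨fun x' hx' => h x' (descendants_subset n hx'), fun t ht => ?_⟩
    obtain ⟨w, hw, hwd, k, hk⟩ := exists_outer_parent_tip n t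
    exact hwd (h w hw k (ht.trans hk)).mem_descendants
  · rintro ⟨x, hx, i, rfl, hr, h⟩
    refine ⟨x, descendants_subset n hx, i, rfl, hr, h.imp_left fun h => ?_⟩
    intro x' hx' i' he
    -- An outside parent is a neighbour of the octagon around `x`, so `x` is a tip, and by parity
    -- `y` is the next one, contrary to `h.2`.
    by_cases hd : x' ∈ descendants n
    · exact h.1 x' hd i' he
    exfalso
    obtain _ | n := n
    · obtain rfl : x = 0 := hx
      exact h.2 i rfl
    have houter (l : Fin 8) (hl : l = i ∨ l = i + 1) (hc : nb (n + 1) x l ∈ centres (n + 1))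
        (hd : nb (n + 1) x l ∉ descendants (n + 1)) : False := by
      obtain ⟨t, rfl, ht⟩ := (outerNb_outerDg n).1 hr hc hd
      rw [isRed_tip_succ] at hr
      have : i = t ∨ i + 1 = t ∨ i = t + 1 := by clear * - hl ht; grind
      rcases this with rfl | rfl | rfl
      · exact h.2 i rfl
      · exact absurd hr.symm (parity_add_one i)
      · exact absurd hr (parity_add_one t)
    rcases vx_eq_vx (descendants_subset _ hx) hx' he.symm with ⟨rfl, -⟩ | ⟨rfl, -⟩ | ⟨rfl, -⟩
    · exact hd hx
    · exact houter _ (Or.inl rfl) hx' hd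
    · exact houter _ (Or.inr rfl) hx' hd

/-! ### Symmetries -/

/-- A symmetry of the octagon at the origin, with its action on directions and vertices. -/
structure IsOctSymm (φ : Plane → Plane) (τ σ : Fin 8 → Fin 8) : Prop where
  map_sub : ∀ p q, φ (p - q) = φ p - φ q
  injective : Function.Injective φ
  map_ip : ∀ l p, ip (τ l) (φ p) = ip l p
  map_vx : ∀ n x i, φ (vx n x i) = vx n (φ x) (σ i)
  cone : ∀ i, (σ i - 1 = τ (i - 1) ∧ σ i + 2 = τ (i + 2)) ∨
    (σ i - 1 = τ (i + 2) ∧ σ i + 2 = τ (i - 1))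
  parity : ∀ i j : Fin 8, (i : ℕ) % 2 = (j : ℕ) % 2 → (σ i : ℕ) % 2 = (σ j : ℕ) % 2
  surjective : Function.Surjective τ
  surjective' : Function.Surjective σ

namespace IsOctSymm

variable {φ : Plane → Plane} {τ σ : Fin 8 → Fin 8}

theorem map_zero (h : IsOctSymm φ τ σ) : φ 0 = 0 := by simpa using h.map_sub 0 0

theorem map_tip (h : IsOctSymm φ τ σ) (n : ℕ) (t : Fin 8) : φ (tip n t) = tip n (σ t) := by
  induction n with
  | zero => exact h.map_zero
  | succ n ih => rw [tip_succ, h.map_vx, ih, tip_succ]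

theorem map_descendants (h : IsOctSymm φ τ σ) {n : ℕ} {x : Plane} (hx : x ∈ descendants n) :
    φ x ∈ descendants n := by
  induction n generalizing x with
  | zero => obtain rfl : x = 0 := hx; exact h.map_zero
  | succ n ih =>
    obtain ⟨u, hu, i, rfl⟩ := hx
    exact ⟨φ u, ih hu, σ i, h.map_vx _ _ _⟩

theorem exists_descendant (h : IsOctSymm φ τ σ) {n : ℕ} {y : Plane} (hy : y ∈ descendants n) :
    ∃ x ∈ descendants n, φ x = y := by
  induction n generalizing y with
  | zero => obtain rfl : y = 0 := hy; exact ⟨0, rfl, h.map_zero⟩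
  | succ n ih =>
    obtain ⟨u, hu, i, rfl⟩ := hy
    obtain ⟨w, hw, rfl⟩ := ih hu
    obtain ⟨k, rfl⟩ := h.surjective' i
    exact ⟨vx n w k, vx_mem_descendants hw k, h.map_vx _ _ _⟩

theorem map_isRed (h : IsOctSymm φ τ σ) {n : ℕ} {x : Plane} {i : Fin 8} (hx : isRed n x i) :
    isRed n (φ x) (σ i) := by
  induction n generalizing x i with
  | zero => obtain rfl : x = 0 := hx; exact h.map_zero
  | succ n ih =>
    obtain ⟨u, hu, k, rfl, hr, hk⟩ := isRed_succ_descendants.1 hx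
    refine isRed_succ_descendants.2 ⟨φ u, h.map_descendants hu, σ k, h.map_vx _ _ _, ih hr, ?_⟩
    refine hk.imp (fun hk => ⟨fun x' hx' i' he => ?_, fun t ht => ?_⟩) (h.parity _ _)
    · obtain ⟨w, hw, rfl⟩ := h.exists_descendant hx'
      obtain ⟨l, rfl⟩ := h.surjective' i'
      rw [← h.map_vx] at he
      exact ih (hk.1 w hw l (h.injective he))
    · obtain ⟨l, rfl⟩ := h.surjective' t
      rw [← h.map_tip] at ht
      exact hk.2 l (h.injective ht)

theorem mem_pieceInt (h : IsOctSymm φ τ σ) {n : ℕ} {x q : Plane} {i : Fin 8}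
    (hq : q ∈ pieceInt n x i) : φ q ∈ pieceInt n (φ x) (σ i) := by
  obtain ⟨h1, h2, h3⟩ := hq
  refine ⟨fun l => ?_, ?_⟩
  · obtain ⟨l, rfl⟩ := h.surjective l
    rw [← h.map_sub, h.map_ip]
    exact h1 l
  · rw [← h.map_sub]
    rcases h.cone i with ⟨e1, e2⟩ | ⟨e1, e2⟩ <;> rw [e1, e2, h.map_ip, h.map_ip]
    exacts [⟨h2, h3⟩, ⟨h3, h2⟩]

theorem mem_oct (h : IsOctSymm φ τ σ) {n : ℕ} {x q : Plane} (hq : φ q ∈ oct n (φ x)) :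
    q ∈ oct n x := by
  rw [mem_oct_iff] at hq ⊢
  intro l
  rw [← h.map_ip, h.map_sub]
  exact hq (τ l)

/-- The packings need not be invariant under `φ`, but by `covers_red` the first octagon to cover a
red point descends from the origin, and `φ` permutes the descendants. -/
theorem mem_redOpen (h : IsOctSymm φ τ σ) {n : ℕ} {q : Plane} (hq : q ∈ redOpen n) :
    φ q ∈ redOpen n := by
  obtain ⟨j, hj, x, i, hr, hp, ha⟩ := hq
  refine ⟨j, hj, φ x, σ i, h.map_isRed hr, h.mem_pieceInt hp, ?_⟩
  intro l
  induction l using Nat.strong_induction_on with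
  | _ l ih =>
    intro hjl hln hpack
    obtain ⟨m, rfl⟩ : ∃ m, l = m + 1 := ⟨l - 1, by lia⟩
    obtain ⟨y, hy, hqy⟩ := mem_packing.1 hpack
    obtain ⟨hyd, -⟩ := covers_red (n := m) (by lia) (h.map_isRed hr) (h.mem_pieceInt hp)
      (fun l h1 h2 => ih l (by lia) h1 (by lia)) hy hqy
    obtain ⟨x', hx', rfl⟩ := h.exists_descendant hyd
    exact ha _ hjl hln (mem_packing.2 ⟨x', descendants_subset _ hx', h.mem_oct hqy⟩)

theorem mapsTo_cell (h : IsOctSymm φ τ σ) (hc : Continuous φ) : Set.MapsTo φ cell cell := by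
  rw [cell_eq]
  refine Set.MapsTo.closure_left (fun q hq => ?_) hc isClosed_closure
  rw [← cell_eq]
  refine subset_closure ?_
  filter_upwards [redLimit_mem_redOpen hq] with n hn
  rw [stage_eq]
  exact subset_closure (h.mem_redOpen hn)

end IsOctSymm

/-! ### The dihedral group preserves the cell -/

theorem rotation_apply (p : Plane) : rotation (2 * Real.pi / (8 : ℕ)) p =
    !₂[√2 / 2 * p 0 - √2 / 2 * p 1, √2 / 2 * p 0 + √2 / 2 * p 1] := by
  change rotMap _ p = _
  rw [rotMap, show 2 * Real.pi / (8 : ℕ) = Real.pi / 4 by push_cast; ring, Real.cos_pi_div_four,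
    Real.sin_pi_div_four]

theorem reflection_apply (p : Plane) : reflection p = !₂[p 0, -p 1] := rfl

theorem rotation_add_smul (x w : Plane) (a : ℝ) : rotation (2 * Real.pi / (8 : ℕ)) (x + a • w) =
    rotation (2 * Real.pi / (8 : ℕ)) x + a • rotation (2 * Real.pi / (8 : ℕ)) w := by
  simp only [rotation_apply]
  ext i; fin_cases i <;> simp <;> ring

theorem reflection_add_smul (x w : Plane) (a : ℝ) :
    reflection (x + a • w) = reflection x + a • reflection w := by
  simp only [reflection_apply]
  ext i; fin_cases i <;> simp; ring

theorem rotation_e (l : Fin 8) : rotation (2 * Real.pi / (8 : ℕ)) (e l) = e (l + 1) := by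
  have h : √2 / 2 * (√2 / 2) = 1 / 2 := by linarith [sqrt_two_sq]
  rw [rotation_apply]
  revert l
  refine forall_fin_eight ?_ ?_ ?_ ?_ ?_ ?_ ?_ ?_
  · rw [show (0 + 1 : Fin 8) = 1 by rfl, e_zero, e_one]; ext i; fin_cases i <;> simp
  · rw [show (1 + 1 : Fin 8) = 2 by rfl, e_one, e_two]; ext i; fin_cases i <;> simp [h]; norm_num
  · rw [show (2 + 1 : Fin 8) = 3 by rfl, e_two, e_three]; ext i; fin_cases i <;> simp
  · rw [show (3 + 1 : Fin 8) = 4 by rfl, e_three, e_four]; ext i; fin_cases i <;> simp [h]; norm_num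
  · rw [show (4 + 1 : Fin 8) = 5 by rfl, e_four, e_five]; ext i; fin_cases i <;> simp
  · rw [show (5 + 1 : Fin 8) = 6 by rfl, e_five, e_six]; ext i; fin_cases i <;> simp [h]; norm_num
  · rw [show (6 + 1 : Fin 8) = 7 by rfl, e_six, e_seven]; ext i; fin_cases i <;> simp
  · rw [show (7 + 1 : Fin 8) = 0 by rfl, e_seven, e_zero]; ext i; fin_cases i <;> simp [h]; norm_num

theorem reflection_e (l : Fin 8) : reflection (e l) = e (-l) := by
  rw [reflection_apply]
  revert l
  refine forall_fin_eight ?_ ?_ ?_ ?_ ?_ ?_ ?_ ?_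
  · rw [show (-0 : Fin 8) = 0 by rfl, e_zero]; ext i; fin_cases i <;> simp
  · rw [show (-1 : Fin 8) = 7 by rfl, e_one, e_seven]; ext i; fin_cases i <;> simp
  · rw [show (-2 : Fin 8) = 6 by rfl, e_two, e_six]; ext i; fin_cases i <;> simp
  · rw [show (-3 : Fin 8) = 5 by rfl, e_three, e_five]; ext i; fin_cases i <;> simp
  · rw [show (-4 : Fin 8) = 4 by rfl, e_four]; ext i; fin_cases i <;> simp
  · rw [show (-5 : Fin 8) = 3 by rfl, e_five, e_three]; ext i; fin_cases i <;> simp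
  · rw [show (-6 : Fin 8) = 2 by rfl, e_six, e_two]; ext i; fin_cases i <;> simp
  · rw [show (-7 : Fin 8) = 1 by rfl, e_seven, e_one]; ext i; fin_cases i <;> simp

theorem map_sub_of_add_smul {φ : Plane → Plane}
    (h : ∀ (x w : Plane) (a : ℝ), φ (x + a • w) = φ x + a • φ w) (p q : Plane) :
    φ (p - q) = φ p - φ q := by
  have := h p q (-1)
  simpa [← sub_eq_add_neg] using this

theorem map_smul_add_of_add_smul {φ : Plane → Plane}
    (h : ∀ (x w : Plane) (a : ℝ), φ (x + a • w) = φ x + a • φ w) (a : ℝ) (p q : Plane) :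
    φ (a • (p + q)) = a • (φ p + φ q) := by
  have h0 : φ 0 = 0 := by simpa using map_sub_of_add_smul h 0 0
  have h1 := h 0 (p + (1 : ℝ) • q) a
  rwa [h p q 1, h0, zero_add, zero_add, one_smul, one_smul] at h1

theorem isOctSymm_rotation :
    IsOctSymm (rotation (2 * Real.pi / (8 : ℕ))) (fun l => l + 1) (fun l => l + 1) where
  map_sub := map_sub_of_add_smul rotation_add_smul
  injective := (rotation _).injective
  map_ip l p := by
    rw [ip_apply, ip_apply, ← rotation_e, rotation_apply, rotation_apply]
    simp
    linear_combination (p 0 * e l 0 + p 1 * e l 1) / 2 * sqrt_two_sq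
  map_vx n x i := by
    rw [vx_eq, vx_eq, rotation_add_smul, v, v]
    rw [map_smul_add_of_add_smul rotation_add_smul, rotation_e, rotation_e]
  cone i := Or.inl ⟨by grind, by grind⟩
  parity := by decide
  surjective := fun l => ⟨l - 1, sub_add_cancel l 1⟩
  surjective' := fun l => ⟨l - 1, sub_add_cancel l 1⟩

theorem isOctSymm_reflection :
    IsOctSymm reflection (fun l => -l) (fun l => -l - 1) where
  map_sub := map_sub_of_add_smul reflection_add_smul
  injective := reflection.injective
  map_ip l p := by
    rw [ip_apply, ip_apply, ← reflection_e, reflection_apply, reflection_apply]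
    simp
  map_vx n x i := by
    rw [vx_eq, vx_eq, reflection_add_smul, v, v]
    rw [map_smul_add_of_add_smul reflection_add_smul, reflection_e, reflection_e, add_comm (e (-i)),
      sub_add_cancel, neg_add']
  cone i := Or.inr ⟨by grind, by grind⟩
  parity := by decide
  surjective := neg_surjective
  surjective' := fun l => ⟨-l - 1, by grind⟩

theorem dihedral_le : dihedral 8 ≤ symmetryGroup cell := by
  have h1 := isOctSymm_rotation.mapsTo_cell (rotation _).continuous
  have h2 := isOctSymm_reflection.mapsTo_cell reflection.continuous
  refine (Subgroup.closure_le _).2 ?_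
  rintro φ (rfl | rfl)
  · refine Set.Subset.antisymm h1.image_subset fun p hp => ?_
    -- Conjugation by the reflection inverts the rotation.
    refine ⟨_, h2 (h1 (h2 hp)), ?_⟩
    rw [reflection_apply p, rotation_apply, reflection_apply, rotation_apply]
    have h := sqrt_two_sq
    ext i; fin_cases i <;> simp
    · linear_combination p 0 / 2 * h
    · linear_combination p 1 / 2 * h
  · refine Set.Subset.antisymm h2.image_subset fun p hp => ?_
    refine ⟨_, h2 hp, ?_⟩
    rw [reflection_apply p, reflection_apply]
    ext i; fin_cases i <;> simp

/-! ### The extreme points -/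

/-- The tips of the cell. -/
def apex (i : Fin 8) : Plane := (1 / 2 : ℝ) • (e i + e (i + 1))

theorem tip_eq (n : ℕ) (t : Fin 8) : tip n t = apex t - rho ^ n • apex t := by
  induction n with
  | zero => simp [tip]
  | succ n ih =>
    have h : v t = √2 • apex t := by rw [v, apex, smul_smul]; congr 1; ring
    rw [tip_succ, vx_eq, ih, h, rho_pow_succ n]
    module

theorem apex_mem_cell (t : Fin 8) : apex t ∈ cell := by
  have h1 : Tendsto (fun n : ℕ => tip (n + 1) t) atTop (𝓝 (apex t)) := by
    have := ((tendsto_rho_pow 1).comp (tendsto_add_atTop_nat 1)).smul_const (apex t)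
    simp only [zero_smul] at this
    simpa [tip_eq] using (tendsto_const_nhds (x := apex t)).sub this
  rw [cell_eq]
  exact isClosed_closure.mem_of_tendsto h1
    (Eventually.of_forall fun n => ((isRed_tip_succ n t t).2 rfl).mem_closure_redLimit)

theorem norm_sq_eq (p : Plane) : ‖p‖ ^ 2 = p 0 ^ 2 + p 1 ^ 2 := by
  simp [EuclideanSpace.norm_sq_eq]

theorem inner_e_smul_add (i : Fin 8) (a b : ℝ) :
    ip i (a • e i + b • e (i + 1)) = a + √2 / 2 * b ∧
      ip (i + 1) (a • e i + b • e (i + 1)) = √2 / 2 * a + b := by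
  simp only [map_add, map_smul, smul_eq_mul, ip_e_self, ip_e_succ, ip_succ_e]
  constructor <;> ring

theorem norm_sq_smul_add (i : Fin 8) (a b : ℝ) :
    ‖a • e i + b • e (i + 1)‖ ^ 2 = a * (a + √2 / 2 * b) + b * (√2 / 2 * a + b) := by
  obtain ⟨h1, h2⟩ := inner_e_smul_add i a b
  rw [← real_inner_self_eq_norm_sq, inner_add_left, real_inner_smul_left, real_inner_smul_left]
  change a * ip i _ + b * ip (i + 1) _ = _
  rw [h1, h2]

theorem norm_sq_apex (i : Fin 8) : ‖apex i‖ ^ 2 = kappa := by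
  rw [apex, smul_add, norm_sq_smul_add, kappa]; ring

/-- The cell lies in the regular octagon of inradius `kappa`. As `kappa = cos² (π / 8)`, its squared
circumradius is again `kappa`, attained only at the vertices `apex i`. -/
theorem norm_sq_le_of_mem_cell {p : Plane} (hp : p ∈ cell) :
    ‖p‖ ^ 2 ≤ kappa ∧ (‖p‖ ^ 2 = kappa → ∃ i, p = apex i) := by
  obtain ⟨i, h1, h2⟩ := exists_cone p
  obtain ⟨a, b, ha, hb, rfl⟩ : ∃ a b : ℝ, 0 ≤ a ∧ 0 ≤ b ∧ p = a • e i + b • e (i + 1) :=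
    ⟨√2 * ip (i - 1) p, √2 * ip (i + 2) p, by positivity, by positivity, eq_cone_coords i p⟩
  have c1 := ip_le_of_mem_cell hp i
  have c2 := ip_le_of_mem_cell hp (i + 1)
  obtain ⟨e1, e2⟩ := inner_e_smul_add i a b
  rw [e1] at c1
  rw [e2] at c2
  rw [norm_sq_smul_add]
  have m1 := mul_le_mul_of_nonneg_left c1 ha
  have m2 := mul_le_mul_of_nonneg_left c2 hb
  have hk : kappa = (1 + √2 / 2) / 2 := by rw [kappa]; ring
  have hs := sqrt_two_gt
  have hs' := sqrt_two_lt
  have hab : a + b ≤ 1 := by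
    rw [hk] at c1 c2
    by_contra! h
    nlinarith
  have m3 : kappa * (a + b) ≤ kappa := by nlinarith [lt_kappa]
  refine ⟨by linarith, fun h => ⟨i, ?_⟩⟩
  have hab' : a + b = 1 := by nlinarith [lt_kappa]
  have hba : b = 1 - a := by linarith
  subst hba
  rw [hk] at c1 c2
  have ha2 : a = 1 / 2 := by nlinarith
  rw [ha2, apex, smul_add]
  norm_num

theorem apex_add_four (i : Fin 8) : apex (i + 4) = -apex i := by
  rw [apex, apex, e_add_four, show i + 4 + 1 = i + 1 + 4 by grind, e_add_four]; module

/-- It is not yet known that `φ` fixes the origin. By the parallelogram law, two points of squared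
norm at most `kappa` with squared distance `4 * kappa` are opposite and of maximal norm. -/
theorem map_apex {φ : Plane ≃ᵢ Plane} (hφ : φ ∈ symmetryGroup cell) (i : Fin 8) :
    φ (apex (i + 4)) = -φ (apex i) ∧ ∃ j, φ (apex i) = apex j := by
  have hm (i : Fin 8) : φ (apex i) ∈ cell := by
    have h : φ '' cell = cell := hφ
    rw [← h]
    exact Set.mem_image_of_mem _ (apex_mem_cell i)
  obtain ⟨a1, a2⟩ := norm_sq_le_of_mem_cell (hm i)
  obtain ⟨b1, b2⟩ := norm_sq_le_of_mem_cell (hm (i + 4))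
  have hd := φ.dist_eq (apex i) (apex (i + 4))
  have hn : ‖φ (apex i) - φ (apex (i + 4))‖ ^ 2 = 4 * kappa := by
    rw [← dist_eq_norm, hd, dist_eq_norm, apex_add_four, sub_neg_eq_add, ← two_smul ℝ, norm_smul,
      mul_pow, norm_sq_apex]
    norm_num
  have hpar := parallelogram_law_with_norm ℝ (φ (apex i)) (φ (apex (i + 4)))
  have h0 : ‖φ (apex i) + φ (apex (i + 4))‖ ^ 2 ≤ 0 := by nlinarith
  have h1 : φ (apex i) + φ (apex (i + 4)) = 0 := by
    rw [← norm_eq_zero, ← sq_eq_zero_iff]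
    exact le_antisymm h0 (sq_nonneg _)
  have h2 : φ (apex (i + 4)) = -φ (apex i) := (neg_eq_of_add_eq_zero_right h1).symm
  refine ⟨h2, a2 ?_⟩
  rw [h2, norm_neg] at hpar
  rw [h2, sub_neg_eq_add, ← two_smul ℝ, norm_smul, mul_pow] at hn
  norm_num at hn
  linarith

theorem map_zero_of_mem {φ : Plane ≃ᵢ Plane} (hφ : φ ∈ symmetryGroup cell) : φ 0 = 0 := by
  obtain ⟨h1, j, h2⟩ := map_apex hφ 0
  have d1 := φ.dist_eq 0 (apex 0)
  have d2 := φ.dist_eq 0 (apex (0 + 4))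
  rw [h1, h2, dist_eq_norm, sub_neg_eq_add, dist_eq_norm, apex_add_four, zero_sub, neg_neg] at d2
  rw [h2, dist_eq_norm, dist_eq_norm, zero_sub, norm_neg] at d1
  have hpar := parallelogram_law_with_norm ℝ (φ 0) (apex j)
  rw [d1, d2] at hpar
  have e1 := norm_sq_apex 0
  have e2 := norm_sq_apex j
  rw [← norm_eq_zero, ← sq_eq_zero_iff]
  nlinarith

theorem eq_one_of_fix {φ : Plane ≃ᵢ Plane} (h0 : φ 0 = 0) (h1 : φ (apex 0) = apex 0)
    (h2 : φ (apex 1) = apex 1) : φ = 1 := by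
  ext1 p
  change φ p = p
  have key (a : Plane) (ha : φ a = a) : ‖φ p - a‖ ^ 2 = ‖p - a‖ ^ 2 := by
    have := φ.dist_eq p a
    rw [ha, dist_eq_norm, dist_eq_norm] at this
    rw [this]
  have k0 := key 0 h0
  have k1 := key _ h1
  have k2 := key _ h2
  have hs := sqrt_two_gt
  have hs2 := sqrt_two_sq
  rw [norm_sq_eq, norm_sq_eq] at k0 k1 k2
  simp [apex, e_zero, e_one, e_two] at k0 k1 k2
  generalize φ p = q at *
  have l1 : (1 + √2 / 2) * (q 0 - p 0) + √2 / 2 * (q 1 - p 1) = 0 := by linarith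
  have l2 : √2 / 2 * (q 0 - p 0) + (1 + √2 / 2) * (q 1 - p 1) = 0 := by linarith
  have l3 : q 0 - p 0 = q 1 - p 1 := by linarith
  have l4 : (1 + √2) * (q 1 - p 1) = 0 := by rw [l3] at l1; linarith
  have l5 : q 1 - p 1 = 0 := by
    rcases mul_eq_zero.1 l4 with h | h
    · linarith
    · exact h
  ext i
  fin_cases i
  · change q 0 = p 0; linarith
  · change q 1 = p 1; linarith

/-! ### The symmetry group -/

theorem rotation_apex (i : Fin 8) :
    rotation (2 * Real.pi / (8 : ℕ)) (apex i) = apex (i + 1) := by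
  rw [apex, map_smul_add_of_add_smul rotation_add_smul, rotation_e, rotation_e, apex]

theorem reflection_apex (i : Fin 8) : reflection (apex i) = apex (-i - 1) := by
  rw [apex, map_smul_add_of_add_smul reflection_add_smul, reflection_e, reflection_e, apex,
    add_comm (e (-i)), sub_add_cancel, neg_add']

theorem exists_dihedral_add (k : ℕ) :
    ∃ γ ∈ dihedral 8, ∀ i, γ (apex i) = apex (i + Fin.ofNat 8 k) := by
  induction k with
  | zero => exact ⟨1, one_mem _, fun i => by simp⟩
  | succ k ih =>
    obtain ⟨γ, hγ, h⟩ := ih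
    refine ⟨rotation (2 * Real.pi / (8 : ℕ)) * γ,
      mul_mem (Subgroup.subset_closure (Or.inl rfl)) hγ, fun i => ?_⟩
    have hk : Fin.ofNat 8 (k + 1) = Fin.ofNat 8 k + 1 := by
      ext; simp [Fin.ofNat, Fin.val_add]
    change rotation _ (γ (apex i)) = _
    rw [h, rotation_apex, hk, add_assoc]

theorem dist_apex_sq (i j : Fin 8) : dist (apex i) (apex j) ^ 2 =
    2 * kappa - 1 / 2 * (ip i (e j) + ip i (e (j + 1)) + ip (i + 1) (e j) + ip (i + 1) (e (j + 1))) := by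
  rw [dist_eq_norm, norm_sub_sq_real, norm_sq_apex, norm_sq_apex, apex, apex, real_inner_smul_left,
    real_inner_smul_right, inner_add_left, inner_add_right, inner_add_right]
  change _ - 2 * (_ * (_ * (ip i _ + ip i _ + (ip (i + 1) _ + ip (i + 1) _)))) + _ = _
  ring

theorem eq_of_dist_apex (k : Fin 8) (h : dist (apex 0) (apex k) = dist (apex 0) (apex 1)) :
    k = 1 ∨ k = 7 := by
  have hs := sqrt_two_gt
  have h2 := sqrt_two_sq
  have h1 : dist (apex 0) (apex k) ^ 2 = dist (apex 0) (apex 1) ^ 2 := by rw [h]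
  simp only [dist_apex_sq, zero_add, ip_apply] at h1
  clear h
  revert k
  refine forall_fin_eight ?_ ?_ ?_ ?_ ?_ ?_ ?_ ?_ <;> intro h1
  any_goals decide
  all_goals
    exfalso
    simp [e_zero, e_one, e_two, e_three, e_four, e_five, e_six, e_seven] at h1
    linarith

/-- Rotations reduce to the case that `apex 0` is fixed. Then `apex 1` goes to one of the two apices
next to `apex 0`, and a reflection fixing `apex 0` exchanges these; an isometry fixing `0`, `apex 0`
and `apex 1` is the identity. -/
theorem symmetryGroup_le : symmetryGroup cell ≤ dihedral 8 := by
  have key (φ : Plane ≃ᵢ Plane) (hφ : φ ∈ symmetryGroup cell) (h : φ (apex 0) = apex 0) :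
      φ ∈ dihedral 8 := by
    obtain ⟨-, k, hk⟩ := map_apex hφ 1
    have hd := φ.dist_eq (apex 0) (apex 1)
    rw [h, hk] at hd
    rcases eq_of_dist_apex k hd with rfl | rfl
    · rw [eq_one_of_fix (map_zero_of_mem hφ) h hk]
      exact one_mem _
    · set γ := rotation (2 * Real.pi / (8 : ℕ)) * reflection
      have hγ : γ ∈ dihedral 8 := mul_mem (Subgroup.subset_closure (Or.inl rfl))
        (Subgroup.subset_closure (Or.inr rfl))
      have hγa (i : Fin 8) : γ (apex i) = apex (-i) := by
        change rotation _ (reflection _) = _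
        rw [reflection_apex, rotation_apex, sub_add_cancel]
      have := eq_one_of_fix (φ := γ * φ) (map_zero_of_mem (mul_mem (dihedral_le hγ) hφ))
        (by change γ (φ _) = _; rw [h, hγa]; rfl) (by change γ (φ _) = _; rw [hk, hγa]; rfl)
      rw [eq_inv_of_mul_eq_one_right this]
      exact inv_mem hγ
  intro φ hφ
  obtain ⟨-, j, hj⟩ := map_apex hφ 0
  obtain ⟨γ, hγ, h⟩ := exists_dihedral_add (-j : Fin 8)
  have h1 := key (γ * φ) (mul_mem (dihedral_le hγ) hφ) (by
    change γ (φ _) = _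
    rw [hj, h, Fin.ofNat_val_eq_self, add_neg_cancel])
  have := mul_mem (inv_mem hγ) h1
  rwa [inv_mul_cancel_left] at this

theorem symmetryGroup_cell : symmetryGroup cell = dihedral 8 :=
  le_antisymm symmetryGroup_le dihedral_le

end Elser

end

theorem mainTheorem3 :
    IsCompact Elser.cell ∧
      Tendsto (fun n => Metric.hausdorffEDist (Elser.stage n) Elser.cell) atTop (𝓝 0) ∧
      Elser.IsFundamentalCell Elser.squareLattice Elser.cell ∧
      Elser.symmetryGroup Elser.cell = Elser.dihedral 8 :=
  ⟨Elser.isCompact_cell, Elser.tendsto_hausdorffEDist, Elser.isFundamentalCell_cell,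
    Elser.symmetryGroup_cell⟩
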